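/- For an integer $L\ge 1$ let $\Lambda=\Lambda_L=\{-L,\dots,L\}^2\subset\mathbb Z^2$, let $x\sim y$ mean that $x,y\in\mathbb Z^2$ are nearest neighbours, and let $\partial\Lambda$ be the set of points of $\mathbb Z^2\setminus\Lambda$ that have a nearest neighbour in $\Lambda$. For $\sigma\in\Omega_\Lambda=\{-1,+1\}^{\Lambda}$ let $$H(\sigma)=-\sum_{\{x,y\}\subset\Lambda,\ x\sim y}\sigma_x\sigma_y-\sum_{x\in\Lambda,\ y\in\partial\Lambda,\ x\sim y}\sigma_x$$ be the Ising Hamiltonian with "$+$" boundary condition (each nearest-neighbour pair in $\Lambda$ is counted once), and for $\beta\in[0,\infty)$ let $\pi=\pi_{\beta,L}$ be the Gibbs measure on $\Omega_\Lambda$ with $\pi(\sigma)\propto e^{-\beta H(\sigma)}$. Consider the Glauber dynamics in which each spin is resampled at rate $1$ from its conditional law under $\pi$ given all the other spins, that is, the Markov chain with generator $$(\mathcal L f)(\sigma)=\sum_{x\in\Lambda}\bigl(\pi(f\mid\sigma_y,\,y\neq x)-f(\sigma)\bigr),$$ and let its spectral gap be $$\mathrm{gap}=\mathrm{gap}(\beta,L)=\inf_f\frac{\pi\bigl(f(-\mathcal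 L)f\bigr)}{\mathrm{Var}_\pi(f)},$$ the infimum being over non-constant $f:\Omega_\Lambda\to\mathbb R$. **Theorem.** There exist constants $C,c>0$ such that for every integer $L\ge1$ and every $\beta\in[C\log L,+\infty)$, $$\frac cL\le \mathrm{gap}(\beta,L)\le\frac1{cL}.$$ -/

import Mathlib

namespace IsingGlauber

noncomputable section

/-- Nearest neighbours in `ℤ^d`: points at `ℓ¹`-distance one. -/
def Nbr {d : ℕ} (x y : Fin d → ℤ) : Prop := ∑ i, |x i - y i| = 1

instance {d : ℕ} (x y : Fin d → ℤ) : Decidable (Nbr x y) :=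
  inferInstanceAs (Decidable (∑ i, |x i - y i| = 1))

/-- The outer boundary `∂Λ`: points outside `Λ` having a nearest neighbour in `Λ`
(see `mem_outerBoundary`). -/
def outerBoundary {d : ℕ} (Λ : Finset (Fin d → ℤ)) : Finset (Fin d → ℤ) :=
  (Λ.biUnion fun y => (Finset.Icc (y - 1) (y + 1)).filter fun x => Nbr x y) \ Λ

theorem mem_outerBoundary {d : ℕ} (Λ : Finset (Fin d → ℤ)) (x : Fin d → ℤ) :
    x ∈ outerBoundary Λ ↔ x ∉ Λ ∧ ∃ y ∈ Λ, Nbr x y := by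
  have key : ∀ y : Fin d → ℤ, Nbr x y → x ∈ Finset.Icc (y - 1) (y + 1) := by
    intro y h
    have hi : ∀ i, |x i - y i| ≤ 1 := fun i =>
      (Finset.single_le_sum (f := fun j => |x j - y j|) (fun j _ => abs_nonneg _)
        (Finset.mem_univ i)).trans_eq h
    rw [Finset.mem_Icc]
    constructor <;> intro i <;> have := abs_le.mp (hi i) <;>
      simp only [Pi.sub_apply, Pi.add_apply, Pi.one_apply] <;> omega
  simp only [outerBoundary, Finset.mem_sdiff, Finset.mem_biUnion, Finset.mem_filter]
  constructor
  · rintro ⟨⟨y, hy, -, h⟩, hx⟩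
    exact ⟨hx, y, hy, h⟩
  · rintro ⟨hx, y, hy, h⟩
    exact ⟨⟨y, hy, key y h, h⟩, hx⟩

/-- Spin configurations on `Λ`. The spin space `{-1, +1}` is the unit group `ℤˣ`. -/
abbrev Config {d : ℕ} (Λ : Finset (Fin d → ℤ)) : Type := Λ → ℤˣ

/-- The numerical value `±1` of a spin. -/
def spin (s : ℤˣ) : ℝ := ((s : ℤ) : ℝ)

/-- The Ising Hamiltonian on `Λ` with boundary condition `η` on `∂Λ`. Every nearest neighbour
pair inside `Λ` is counted once: the first sum runs over ordered pairs, whence the factor `1/2`. -/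
def hamiltonian {d : ℕ} (Λ : Finset (Fin d → ℤ)) (η : Config (outerBoundary Λ))
    (σ : Config Λ) : ℝ :=
  -((1 / 2 : ℝ) * ∑ x : Λ, ∑ y : Λ, if Nbr x.1 y.1 then spin (σ x) * spin (σ y) else 0)
    - ∑ x : Λ, ∑ y : outerBoundary Λ, if Nbr x.1 y.1 then spin (σ x) * spin (η y) else 0

/-- The partition function. -/
def partitionFunction {d : ℕ} (β : ℝ) (Λ : Finset (Fin d → ℤ))
    (η : Config (outerBoundary Λ)) : ℝ :=
  ∑ σ : Config Λ, Real.exp (-β * hamiltonian Λ η σ)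

/-- The weight that the Gibbs measure gives to the configuration `σ`. -/
def gibbs {d : ℕ} (β : ℝ) (Λ : Finset (Fin d → ℤ)) (η : Config (outerBoundary Λ))
    (σ : Config Λ) : ℝ :=
  Real.exp (-β * hamiltonian Λ η σ) / partitionFunction β Λ η

/-- Expectation with respect to the Gibbs measure. -/
def expect {d : ℕ} (β : ℝ) (Λ : Finset (Fin d → ℤ)) (η : Config (outerBoundary Λ))
    (f : Config Λ → ℝ) : ℝ :=
  ∑ σ, gibbs β Λ η σ * f σ

/-- Variance with respect to the Gibbs measure. -/
def variance {d : ℕ} (β : ℝ) (Λ : Finset (Fin d → ℤ)) (η : Config (outerBoundary Λ))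
    (f : Config Λ → ℝ) : ℝ :=
  expect β Λ η fun σ => (f σ - expect β Λ η f) ^ 2

/-- The configurations that agree with `σ` at all sites other than `x`. -/
def agreeOff {d : ℕ} {Λ : Finset (Fin d → ℤ)} (x : Λ) (σ : Config Λ) : Finset (Config Λ) :=
  Finset.univ.filter fun τ => ∀ y, y ≠ x → τ y = σ y

/-- The conditional Gibbs expectation of `f` given the spins `σ y`, `y ≠ x`. -/
def siteCondExpect {d : ℕ} (β : ℝ) (Λ : Finset (Fin d → ℤ)) (η : Config (outerBoundary Λ))
    (x : Λ) (σ : Config Λ) (f : Config Λ → ℝ) : ℝ :=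
  (∑ τ ∈ agreeOff x σ, gibbs β Λ η τ * f τ) / ∑ τ ∈ agreeOff x σ, gibbs β Λ η τ

/-- The generator of the Glauber (heat bath) dynamics, in which each spin is resampled at rate
one from its conditional Gibbs distribution given the other spins. -/
def generator {d : ℕ} (β : ℝ) (Λ : Finset (Fin d → ℤ)) (η : Config (outerBoundary Λ))
    (f : Config Λ → ℝ) (σ : Config Λ) : ℝ :=
  ∑ x : Λ, (siteCondExpect β Λ η x σ f - f σ)

/-- The spectral gap: the infimum of `π(f (-𝓛) f) / Var_π(f)` over non-constant functions. -/
def spectralGap {d : ℕ} (β : ℝ) (Λ : Finset (Fin d → ℤ)) (η : Config (outerBoundary Λ)) : ℝ :=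
  sInf {r : ℝ | ∃ f : Config Λ → ℝ, (¬ ∃ a : ℝ, ∀ σ, f σ = a) ∧
    r = expect β Λ η (fun σ => f σ * -generator β Λ η f σ) / variance β Λ η f}

/-- The cubic box `{-L, …, L}^d`. -/
def box (d L : ℕ) : Finset (Fin d → ℤ) :=
  Finset.Icc (fun _ => -(L : ℤ)) (fun _ => (L : ℤ))

/-- The all-plus boundary condition. -/
def plusBoundary {d : ℕ} (Λ : Finset (Fin d → ℤ)) : Config (outerBoundary Λ) := fun _ => 1

end

end IsingGlauber

/-! ### Single-spin flips, the Dirichlet form and variational bounds on the gap. -/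

namespace IsingGlauber
open Finset

/-! Every flip that raises the energy has rate at most `exp (-4β)`, which is negligible even after
multiplication by `L ^ 3`. What remains is essentially zero-temperature dynamics: a spin with
exactly two minus neighbours flips at rate `1/2`, and a minus spin with at most one minus neighbour
flips at rate almost one. Both bounds on the gap describe how droplets of minus spins evolve by
flips at their corners.

Lower bound. By Barta's method (`le_spectralGap`) it suffices to find `W > 0` with `𝓛 W ≤ -λ W` away
from the all-plus state. The choice is `W = exp (α * cost)` with `α = 1 / (4 N)` and `N = 2 L + 1`,
where `cost` is the least total `blockCost` over partitions of the minus set. A block pays `3 N`,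
plus `N` for each coordinate value in its two spans, plus one for each site of its quadrant hull.
Merging touching blocks saves at least `3 N` (`blockCost_union`), so in an optimal partition
adjacent minus sites share a block. A neutral flip to minus raises the cost by at most one, and
raises it only at a growth site of a block. Removing a corner lowers it by at least one. For each
block and each of the four quadrant types, corners outnumber growth sites (`card_growth_lt`), so the
cost drifts down. There are at most `N` growth sites of each type, so the convexity correction, of
order `α ^ 2 * N`, does not destroy the drift. This gives `λ = α / 2 = 1 / (8 N)`. Only `L = 1` with
small `β` escapes, and `exists_le_spectralGap` covers it.

Upper bound. The test functions live on droplets whose boundary in each quadrant is a staircase path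
with `w` horizontal and `k` vertical steps. Neutral flips exchange adjacent unequal steps of a path,
and every other flip has rate at most `exp (-4β)` and leaves the support. On paths this is the
Heisenberg ferromagnet, for which a product state whose angle turns slowly from `0` to `π / 2` has
energy of order `1 / p`. Since the exchanges conserve the number of horizontal steps, some sector
inherits this bound (`exists_sector`). The end angles force each path to start horizontally and end
vertically, so the four quadrants fit together. Two values of `p` give two functions with disjoint
supports and Rayleigh quotients of order `1 / L`, and a combination of them has mean zero
(`spectralGap_le_of_two`). -/

theorem nbr_iff (x y : Fin 2 → ℤ) : Nbr x y ↔
    (x 0 = y 0 ∧ (x 1 = y 1 + 1 ∨ x 1 = y 1 - 1)) ∨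
      (x 1 = y 1 ∧ (x 0 = y 0 + 1 ∨ x 0 = y 0 - 1)) := by
  unfold Nbr
  rw [Fin.sum_univ_two]
  rcases abs_cases (x 0 - y 0) with ⟨h, _⟩ | ⟨h, _⟩ <;>
  rcases abs_cases (x 1 - y 1) with ⟨h', _⟩ | ⟨h', _⟩ <;> rw [h, h'] <;> omega

theorem point_ext {x y : Fin 2 → ℤ} (h0 : x 0 = y 0) (h1 : x 1 = y 1) : x = y := by
  funext i; fin_cases i <;> assumption

theorem Nbr.symm {x y : Fin 2 → ℤ} (h : Nbr x y) : Nbr y x := by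
  rw [nbr_iff] at *; omega

/-- The four nearest neighbours of a point of the square lattice. -/
def nbrs (x : Fin 2 → ℤ) : Finset (Fin 2 → ℤ) :=
  {![x 0 + 1, x 1], ![x 0 - 1, x 1], ![x 0, x 1 + 1], ![x 0, x 1 - 1]}

theorem mem_nbrs {x y : Fin 2 → ℤ} : y ∈ nbrs x ↔ Nbr x y := by
  rw [nbr_iff]
  simp only [nbrs, mem_insert, mem_singleton]
  have key : ∀ a b : ℤ, y = ![a, b] ↔ y 0 = a ∧ y 1 = b := by
    intro a b
    constructor
    · rintro rfl; simp
    · rintro ⟨h0, h1⟩; exact point_ext (by simpa using h0) (by simpa using h1)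
  simp only [key]
  omega

theorem card_nbrs (x : Fin 2 → ℤ) : (nbrs x).card = 4 := by
  have key : ∀ a b c d : ℤ, (![a, b] : Fin 2 → ℤ) = ![c, d] ↔ a = c ∧ b = d := by
    intro a b c d; simp
  unfold nbrs
  rw [card_insert_of_notMem, card_insert_of_notMem, card_insert_of_notMem, card_singleton] <;>
  simp only [mem_insert, mem_singleton, key] <;> omega

variable {Λ : Finset (Fin 2 → ℤ)}

/-- The set of sites carrying a minus spin. -/
def minusSet (σ : Config Λ) : Finset (Fin 2 → ℤ) :=
  (univ.filter fun x : Λ => σ x = -1).map (Function.Embedding.subtype _)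

theorem mem_minusSet {σ : Config Λ} {z : Fin 2 → ℤ} :
    z ∈ minusSet σ ↔ ∃ h : z ∈ Λ, σ ⟨z, h⟩ = -1 := by
  simp [minusSet]

theorem coe_mem_minusSet {σ : Config Λ} {x : Λ} : x.1 ∈ minusSet σ ↔ σ x = -1 := by
  rw [mem_minusSet]; simp

theorem minusSet_subset (σ : Config Λ) : minusSet σ ⊆ Λ := fun z hz => by
  rw [mem_minusSet] at hz; exact hz.1

/-- The number of neighbours of `x` in the set `A`. -/
def nbrCount (A : Finset (Fin 2 → ℤ)) (x : Fin 2 → ℤ) : ℕ := (A.filter fun y => Nbr x y).card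

theorem nbrCount_le_four (A : Finset (Fin 2 → ℤ)) (x : Fin 2 → ℤ) : nbrCount A x ≤ 4 := by
  rw [← card_nbrs x]
  refine card_le_card fun y hy => ?_
  rw [mem_filter] at hy
  exact mem_nbrs.2 hy.2

/-- The configuration with the spin at `x` reversed. -/
def flip (x : Λ) (σ : Config Λ) : Config Λ := Function.update σ x (-σ x)

@[simp] theorem flip_self (x : Λ) (σ : Config Λ) : flip x σ x = -σ x := by simp [flip]

theorem flip_of_ne {x y : Λ} (h : y ≠ x) (σ : Config Λ) : flip x σ y = σ y := by simp [flip, h]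

@[simp] theorem flip_flip (x : Λ) (σ : Config Λ) : flip x (flip x σ) = σ := by
  funext y
  by_cases h : y = x
  · subst h; simp
  · simp [flip_of_ne h]

theorem spin_one : spin 1 = 1 := by simp [spin]
theorem spin_neg (s : ℤˣ) : spin (-s) = -spin s := by simp [spin]
theorem nbrCount_eq_sum (σ : Config Λ) (x : Λ) :
    (nbrCount (minusSet σ) x.1 : ℝ) = ∑ y : Λ, if Nbr x.1 y.1 then (if σ y = -1 then 1 else 0) else 0 := by
  unfold nbrCount minusSet
  rw [filter_map, card_map, filter_filter, card_filter]
  push_cast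
  refine sum_congr rfl fun y _ => ?_
  by_cases h1 : Nbr x.1 y.1 <;> by_cases h2 : σ y = -1 <;> simp [h1, h2]

/-- All four neighbours of a site of `Λ` lie in `Λ` or in its outer boundary, so the plus boundary
spins complete the local field. -/
theorem nbr_total (x : Λ) :
    (∑ y : Λ, if Nbr x.1 y.1 then (1 : ℝ) else 0) +
      (∑ y : outerBoundary Λ, if Nbr x.1 y.1 then (1 : ℝ) else 0) = 4 := by
  rw [univ_eq_attach, sum_attach Λ (fun y => if Nbr x.1 y then (1 : ℝ) else 0), univ_eq_attach,
    sum_attach (outerBoundary Λ) (fun y => if Nbr x.1 y then (1 : ℝ) else 0), ← sum_union]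
  · rw [← sum_filter, sum_const, nsmul_eq_mul, mul_one]
    have : (Λ ∪ outerBoundary Λ).filter (fun y => Nbr x.1 y) = nbrs x.1 := by
      ext y
      rw [mem_filter, mem_nbrs, mem_union, mem_outerBoundary]
      constructor
      · exact fun h => h.2
      · intro h
        refine ⟨?_, h⟩
        by_cases hy : y ∈ Λ
        · exact Or.inl hy
        · exact Or.inr ⟨hy, x.1, x.2, h.symm⟩
    rw [this, card_nbrs]; norm_num
  · rw [disjoint_right]
    intro y hy
    exact ((mem_outerBoundary Λ y).1 hy).1

/-- The local field at `x`. -/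
theorem local_field (σ : Config Λ) (x : Λ) :
    (∑ y : Λ, if Nbr x.1 y.1 then spin (σ y) else 0) +
      (∑ y : outerBoundary Λ, if Nbr x.1 y.1 then (1 : ℝ) else 0)
      = 4 - 2 * (nbrCount (minusSet σ) x.1 : ℝ) := by
  have h : ∀ y : Λ, (if Nbr x.1 y.1 then spin (σ y) else 0) =
      (if Nbr x.1 y.1 then (1 : ℝ) else 0) -
        2 * (if Nbr x.1 y.1 then (if σ y = -1 then 1 else 0) else 0) := by
    intro y
    rcases Int.units_eq_one_or (σ y) with h | h <;> by_cases h1 : Nbr x.1 y.1 <;>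
      (simp [h, h1, spin]; try norm_num)
  rw [sum_congr rfl fun y _ => h y, sum_sub_distrib, ← mul_sum, ← nbrCount_eq_sum]
  have := nbr_total x
  linarith

/-- Only the bonds at `x` change sign, so the energy changes by twice the spin times its local
field. Boundary neighbours count as plus. -/
theorem hamiltonian_flip (σ : Config Λ) (x : Λ) :
    hamiltonian Λ (plusBoundary Λ) (flip x σ) = hamiltonian Λ (plusBoundary Λ) σ
      + 2 * spin (σ x) * (4 - 2 * (nbrCount (minusSet σ) x.1 : ℝ)) := by
  set J : Λ → Λ → ℝ := fun y z => if Nbr y.1 z.1 then 1 else 0 with hJ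
  set b : Λ → ℝ := fun y => ∑ z : outerBoundary Λ, if Nbr y.1 z.1 then (1 : ℝ) else 0 with hb
  have hH : ∀ τ : Config Λ, hamiltonian Λ (plusBoundary Λ) τ =
      -(1 / 2 * ∑ y, ∑ z, J y z * (spin (τ y) * spin (τ z))) - ∑ y, spin (τ y) * b y := by
    intro τ
    unfold hamiltonian plusBoundary
    congr 1
    · congr 2
      refine sum_congr rfl fun y _ => sum_congr rfl fun z _ => ?_
      simp only [hJ]; split_ifs <;> simp
    · refine sum_congr rfl fun y _ => ?_
      rw [hb, mul_sum]
      refine sum_congr rfl fun z _ => ?_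
      split_ifs <;> simp [spin_one]
  have hs : ∀ y, spin (flip x σ y) = spin (σ y) - 2 * spin (σ x) * (if y = x then 1 else 0) := by
    intro y
    by_cases h : y = x
    · subst h; simp [spin_neg]; ring
    · simp [flip_of_ne h, h]
  have hsym : ∀ y z, J y z = J z y := by
    intro y z
    simp only [hJ]
    congr 1
    exact propext ⟨Nbr.symm, Nbr.symm⟩
  have hxx : J x x = 0 := by
    simp only [hJ, nbr_iff, ite_eq_right_iff]; omega
  have hf : (∑ y, J x y * spin (σ y)) + b x = 4 - 2 * (nbrCount (minusSet σ) x.1 : ℝ) := by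
    rw [← local_field]
    congr 1
    refine sum_congr rfl fun y _ => ?_
    simp only [hJ]; split_ifs <;> simp
  rw [hH, hH, ← hf]
  have e1 : ∑ y, ∑ z, J y z * (spin (flip x σ y) * spin (flip x σ z)) =
      (∑ y, ∑ z, J y z * (spin (σ y) * spin (σ z)))
        - 4 * spin (σ x) * ∑ y, J x y * spin (σ y) := by
    -- The symmetric form is expanded around the flipped coordinate; the quadratic term drops out
    -- because `J x x = 0`.
    have : ∀ y z, J y z * (spin (flip x σ y) * spin (flip x σ z)) =
        J y z * (spin (σ y) * spin (σ z)) - (2 * spin (σ x)) * (if y = x then J y z * spin (σ z) else 0)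
        - (2 * spin (σ x)) * (if z = x then J z y * spin (σ y) else 0)
        + (2 * spin (σ x)) ^ 2 * (if y = x then (if z = x then J y z else 0) else 0) := by
      intro y z
      rw [hs, hs, hsym z y]
      split_ifs <;> ring
    simp only [this, sum_add_distrib, sum_sub_distrib, ← mul_sum, sum_ite_eq', mem_univ, if_true,
      sum_ite_irrel, sum_const_zero, hxx]
    ring
  have e2 : ∑ y, spin (flip x σ y) * b y = ∑ y, spin (σ y) * b y - 2 * spin (σ x) * b x := by
    have : ∀ y, spin (flip x σ y) * b y = spin (σ y) * b y
        - (2 * spin (σ x)) * (if y = x then b y else 0) := by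
      intro y; rw [hs]; split_ifs <;> ring
    simp only [this, sum_sub_distrib, ← mul_sum, sum_ite_eq', mem_univ, if_true]
  rw [e1, e2]; ring

theorem partitionFunction_pos (β : ℝ) : 0 < partitionFunction β Λ (plusBoundary Λ) :=
  sum_pos (fun _ _ => Real.exp_pos _) univ_nonempty

/-- Shorthand for the Gibbs weight with plus boundary condition. -/
noncomputable abbrev gw (β : ℝ) (σ : Config Λ) : ℝ := gibbs β Λ (plusBoundary Λ) σ

theorem gw_pos (β : ℝ) (σ : Config Λ) : 0 < gw β σ :=
  div_pos (Real.exp_pos _) (partitionFunction_pos β)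

theorem sum_gw (β : ℝ) : ∑ σ : Config Λ, gw β σ = 1 := by
  unfold gw gibbs
  rw [← sum_div]
  exact div_self (partitionFunction_pos β).ne'

/-- The energy barrier of the flip at `x`. -/
noncomputable def barrier (x : Λ) (σ : Config Λ) : ℝ :=
  2 * spin (σ x) * (4 - 2 * (nbrCount (minusSet σ) x.1 : ℝ))

theorem gw_flip (β : ℝ) (x : Λ) (σ : Config Λ) :
    gw β (flip x σ) = gw β σ * Real.exp (-β * barrier x σ) := by
  unfold gw gibbs
  rw [hamiltonian_flip, div_mul_eq_mul_div, ← Real.exp_add]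
  unfold barrier
  ring_nf

/-- The rate at which the spin at `x` flips. -/
noncomputable def flipRate (β : ℝ) (x : Λ) (σ : Config Λ) : ℝ :=
  1 / (1 + Real.exp (β * barrier x σ))

theorem flipRate_pos (β : ℝ) (x : Λ) (σ : Config Λ) : 0 < flipRate β x σ := by
  unfold flipRate; positivity

/-- This identifies the logistic function of the barrier with the heat-bath probability; detailed
balance is then immediate. -/
theorem flipRate_eq_div (β : ℝ) (x : Λ) (σ : Config Λ) :
    flipRate β x σ = gw β (flip x σ) / (gw β σ + gw β (flip x σ)) := by
  rw [gw_flip]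
  have := gw_pos β σ
  unfold flipRate
  have e : Real.exp (β * barrier x σ) = (Real.exp (-β * barrier x σ))⁻¹ := by
    rw [← Real.exp_neg]; ring_nf
  rw [e]
  have := Real.exp_pos (-β * barrier x σ)
  field_simp
  ring

theorem detailed_balance (β : ℝ) (x : Λ) (σ : Config Λ) :
    gw β σ * flipRate β x σ = gw β (flip x σ) * flipRate β x (flip x σ) := by
  rw [flipRate_eq_div, flipRate_eq_div, flip_flip, add_comm (gw β (flip x σ))]
  ring

theorem agreeOff_eq (x : Λ) (σ : Config Λ) : agreeOff x σ = {σ, flip x σ} := by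
  ext τ
  simp only [agreeOff, mem_filter, mem_univ, true_and, mem_insert, mem_singleton]
  constructor
  · intro h
    by_cases hx : τ x = σ x
    · left; funext y
      by_cases hy : y = x
      · rw [hy, hx]
      · exact h y hy
    · right; funext y
      by_cases hy : y = x
      · subst hy
        rw [flip_self]
        rcases Int.units_eq_one_or (τ y) with h1 | h1 <;>
          rcases Int.units_eq_one_or (σ y) with h2 | h2 <;> simp_all
      · rw [h y hy, flip_of_ne hy]
  · rintro (rfl | rfl) y hy
    · rfl
    · exact flip_of_ne hy σ

theorem ne_flip (x : Λ) (σ : Config Λ) : σ ≠ flip x σ := by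
  intro h
  have := congrFun h x
  rw [flip_self] at this
  rcases Int.units_eq_one_or (σ x) with h2 | h2 <;> rw [h2] at this <;> revert this <;> decide

theorem generator_eq (β : ℝ) (f : Config Λ → ℝ) (σ : Config Λ) :
    generator β Λ (plusBoundary Λ) f σ = ∑ x : Λ, flipRate β x σ * (f (flip x σ) - f σ) := by
  unfold generator siteCondExpect
  refine sum_congr rfl fun x _ => ?_
  rw [agreeOff_eq, sum_pair (ne_flip x σ), sum_pair (ne_flip x σ), flipRate_eq_div]
  have h1 := gw_pos β σ
  have h2 := gw_pos β (flip x σ)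
  unfold gw at *
  field_simp
  ring

theorem sum_flip (x : Λ) (g : Config Λ → ℝ) : ∑ σ, g (flip x σ) = ∑ σ, g σ :=
  Equiv.sum_comp ⟨flip x, flip x, flip_flip x, flip_flip x⟩ g

/-- Summation by parts: detailed balance lets `σ` and `flip x σ` be interchanged. Two different
functions are needed because Barta's method pairs `(f - a) ^ 2 / W` with `W`. -/
theorem dirichlet_symm (β : ℝ) (f g : Config Λ → ℝ) :
    expect β Λ (plusBoundary Λ) (fun σ => f σ * -generator β Λ (plusBoundary Λ) g σ) =
      1 / 2 * ∑ x : Λ, ∑ σ, gw β σ * flipRate β x σ * ((f (flip x σ) - f σ) * (g (flip x σ) - g σ)) := by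
  have h : ∀ x : Λ, ∑ σ, gw β σ * flipRate β x σ * ((f (flip x σ) - f σ) * (g (flip x σ) - g σ))
      = 2 * ∑ σ, gw β σ * flipRate β x σ * (f σ * (g σ - g (flip x σ))) := by
    intro x
    have h1 : ∑ σ, gw β σ * flipRate β x σ * (f (flip x σ) * (g (flip x σ) - g σ)) =
        ∑ σ, gw β σ * flipRate β x σ * (f σ * (g σ - g (flip x σ))) := by
      rw [← sum_flip x (fun σ => gw β σ * flipRate β x σ * (f σ * (g σ - g (flip x σ))))]
      refine sum_congr rfl fun σ _ => ?_
      rw [← detailed_balance, flip_flip]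
    rw [two_mul]
    nth_rewrite 1 [← h1]
    rw [← sum_add_distrib]
    exact sum_congr rfl fun σ _ => by ring
  rw [sum_congr rfl fun x _ => h x, ← mul_sum, ← mul_assoc, sum_comm]
  rw [show (1 / 2 : ℝ) * 2 = 1 by norm_num, one_mul]
  unfold expect
  refine sum_congr rfl fun σ _ => ?_
  beta_reduce
  rw [generator_eq, mul_neg, mul_neg, mul_sum, mul_sum, ← sum_neg_distrib]
  exact sum_congr rfl fun x _ => by ring

theorem dirichlet_eq (β : ℝ) (f : Config Λ → ℝ) :
    expect β Λ (plusBoundary Λ) (fun σ => f σ * -generator β Λ (plusBoundary Λ) f σ) =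
      1 / 2 * ∑ x : Λ, ∑ σ, gw β σ * flipRate β x σ * (f (flip x σ) - f σ) ^ 2 := by
  rw [dirichlet_symm]
  simp only [sq]

/-- Centring at an arbitrary constant allows the value at the all-plus state to replace the mean. -/
theorem variance_eq (β : ℝ) (f : Config Λ → ℝ) (a : ℝ) :
    variance β Λ (plusBoundary Λ) f =
      ∑ σ, gw β σ * (f σ - a) ^ 2 - (expect β Λ (plusBoundary Λ) f - a) ^ 2 := by
  unfold variance
  set e := expect β Λ (plusBoundary Λ) f with he
  have h1 : ∑ σ : Config Λ, gw β σ * f σ = e := rfl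
  have h : ∀ σ : Config Λ, gw β σ * (f σ - e) ^ 2 = gw β σ * (f σ - a) ^ 2
      - 2 * (e - a) * (gw β σ * f σ) + (e ^ 2 - a ^ 2) * gw β σ := fun σ => by ring
  have h2 : expect β Λ (plusBoundary Λ) (fun σ => (f σ - e) ^ 2) =
      ∑ σ : Config Λ, gw β σ * (f σ - e) ^ 2 := rfl
  rw [h2, sum_congr rfl fun σ _ => h σ, sum_add_distrib, sum_sub_distrib, ← mul_sum, ← mul_sum, h1, sum_gw]
  ring

theorem variance_pos (β : ℝ) {f : Config Λ → ℝ} (hf : ¬ ∃ a : ℝ, ∀ σ, f σ = a) :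
    0 < variance β Λ (plusBoundary Λ) f := by
  unfold variance
  push Not at hf
  obtain ⟨σ, hσ⟩ := hf (expect β Λ (plusBoundary Λ) f)
  unfold expect at *
  refine sum_pos' (s := univ) (f := fun τ => gw β τ * (f τ - ∑ σ, gw β σ * f σ) ^ 2)
    (fun τ _ => mul_nonneg (gw_pos β τ).le (sq_nonneg _)) ⟨σ, mem_univ _, ?_⟩
  exact mul_pos (gw_pos β σ) (by have := sub_ne_zero.2 hσ; positivity)

theorem dirichlet_nonneg (β : ℝ) (f : Config Λ → ℝ) :
    0 ≤ expect β Λ (plusBoundary Λ) (fun σ => f σ * -generator β Λ (plusBoundary Λ) f σ) := by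
  rw [dirichlet_eq]
  refine mul_nonneg (by norm_num) (sum_nonneg fun x _ => sum_nonneg fun σ _ => ?_)
  exact mul_nonneg (mul_nonneg (gw_pos β σ).le (flipRate_pos β x σ).le) (sq_nonneg _)

/-- Barta's method: a positive supersolution away from the plus state bounds the gap below. -/
theorem le_spectralGap (β lam : ℝ) (hΛ : Λ.Nonempty) (hlam : 0 ≤ lam) (W : Config Λ → ℝ)
    (hW : ∀ σ, 0 < W σ)
    (h : ∀ σ : Config Λ, (minusSet σ).Nonempty →
      ∑ x : Λ, flipRate β x σ * (W (flip x σ) - W σ) ≤ -lam * W σ) :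
    lam ≤ spectralGap β Λ (plusBoundary Λ) := by
  unfold spectralGap
  refine le_csInf ?_ ?_
  · obtain ⟨x, hx⟩ := hΛ
    refine ⟨_, fun σ => spin (σ ⟨x, hx⟩), ?_, rfl⟩
    rintro ⟨a, ha⟩
    have h1 := ha (fun _ => 1)
    have h2 := ha (fun _ => -1)
    simp only [spin_one, spin_neg] at h1 h2
    linarith
  · rintro r ⟨f, hf, rfl⟩
    rw [le_div_iff₀ (variance_pos β hf)]
    -- With this centring the all-plus state contributes nothing, so the supersolution inequality is
    -- not needed there.
    set a := f (fun _ => 1) with ha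
    have hv : variance β Λ (plusBoundary Λ) f ≤ ∑ σ, gw β σ * (f σ - a) ^ 2 := by
      rw [variance_eq β f a]; linarith [sq_nonneg (expect β Λ (plusBoundary Λ) f - a)]
    refine (mul_le_mul_of_nonneg_left hv hlam).trans ?_
    have step1 : lam * ∑ σ, gw β σ * (f σ - a) ^ 2 ≤
        expect β Λ (plusBoundary Λ)
          (fun σ => ((f σ - a) ^ 2 / W σ) * -generator β Λ (plusBoundary Λ) W σ) := by
      unfold expect
      rw [mul_sum]
      refine sum_le_sum fun σ _ => ?_
      beta_reduce
      rw [generator_eq]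
      by_cases hσ : (minusSet σ).Nonempty
      · have h1 := h σ hσ
        have h2 : lam * W σ ≤ -∑ x : Λ, flipRate β x σ * (W (flip x σ) - W σ) := by linarith
        have h3 : 0 ≤ (f σ - a) ^ 2 / W σ := div_nonneg (sq_nonneg _) (hW σ).le
        have h4 := mul_le_mul_of_nonneg_left (mul_le_mul_of_nonneg_left h2 h3) (gw_pos β σ).le
        refine le_trans (le_of_eq ?_) h4
        have := (hW σ).ne'
        field_simp
      · have : σ = fun _ => 1 := by
          funext x
          rcases Int.units_eq_one_or (σ x) with h1 | h1
          · exact h1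
          · exact absurd ⟨x.1, coe_mem_minusSet.2 h1⟩ hσ
        have h0 : f σ - a = 0 := by rw [this, ha, sub_self]
        rw [h0]; simp
    refine step1.trans ?_
    rw [dirichlet_symm, dirichlet_eq]
    refine mul_le_mul_of_nonneg_left (sum_le_sum fun x _ => sum_le_sum fun σ _ => ?_) (by norm_num)
    refine mul_le_mul_of_nonneg_left ?_ (mul_nonneg (gw_pos β σ).le (flipRate_pos β x σ).le)
    have h1 := hW σ
    have h2 := hW (flip x σ)
    set u := f σ - a with hu
    set v := f (flip x σ) - a with hv
    have e : f (flip x σ) - f σ = v - u := by rw [hu, hv]; ring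
    rw [e]
    -- This is Picone's identity for one edge; its right-hand side is a square over a positive
    -- number.
    have : (v - u) ^ 2 - (v ^ 2 / W (flip x σ) - u ^ 2 / W σ) * (W (flip x σ) - W σ) =
        (v * W σ - u * W (flip x σ)) ^ 2 / (W σ * W (flip x σ)) := by
      field_simp; ring
    have h3 : 0 ≤ (v * W σ - u * W (flip x σ)) ^ 2 / (W σ * W (flip x σ)) := by positivity
    linarith

theorem spectralGap_le (β : ℝ) (f : Config Λ → ℝ) (K : ℝ) (hf : ¬ ∃ a : ℝ, ∀ σ, f σ = a)
    (h : 1 / 2 * ∑ x : Λ, ∑ σ, gw β σ * flipRate β x σ * (f (flip x σ) - f σ) ^ 2 ≤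
      K * variance β Λ (plusBoundary Λ) f) :
    spectralGap β Λ (plusBoundary Λ) ≤ K := by
  unfold spectralGap
  refine csInf_le_of_le (b := expect β Λ (plusBoundary Λ)
    (fun σ => f σ * -generator β Λ (plusBoundary Λ) f σ) / variance β Λ (plusBoundary Λ) f)
    ?_ ⟨f, hf, rfl⟩ ?_
  · refine ⟨0, ?_⟩
    rintro r ⟨g, hg, rfl⟩
    exact div_nonneg (dirichlet_nonneg β g) (variance_pos β hg).le
  · rw [div_le_iff₀ (variance_pos β hf), dirichlet_eq]
    exact h

end IsingGlauber

/-! ### Quadrant hulls, block costs, corners and growth sites. -/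

namespace IsingGlauber
open Finset

theorem mem_box {L : ℕ} {z : Fin 2 → ℤ} :
    z ∈ box 2 L ↔ (-(L : ℤ) ≤ z 0 ∧ z 0 ≤ L) ∧ (-(L : ℤ) ≤ z 1 ∧ z 1 ≤ L) := by
  unfold box
  rw [mem_Icc, Pi.le_def, Pi.le_def, Fin.forall_fin_two, Fin.forall_fin_two]
  tauto

/-- The sign attached to a direction. -/
def dir (b : Bool) : ℤ := if b then 1 else -1

@[simp] theorem dir_true : dir true = 1 := rfl
@[simp] theorem dir_false : dir false = -1 := rfl

/-- `w` lies in the closed quadrant of type `t` with apex `z`. -/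
def InQuad (t : Bool × Bool) (z w : Fin 2 → ℤ) : Prop :=
  0 ≤ dir t.1 * (w 0 - z 0) ∧ 0 ≤ dir t.2 * (w 1 - z 1)

instance (t : Bool × Bool) (z w : Fin 2 → ℤ) : Decidable (InQuad t z w) :=
  inferInstanceAs (Decidable (_ ∧ _))

/-- The quadrant hull of `S` in the box. -/
noncomputable def hull (L : ℕ) (S : Finset (Fin 2 → ℤ)) : Finset (Fin 2 → ℤ) :=
  (box 2 L).filter fun z => ∀ t : Bool × Bool, ∃ w ∈ S, InQuad t z w

/-- The integer interval spanned by the `i`-th coordinates of the points of `S`. -/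
noncomputable def span (L : ℕ) (i : Fin 2) (S : Finset (Fin 2 → ℤ)) : Finset ℤ :=
  (Icc (-(L : ℤ)) L).filter fun r => (∃ w ∈ S, w i ≤ r) ∧ ∃ w ∈ S, r ≤ w i

/-- The side length of the box. -/
abbrev side (L : ℕ) : ℕ := 2 * L + 1

/-- The cost of a block of minus spins. -/
noncomputable def blockCost (L : ℕ) (S : Finset (Fin 2 → ℤ)) : ℕ :=
  if S = ∅ then 0 else
    3 * side L + side L * ((span L 0 S).card + (span L 1 S).card) + (hull L S).card

theorem mem_hull {L : ℕ} {S : Finset (Fin 2 → ℤ)} {z : Fin 2 → ℤ} :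
    z ∈ hull L S ↔ z ∈ box 2 L ∧ ∀ t : Bool × Bool, ∃ w ∈ S, InQuad t z w := by
  simp [hull]

theorem mem_span {L : ℕ} {i : Fin 2} {S : Finset (Fin 2 → ℤ)} {r : ℤ} :
    r ∈ span L i S ↔ (-(L : ℤ) ≤ r ∧ r ≤ L) ∧ (∃ w ∈ S, w i ≤ r) ∧ ∃ w ∈ S, r ≤ w i := by
  simp [span]

theorem hull_mono {L : ℕ} {S T : Finset (Fin 2 → ℤ)} (h : S ⊆ T) : hull L S ⊆ hull L T := by
  intro z
  rw [mem_hull, mem_hull]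
  rintro ⟨h1, h2⟩
  refine ⟨h1, fun t => ?_⟩
  obtain ⟨w, hw, hq⟩ := h2 t
  exact ⟨w, h hw, hq⟩

theorem span_mono {L : ℕ} {i : Fin 2} {S T : Finset (Fin 2 → ℤ)} (h : S ⊆ T) :
    span L i S ⊆ span L i T := by
  intro r
  rw [mem_span, mem_span]
  rintro ⟨h1, ⟨w, hw, h2⟩, v, hv, h3⟩
  exact ⟨h1, ⟨w, h hw, h2⟩, v, h hv, h3⟩

theorem blockCost_mono {L : ℕ} {S T : Finset (Fin 2 → ℤ)} (h : S ⊆ T) :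
    blockCost L S ≤ blockCost L T := by
  unfold blockCost
  split_ifs with h1 h2 h2
  · rfl
  · exact Nat.zero_le _
  · exact absurd (subset_empty.1 (h2 ▸ h)) h1
  · have a1 := card_le_card (span_mono (L := L) (i := 0) h)
    have a2 := card_le_card (span_mono (L := L) (i := 1) h)
    have a3 := card_le_card (hull_mono (L := L) h)
    gcongr

/-- The constant `6` matters: it is exactly what two mergers, each saving `3 * side L`, pay back in
`cost_insert_of_two_blocks`. -/
theorem blockCost_singleton_le (L : ℕ) (x : Fin 2 → ℤ) : blockCost L {x} ≤ 6 * side L := by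
  unfold blockCost
  rw [if_neg (singleton_ne_empty x)]
  have a1 : ∀ i, (span L i {x}).card ≤ 1 := by
    intro i
    refine (card_le_card (t := {x i}) fun r hr => ?_).trans (card_singleton _).le
    rw [mem_span] at hr
    simp only [mem_singleton, exists_eq_left] at hr ⊢
    omega
  have a3 : (hull L {x}).card ≤ 1 := by
    refine (card_le_card (t := {x}) fun r hr => ?_).trans (card_singleton _).le
    rw [mem_hull] at hr
    simp only [mem_singleton, exists_eq_left, InQuad] at hr ⊢
    have h1 := hr.2 (true, true)
    have h2 := hr.2 (false, false)
    simp only [dir_true, dir_false] at h1 h2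
    exact point_ext (by omega) (by omega)
  have := a1 0
  have := a1 1
  unfold side
  nlinarith

/-- Adjacent points have coordinates differing by at most one, so no integer is left in a gap
between the two intervals. -/
theorem span_union_subset {L : ℕ} {i : Fin 2} {S T : Finset (Fin 2 → ℤ)} {a b : Fin 2 → ℤ}
    (ha : a ∈ S) (hb : b ∈ T) (hab : Nbr a b) :
    span L i (S ∪ T) ⊆ span L i S ∪ span L i T := by
  have hd : a i ≤ b i + 1 ∧ b i ≤ a i + 1 := by
    rw [nbr_iff] at hab
    revert i; rw [Fin.forall_fin_two]; omega
  intro r hr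
  rw [mem_union, mem_span, mem_span]
  rw [mem_span] at hr
  obtain ⟨h1, ⟨w, hw, h2⟩, v, hv, h3⟩ := hr
  rw [mem_union] at hw hv
  by_cases hS : r ∈ span L i S
  · exact Or.inl (mem_span.1 hS)
  by_cases hT : r ∈ span L i T
  · exact Or.inr (mem_span.1 hT)
  exfalso
  have kS : ∀ p ∈ S, ∀ q ∈ S, ¬ (p i ≤ r ∧ r ≤ q i) := fun p hp q hq h =>
    hS (mem_span.2 ⟨h1, ⟨p, hp, h.1⟩, q, hq, h.2⟩)
  have kT : ∀ p ∈ T, ∀ q ∈ T, ¬ (p i ≤ r ∧ r ≤ q i) := fun p hp q hq h =>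
    hT (mem_span.2 ⟨h1, ⟨p, hp, h.1⟩, q, hq, h.2⟩)
  rcases hw with hw | hw <;> rcases hv with hv | hv
  · exact kS w hw v hv ⟨h2, h3⟩
  · have := kS w hw a ha
    have := kT b hb v hv
    omega
  · have := kS a ha v hv
    have := kT w hw b hb
    omega
  · exact kT w hw v hv ⟨h2, h3⟩

theorem strictly_aside {L : ℕ} {i : Fin 2} {S : Finset (Fin 2 → ℤ)} {r : ℤ}
    (h : -(L : ℤ) ≤ r ∧ r ≤ L) (hr : r ∉ span L i S) :
    ∃ v, ∀ w ∈ S, 0 < dir v * (w i - r) := by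
  rw [mem_span] at hr
  by_cases h1 : ∃ w ∈ S, w i ≤ r
  · refine ⟨false, fun w hw => ?_⟩
    have : ¬ r ≤ w i := fun h2 => hr ⟨h, h1, w, hw, h2⟩
    simp only [dir_false]; omega
  · refine ⟨true, fun w hw => ?_⟩
    have : ¬ w i ≤ r := fun h2 => h1 ⟨w, hw, h2⟩
    simp only [dir_true]; omega

/-- Since `S` lies strictly on one side of the row of `z`, only `T` can meet the two quadrants on
the other side, so the column of `z` is in the span of `T` and hence not in that of `S`. Thus `S`
lies in one open quadrant at `z`, and `T` must also serve the third quadrant. In the fourth, `b` is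
adjacent to a point strictly inside, hence lies in the closed quadrant. So `z` would be in the hull
of `T`. -/
theorem hull_union_aux {L : ℕ} {S T : Finset (Fin 2 → ℤ)} {a b z : Fin 2 → ℤ}
    (ha : a ∈ S) (hb : b ∈ T) (hab : Nbr a b) (hz : z ∈ hull L (S ∪ T))
    (hT : z ∉ hull L T) (hr : z 1 ∉ span L 1 S)
    (hc : z 0 ∈ span L 0 S → z 0 ∉ span L 0 T) : False := by
  rw [mem_hull] at hz hT
  obtain ⟨hz1, hz2⟩ := hz
  have hbox := mem_box.1 hz1
  obtain ⟨v, hv⟩ := strictly_aside hbox.2 hr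
  have low : ∀ u, ∃ w ∈ T, InQuad (u, !v) z w := by
    intro u
    obtain ⟨w, hw, hq⟩ := hz2 (u, !v)
    rcases mem_union.1 hw with h | h
    · have := hv w h
      exfalso
      cases v <;> simp [InQuad] at hq this <;> omega
    · exact ⟨w, h, hq⟩
  have hcT : z 0 ∈ span L 0 T := by
    obtain ⟨w, hw, hq⟩ := low true
    obtain ⟨w', hw', hq'⟩ := low false
    simp only [InQuad, dir_true, dir_false] at hq hq'
    exact mem_span.2 ⟨hbox.1, ⟨w', hw', by omega⟩, w, hw, by omega⟩
  have hcS : z 0 ∉ span L 0 S := fun h => hc h hcT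
  obtain ⟨u, hu⟩ := strictly_aside hbox.1 hcS
  have third : ∃ w ∈ T, InQuad (!u, v) z w := by
    obtain ⟨w, hw, hq⟩ := hz2 (!u, v)
    rcases mem_union.1 hw with h | h
    · have := hu w h
      exfalso
      cases u <;> simp [InQuad] at hq this <;> omega
    · exact ⟨w, h, hq⟩
  have fourth : ∃ w ∈ T, InQuad (u, v) z w := by
    refine ⟨b, hb, ?_⟩
    have h1 := hu a ha
    have h2 := hv a ha
    rw [nbr_iff] at hab
    cases u <;> cases v <;> simp only [InQuad, dir_true, dir_false] at h1 h2 ⊢ <;> omega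
  refine hT ⟨hz1, ?_⟩
  rintro ⟨u', v'⟩
  have l1 := low u
  have l2 := low (!u)
  cases u <;> cases v <;> cases u' <;> cases v' <;>
    simp only [Bool.not_true, Bool.not_false] at l1 l2 third fourth <;> assumption

theorem card_strip {L : ℕ} (i : Fin 2) {R : Finset ℤ} :
    ((box 2 L).filter fun z => z i ∈ R).card ≤ side L * R.card := by
  have h : ((box 2 L).filter fun z => z i ∈ R).card ≤ ((Icc (-(L : ℤ)) L) ×ˢ R).card := by
    refine card_le_card_of_injOn (fun z => (z (1 - i), z i)) ?_ ?_
    · intro z hz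
      simp only [coe_filter, Set.mem_ofPred_eq, mem_box] at hz
      simp only [coe_product, Set.mem_prod, mem_coe, mem_Icc]
      refine ⟨?_, hz.2⟩
      revert hz; revert i; rw [Fin.forall_fin_two]; simp; tauto
    · intro z _ w _ h
      simp only [Prod.mk.injEq] at h
      revert h; revert i; rw [Fin.forall_fin_two]
      exact ⟨fun _ _ h => point_ext h.2 h.1, fun _ _ h => point_ext h.1 h.2⟩
  refine h.trans ?_
  rw [card_product]
  refine Nat.mul_le_mul_right _ ?_
  simp only [Int.card_Icc, side]
  omega

/-- Merging two blocks with adjacent points is profitable. -/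
theorem blockCost_union {L : ℕ} {S T : Finset (Fin 2 → ℤ)} {a b : Fin 2 → ℤ}
    (ha : a ∈ S) (hb : b ∈ T) (hab : Nbr a b) :
    blockCost L (S ∪ T) + 3 * side L ≤ blockCost L S + blockCost L T := by
  have hS : S ≠ ∅ := ne_empty_of_mem ha
  have hT : T ≠ ∅ := ne_empty_of_mem hb
  have hST : S ∪ T ≠ ∅ := ne_empty_of_mem (mem_union_left _ ha)
  -- New hull points occur only over overlaps of the spans. Each overlapping coordinate value
  -- contributes a strip of at most `side L` sites, which is what the two span terms save by not
  -- counting it twice.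
  have hull_sub : hull L (S ∪ T) ⊆ (hull L S ∪ hull L T) ∪
      (((box 2 L).filter fun z => z 0 ∈ span L 0 S ∩ span L 0 T) ∪
       ((box 2 L).filter fun z => z 1 ∈ span L 1 S ∩ span L 1 T)) := by
    intro z hz
    have hbox := (mem_hull.1 hz).1
    by_contra hn
    simp only [mem_union, mem_filter, mem_inter, not_or, not_and] at hn
    obtain ⟨⟨hn1, hn2⟩, hn3, hn4⟩ := hn
    by_cases hr : z 1 ∈ span L 1 S
    · exact hull_union_aux hb ha hab.symm (union_comm S T ▸ hz) hn1 (hn4 hbox hr)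
        fun h h' => hn3 hbox h' h
    · exact hull_union_aux ha hb hab hz hn2 hr (hn3 hbox)
  have c0 := card_le_card (span_union_subset (L := L) (i := 0) ha hb hab)
  have c1 := card_le_card (span_union_subset (L := L) (i := 1) ha hb hab)
  have d0 := card_union_add_card_inter (span L 0 S) (span L 0 T)
  have d1 := card_union_add_card_inter (span L 1 S) (span L 1 T)
  have e := card_le_card hull_sub
  have e1 := card_union_le (hull L S ∪ hull L T)
    (((box 2 L).filter fun z => z 0 ∈ span L 0 S ∩ span L 0 T) ∪
       ((box 2 L).filter fun z => z 1 ∈ span L 1 S ∩ span L 1 T))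
  have e2 := card_union_le (hull L S) (hull L T)
  have e3 := card_union_le ((box 2 L).filter fun z => z 0 ∈ span L 0 S ∩ span L 0 T)
    ((box 2 L).filter fun z => z 1 ∈ span L 1 S ∩ span L 1 T)
  have f0 := card_strip (L := L) 0 (R := span L 0 S ∩ span L 0 T)
  have f1 := card_strip (L := L) 1 (R := span L 1 S ∩ span L 1 T)
  unfold blockCost
  rw [if_neg hS, if_neg hT, if_neg hST]
  generalize side L = N at *
  have g0 : N * ((span L 0 (S ∪ T)).card + (span L 0 S ∩ span L 0 T).card) ≤
      N * ((span L 0 S).card + (span L 0 T).card) := Nat.mul_le_mul_left _ (by omega)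
  have g1 : N * ((span L 1 (S ∪ T)).card + (span L 1 S ∩ span L 1 T).card) ≤
      N * ((span L 1 S).card + (span L 1 T).card) := Nat.mul_le_mul_left _ (by omega)
  rw [mul_add, mul_add] at g0 g1
  rw [mul_add, mul_add, mul_add]
  omega

/-- Closed quadrants nest: wherever `x` serves as a witness, a point of `S` in the same type of
quadrant at `x` can replace it. -/
theorem insert_hull_subset {L : ℕ} {S : Finset (Fin 2 → ℤ)} {x : Fin 2 → ℤ} (hx : x ∈ hull L S) :
    blockCost L (insert x S) ≤ blockCost L S := by
  rw [mem_hull] at hx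
  have hS : S ≠ ∅ := by
    obtain ⟨w, hw, _⟩ := hx.2 (true, true)
    exact ne_empty_of_mem hw
  have h0 : ∀ i, ∃ w ∈ S, w i ≤ x i := by
    obtain ⟨w, hw, h⟩ := hx.2 (false, false)
    simp only [InQuad, dir_false] at h
    refine fun i => ⟨w, hw, ?_⟩
    revert i; rw [Fin.forall_fin_two]; omega
  have h1 : ∀ i, ∃ w ∈ S, x i ≤ w i := by
    obtain ⟨w, hw, h⟩ := hx.2 (true, true)
    simp only [InQuad, dir_true] at h
    refine fun i => ⟨w, hw, ?_⟩
    revert i; rw [Fin.forall_fin_two]; omega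
  have hs : ∀ i, span L i (insert x S) ⊆ span L i S := by
    intro i r hr
    rw [mem_span] at hr ⊢
    obtain ⟨hr1, ⟨w, hw, h2⟩, v, hv, h3⟩ := hr
    refine ⟨hr1, ?_, ?_⟩
    · rcases mem_insert.1 hw with rfl | hw
      · obtain ⟨w', hw', h⟩ := h0 i
        exact ⟨w', hw', h.trans h2⟩
      · exact ⟨w, hw, h2⟩
    · rcases mem_insert.1 hv with rfl | hv
      · obtain ⟨w', hw', h⟩ := h1 i
        exact ⟨w', hw', h3.trans h⟩
      · exact ⟨v, hv, h3⟩
  have hh : hull L (insert x S) ⊆ hull L S := by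
    intro z hz
    rw [mem_hull] at hz ⊢
    refine ⟨hz.1, fun t => ?_⟩
    obtain ⟨w, hw, hq⟩ := hz.2 t
    rcases mem_insert.1 hw with rfl | hw
    · obtain ⟨w', hw', hq'⟩ := hx.2 t
      refine ⟨w', hw', ?_⟩
      unfold InQuad at *
      constructor <;> linarith [hq.1, hq.2, hq'.1, hq'.2]
    · exact ⟨w, hw, hq⟩
  unfold blockCost
  rw [if_neg hS, if_neg (insert_ne_empty x S)]
  have a1 := card_le_card (hs 0)
  have a2 := card_le_card (hs 1)
  have a3 := card_le_card hh
  gcongr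

/-- Corners of type `t` of `S`. -/
def corners (t : Bool × Bool) (S : Finset (Fin 2 → ℤ)) : Finset (Fin 2 → ℤ) :=
  S.filter fun z => ∀ w ∈ S, InQuad t z w → w = z

/-- Sites at which `S` can grow in direction `t`. -/
noncomputable def growth (L : ℕ) (t : Bool × Bool) (S : Finset (Fin 2 → ℤ)) : Finset (Fin 2 → ℤ) :=
  (box 2 L).filter fun x => (∀ w ∈ S, ¬ InQuad t x w) ∧
    (∃ w ∈ S, w 0 = x 0 - dir t.1 ∧ w 1 = x 1) ∧ ∃ w ∈ S, w 0 = x 0 ∧ w 1 = x 1 - dir t.2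

theorem mem_growth {L : ℕ} {t : Bool × Bool} {S : Finset (Fin 2 → ℤ)} {x : Fin 2 → ℤ} :
    x ∈ growth L t S ↔ x ∈ box 2 L ∧ (∀ w ∈ S, ¬ InQuad t x w) ∧
    (∃ w ∈ S, w 0 = x 0 - dir t.1 ∧ w 1 = x 1) ∧
      ∃ w ∈ S, w 0 = x 0 ∧ w 1 = x 1 - dir t.2 := by
  simp [growth]

/-- The row and the column of `x` already meet `S`, so the spans stay the same. A quadrant with apex
`z ≠ x` that contains `x` also contains one of its two neighbours `p`, `q` in `S`, so `x` is the
only possible new hull site. -/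
theorem blockCost_growth {L : ℕ} {t : Bool × Bool} {S : Finset (Fin 2 → ℤ)} {x : Fin 2 → ℤ}
    (hx : x ∈ growth L t S) : blockCost L (insert x S) ≤ blockCost L S + 1 := by
  rw [mem_growth] at hx
  obtain ⟨hbox, hno, ⟨p, hp, hp0, hp1⟩, q, hq, hq0, hq1⟩ := hx
  have hS : S ≠ ∅ := ne_empty_of_mem hp
  have hs : ∀ i, span L i (insert x S) ⊆ span L i S := by
    have key : ∀ i, ∃ w ∈ S, w i = x i := by
      rw [Fin.forall_fin_two]; exact ⟨⟨q, hq, hq0⟩, p, hp, hp1⟩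
    intro i r hr
    obtain ⟨y, hy, hyi⟩ := key i
    rw [mem_span] at hr ⊢
    obtain ⟨hr1, ⟨w, hw, h2⟩, v, hv, h3⟩ := hr
    refine ⟨hr1, ?_, ?_⟩
    · rcases mem_insert.1 hw with rfl | hw
      · exact ⟨y, hy, hyi.le.trans h2⟩
      · exact ⟨w, hw, h2⟩
    · rcases mem_insert.1 hv with rfl | hv
      · exact ⟨y, hy, h3.trans hyi.ge⟩
      · exact ⟨v, hv, h3⟩
  have hh : hull L (insert x S) ⊆ insert x (hull L S) := by
    intro z hz
    rw [mem_insert]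
    by_cases hzx : z = x
    · exact Or.inl hzx
    right
    have hzx' : z 0 ≠ x 0 ∨ z 1 ≠ x 1 := by
      by_contra hn; push Not at hn; exact hzx (point_ext hn.1 hn.2)
    rw [mem_hull] at hz ⊢
    refine ⟨hz.1, fun s => ?_⟩
    obtain ⟨w, hw, hqd⟩ := hz.2 s
    rcases mem_insert.1 hw with rfl | hw
    · have : InQuad s z p ∨ InQuad s z q := by
        obtain ⟨s1, s2⟩ := s
        obtain ⟨t1, t2⟩ := t
        cases s1 <;> cases s2 <;> cases t1 <;> cases t2 <;>
          simp only [InQuad, dir_true, dir_false] at * <;> omega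
      rcases this with h | h
      · exact ⟨p, hp, h⟩
      · exact ⟨q, hq, h⟩
    · exact ⟨w, hw, hqd⟩
  unfold blockCost
  rw [if_neg hS, if_neg (insert_ne_empty x S)]
  have a1 := card_le_card (hs 0)
  have a2 := card_le_card (hs 1)
  have a3 := (card_le_card hh).trans (card_insert_le _ _)
  have := Nat.mul_le_mul_left (side L) (Nat.add_le_add a1 a2)
  omega

theorem mem_corners {t : Bool × Bool} {S : Finset (Fin 2 → ℤ)} {z : Fin 2 → ℤ} :
    z ∈ corners t S ↔ z ∈ S ∧ ∀ w ∈ S, InQuad t z w → w = z := by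
  simp [corners]

theorem inQuad_self (t : Bool × Bool) (z : Fin 2 → ℤ) : InQuad t z z := by simp [InQuad]

theorem mem_hull_of_mem {L : ℕ} {S : Finset (Fin 2 → ℤ)} (hS : S ⊆ box 2 L) {z : Fin 2 → ℤ}
    (hz : z ∈ S) : z ∈ hull L S :=
  mem_hull.2 ⟨hS hz, fun t => ⟨z, hz, inQuad_self t z⟩⟩

/-- Once the corner is removed, no point of `S` remains in its quadrant of type `t`, so the corner
leaves the hull. -/
theorem blockCost_erase_corner {L : ℕ} {t : Bool × Bool} {S : Finset (Fin 2 → ℤ)}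
    (hS : S ⊆ box 2 L) {z : Fin 2 → ℤ} (hz : z ∈ corners t S) :
    blockCost L (S.erase z) + 1 ≤ blockCost L S := by
  rw [mem_corners] at hz
  have hSn : S ≠ ∅ := ne_empty_of_mem hz.1
  unfold blockCost
  rw [if_neg hSn]
  split_ifs with h
  · unfold side; omega
  · have a1 := card_le_card (span_mono (L := L) (i := 0) (erase_subset z S))
    have a2 := card_le_card (span_mono (L := L) (i := 1) (erase_subset z S))
    have a3 : (hull L (S.erase z)).card < (hull L S).card := by
      refine card_lt_card ⟨hull_mono (erase_subset z S), fun hsub => ?_⟩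
      obtain ⟨w, hw, hq⟩ := (mem_hull.1 (hsub (mem_hull_of_mem hS hz.1))).2 t
      rw [mem_erase] at hw
      exact hw.1 (hz.2 w hw.2 hq)
    have := Nat.mul_le_mul_left (side L) (Nat.add_le_add a1 a2)
    omega

/-- A strict extreme point in a coordinate direction is the only reason its coordinate belongs to
the span. -/
theorem blockCost_erase_extreme {L : ℕ} {S : Finset (Fin 2 → ℤ)} (hS : S ⊆ box 2 L)
    {z : Fin 2 → ℤ} (hz : z ∈ S) (i : Fin 2) (u : Bool)
    (h : ∀ w ∈ S, w ≠ z → dir u * (w i - z i) < 0) :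
    blockCost L (S.erase z) + side L ≤ blockCost L S := by
  have hSn : S ≠ ∅ := ne_empty_of_mem hz
  unfold blockCost
  rw [if_neg hSn]
  split_ifs with hE
  · omega
  · have a1 := fun j => card_le_card (span_mono (L := L) (i := j) (erase_subset z S))
    have a3 := card_le_card (hull_mono (L := L) (erase_subset z S))
    have a4 : (span L i (S.erase z)).card < (span L i S).card := by
      refine card_lt_card ⟨span_mono (erase_subset z S), fun hsub => ?_⟩
      have hb := mem_box.1 (hS hz)
      have hzi : z i ∈ span L i S := by
        rw [mem_span]
        refine ⟨?_, ⟨z, hz, le_rfl⟩, z, hz, le_rfl⟩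
        revert i; rw [Fin.forall_fin_two]; exact ⟨fun _ _ => hb.1, fun _ _ => hb.2⟩
      obtain ⟨_, ⟨w, hw, h2⟩, v, hv, h3⟩ := mem_span.1 (hsub hzi)
      rw [mem_erase] at hw hv
      have b1 := h w hw.2 hw.1
      have b2 := h v hv.2 hv.1
      cases u <;> simp only [dir_true, dir_false] at b1 b2 <;> omega
    have a5 : (span L 0 (S.erase z)).card + (span L 1 (S.erase z)).card + 1 ≤
        (span L 0 S).card + (span L 1 S).card := by
      have := a1 0
      have := a1 1
      revert a4; revert i; rw [Fin.forall_fin_two]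
      constructor <;> intro _ _ <;> omega
    have := Nat.mul_le_mul_left (side L) a5
    rw [mul_add _ _ 1, mul_one] at this
    omega

theorem growth_subset_first {L : ℕ} {t : Bool × Bool} {S : Finset (Fin 2 → ℤ)} :
    Set.InjOn (fun x : Fin 2 → ℤ => x 0 - dir t.1) (growth L t S) := by
  intro x hx y hy hxy
  rw [mem_coe, mem_growth] at hx hy
  obtain ⟨-, h1, -, w, hw, hw0, hw1⟩ := hx
  obtain ⟨-, h2, -, v, hv, hv0, hv1⟩ := hy
  have h3 := h1 v hv
  have h4 := h2 w hw
  simp only at hxy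
  refine point_ext (by omega) ?_
  obtain ⟨t1, t2⟩ := t
  cases t1 <;> cases t2 <;> simp only [InQuad, dir_true, dir_false] at * <;> omega

theorem card_growth_le {L : ℕ} {t : Bool × Bool} {S : Finset (Fin 2 → ℤ)} (hS : S ⊆ box 2 L) :
    (growth L t S).card ≤ side L := by
  rw [← card_image_of_injOn growth_subset_first]
  refine (card_le_card (t := Icc (-(L : ℤ)) L) ?_).trans (by simp [side]; omega)
  intro r hr
  rw [mem_image] at hr
  obtain ⟨x, hx, rfl⟩ := hr
  obtain ⟨-, -, ⟨w, hw, hw0, -⟩, -⟩ := mem_growth.1 hx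
  rw [← hw0, mem_Icc]
  exact (mem_box.1 (hS hw)).1

/-- If nothing in `S` lies further out in direction `t` than the column of `y`, that column
contains a corner. -/
theorem exists_corner {t : Bool × Bool} {S : Finset (Fin 2 → ℤ)} {y : Fin 2 → ℤ} (hy : y ∈ S)
    (h : ∀ w ∈ S, InQuad t y w → w 0 = y 0) : ∃ z ∈ corners t S, z 0 = y 0 := by
  obtain ⟨z, hz, hmax⟩ := exists_max_image (S.filter fun w => InQuad t y w)
    (fun w => dir t.2 * w 1) ⟨y, mem_filter.2 ⟨hy, inQuad_self t y⟩⟩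
  rw [mem_filter] at hz
  refine ⟨z, mem_corners.2 ⟨hz.1, fun w hw hq => ?_⟩, h z hz.1 hz.2⟩
  have hq' : InQuad t y w := by
    have := hz.2
    unfold InQuad at *
    constructor <;> linarith [this.1, this.2, hq.1, hq.2]
  have h1 := hmax w (mem_filter.2 ⟨hw, hq'⟩)
  have h2 := h w hw hq'
  have h3 := h z hz.1 hz.2
  refine point_ext (by omega) ?_
  obtain ⟨t1, t2⟩ := t
  cases t2 <;> simp only [InQuad, dir_true, dir_false] at * <;> omega

/-- The column just behind a growth site contains a corner, and distinct growth sites have distinct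
such columns. The outermost column also contains a corner but lies behind no growth site. This
surplus of one is the source of the negative drift. -/
theorem card_growth_lt {L : ℕ} {t : Bool × Bool} {S : Finset (Fin 2 → ℤ)} (hS : S.Nonempty) :
    (growth L t S).card + 1 ≤ (corners t S).card := by
  obtain ⟨y, hy, hmax⟩ := exists_max_image S (fun w => dir t.1 * w 0) hS
  have hn : y 0 ∉ (growth L t S).image fun x : Fin 2 → ℤ => x 0 - dir t.1 := by
    intro hm
    obtain ⟨x, hx, hxy⟩ := mem_image.1 hm
    obtain ⟨-, -, -, w, hw, hw0, -⟩ := mem_growth.1 hx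
    have := hmax w hw
    obtain ⟨t1, t2⟩ := t
    cases t1 <;> simp only [dir_true, dir_false] at * <;> omega
  have hsub : insert (y 0) ((growth L t S).image fun x : Fin 2 → ℤ => x 0 - dir t.1) ⊆
      (corners t S).image fun z => z 0 := by
    intro r hr
    rw [mem_image]
    rcases mem_insert.1 hr with rfl | hr
    · refine exists_corner hy fun w hw hq => ?_
      have := hmax w hw
      obtain ⟨t1, t2⟩ := t
      cases t1 <;> simp only [InQuad, dir_true, dir_false] at * <;> omega
    · obtain ⟨x, hx, rfl⟩ := mem_image.1 hr
      obtain ⟨-, hno, ⟨w, hw, hw0, hw1⟩, -⟩ := mem_growth.1 hx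
      rw [← hw0]
      refine exists_corner hw fun v hv hq => ?_
      have := hno v hv
      obtain ⟨t1, t2⟩ := t
      cases t1 <;> cases t2 <;> simp only [InQuad, dir_true, dir_false] at * <;> omega
  have h1 := card_le_card hsub
  rw [card_insert_of_notMem hn, card_image_of_injOn growth_subset_first] at h1
  exact h1.trans card_image_le

end IsingGlauber

/-! ### Partitions of the minus set and the minimal cost. -/

namespace IsingGlauber
open Finset

/-- The block with label `l` of the colouring `c` of `A`. -/
def block (c : (Fin 2 → ℤ) → ℕ) (A : Finset (Fin 2 → ℤ)) (l : ℕ) : Finset (Fin 2 → ℤ) :=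
  A.filter fun z => c z = l

theorem mem_block {c : (Fin 2 → ℤ) → ℕ} {A : Finset (Fin 2 → ℤ)} {l : ℕ} {z : Fin 2 → ℤ} :
    z ∈ block c A l ↔ z ∈ A ∧ c z = l := by simp [block]

theorem block_subset (c : (Fin 2 → ℤ) → ℕ) (A : Finset (Fin 2 → ℤ)) (l : ℕ) :
    block c A l ⊆ A := filter_subset _ _

/-- The total cost of the partition of `A` into the colour classes of `c`. -/
noncomputable def partCost (L : ℕ) (c : (Fin 2 → ℤ) → ℕ) (A : Finset (Fin 2 → ℤ)) : ℕ :=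
  ∑ l ∈ A.image c, blockCost L (block c A l)

/-- Empty blocks cost nothing, so costs before and after a modification can be summed over a common
set of labels. -/
theorem partCost_eq {L : ℕ} {c : (Fin 2 → ℤ) → ℕ} {A : Finset (Fin 2 → ℤ)} {T : Finset ℕ}
    (h : A.image c ⊆ T) : partCost L c A = ∑ l ∈ T, blockCost L (block c A l) := by
  refine sum_subset h fun l _ hl => ?_
  have : block c A l = ∅ := by
    rw [eq_empty_iff_forall_notMem]
    intro z hz
    rw [mem_block] at hz
    exact hl (mem_image.2 ⟨z, hz⟩)
  rw [this]; simp [blockCost]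

/-- The least cost of a partition of `A`. -/
noncomputable def cost (L : ℕ) (A : Finset (Fin 2 → ℤ)) : ℕ :=
  sInf (Set.range fun c : (Fin 2 → ℤ) → ℕ => partCost L c A)

theorem cost_le (L : ℕ) (c : (Fin 2 → ℤ) → ℕ) (A : Finset (Fin 2 → ℤ)) :
    cost L A ≤ partCost L c A := Nat.sInf_le ⟨c, rfl⟩

theorem exists_cost_eq (L : ℕ) (A : Finset (Fin 2 → ℤ)) : ∃ c, partCost L c A = cost L A :=
  Nat.sInf_mem (s := Set.range fun c : (Fin 2 → ℤ) → ℕ => partCost L c A) ⟨_, fun _ => 0, rfl⟩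

theorem sum_replace {T : Finset ℕ} {f g : ℕ → ℕ} {l : ℕ} (hl : l ∈ T)
    (h : ∀ k, k ≠ l → f k = g k) : ∑ k ∈ T, f k + g l = ∑ k ∈ T, g k + f l := by
  rw [← add_sum_erase T f hl, ← add_sum_erase T g hl,
    sum_congr rfl fun k hk => h k (ne_of_mem_erase hk)]
  ring

theorem partCost_erase (L : ℕ) (c : (Fin 2 → ℤ) → ℕ) {A : Finset (Fin 2 → ℤ)} {z : Fin 2 → ℤ}
    (hz : z ∈ A) :
    partCost L c (A.erase z) + blockCost L (block c A (c z)) =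
      partCost L c A + blockCost L ((block c A (c z)).erase z) := by
  rw [partCost_eq (T := A.image c) (image_subset_image (erase_subset z A)),
    partCost_eq (T := A.image c) (Subset.refl _)]
  have h : block c (A.erase z) (c z) = (block c A (c z)).erase z := by
    ext w; simp only [mem_block, mem_erase]; tauto
  rw [← h]
  refine sum_replace (f := fun l => blockCost L (block c (A.erase z) l))
    (g := fun l => blockCost L (block c A l)) (mem_image_of_mem c hz) fun k hk => ?_
  congr 1
  ext w; simp only [mem_block, mem_erase]
  constructor
  · tauto
  · rintro ⟨h1, h2⟩
    refine ⟨⟨?_, h1⟩, h2⟩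
    rintro rfl; exact hk h2.symm

theorem block_insert_self (c : (Fin 2 → ℤ) → ℕ) (A : Finset (Fin 2 → ℤ)) (x : Fin 2 → ℤ)
    (l : ℕ) :
    block (Function.update c x l) (insert x A) l = insert x (block c A l) := by
  ext w; simp only [mem_block, mem_insert, Function.update_apply]
  by_cases h : w = x
  · simp [h]
  · simp [h]

theorem block_insert_of_ne (c : (Fin 2 → ℤ) → ℕ) {A : Finset (Fin 2 → ℤ)} {x : Fin 2 → ℤ}
    (hx : x ∉ A) {l k : ℕ} (hk : k ≠ l) :
    block (Function.update c x l) (insert x A) k = block c A k := by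
  ext w; simp only [mem_block, mem_insert, Function.update_apply]
  by_cases h : w = x
  · subst h; simp [hx, hk.symm]
  · simp [h]

theorem partCost_insert (L : ℕ) (c : (Fin 2 → ℤ) → ℕ) {A : Finset (Fin 2 → ℤ)} {x : Fin 2 → ℤ}
    (hx : x ∉ A) (l : ℕ) :
    partCost L (Function.update c x l) (insert x A) + blockCost L (block c A l) =
      partCost L c A + blockCost L (insert x (block c A l)) := by
  have hT1 : (insert x A).image (Function.update c x l) ⊆ insert l (A.image c) := by
    intro k hk
    obtain ⟨w, hw, rfl⟩ := mem_image.1 hk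
    rw [Function.update_apply]
    split_ifs with h
    · exact mem_insert_self _ _
    · exact mem_insert_of_mem (mem_image_of_mem c ((mem_insert.1 hw).resolve_left h))
  rw [partCost_eq hT1, partCost_eq (subset_insert l (A.image c)), ← block_insert_self c A x]
  exact sum_replace (f := fun k => blockCost L (block (Function.update c x l) (insert x A) k))
    (g := fun k => blockCost L (block c A k)) (mem_insert_self _ _)
    fun k hk => by rw [block_insert_of_ne c hx hk]

/-- The colouring in which label `k` is replaced by `l`. -/
def relabel (c : (Fin 2 → ℤ) → ℕ) (l k : ℕ) : (Fin 2 → ℤ) → ℕ :=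
  fun z => if c z = k then l else c z

theorem block_relabel (c : (Fin 2 → ℤ) → ℕ) (A : Finset (Fin 2 → ℤ)) (l k : ℕ) :
    block (relabel c l k) A l = block c A l ∪ block c A k := by
  ext w; simp only [mem_block, mem_union, relabel]
  split_ifs with h
  · simp only [h]; tauto
  · simp [h]

theorem partCost_relabel (L : ℕ) (c : (Fin 2 → ℤ) → ℕ) (A : Finset (Fin 2 → ℤ)) {l k : ℕ}
    (hlk : l ≠ k) :
    partCost L (relabel c l k) A + blockCost L (block c A l) + blockCost L (block c A k) =
      partCost L c A + blockCost L (block c A l ∪ block c A k) := by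
  set T := insert l (insert k (A.image c)) with hT
  have hT1 : A.image (relabel c l k) ⊆ T := by
    intro j hj
    obtain ⟨w, hw, rfl⟩ := mem_image.1 hj
    unfold relabel
    split_ifs with h
    · exact mem_insert_self _ _
    · exact mem_insert_of_mem (mem_insert_of_mem (mem_image_of_mem c hw))
  have hT2 : A.image c ⊆ T := (subset_insert _ _).trans (subset_insert _ _)
  have hl : l ∈ T := mem_insert_self _ _
  have hk : k ∈ T.erase l := mem_erase.2 ⟨hlk.symm, mem_insert_of_mem (mem_insert_self _ _)⟩
  have hkE : block (relabel c l k) A k = ∅ := by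
    rw [eq_empty_iff_forall_notMem]
    intro z hz
    rw [mem_block, relabel] at hz
    split_ifs at hz with h
    · exact hlk hz.2
    · exact h hz.2
  rw [partCost_eq hT1, partCost_eq hT2, ← add_sum_erase T _ hl, ← add_sum_erase T _ hl,
    ← add_sum_erase _ _ hk, ← add_sum_erase _ _ hk, block_relabel, hkE]
  have : ∑ j ∈ (T.erase l).erase k, blockCost L (block (relabel c l k) A j) =
      ∑ j ∈ (T.erase l).erase k, blockCost L (block c A j) := by
    refine sum_congr rfl fun j hj => ?_
    rw [mem_erase, mem_erase] at hj
    congr 1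
    ext w; simp only [mem_block, relabel]
    split_ifs with h
    · simp [h, hj.1.symm, hj.2.1.symm]
    · rfl
  rw [this]
  have h0 : blockCost L ∅ = 0 := by simp [blockCost]
  rw [h0]
  omega

section Minimal

variable {L : ℕ} {c : (Fin 2 → ℤ) → ℕ} {A : Finset (Fin 2 → ℤ)}

/-- Otherwise merging the two blocks would lower a minimal cost. Consequently a minus site sees the
same neighbours in its block as in the whole minus set. -/
theorem color_eq_of_nbr (hc : partCost L c A = cost L A) {a b : Fin 2 → ℤ} (ha : a ∈ A)
    (hb : b ∈ A) (hab : Nbr a b) : c a = c b := by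
  by_contra hne
  have h1 := partCost_relabel L c A hne
  have h2 := cost_le L (relabel c (c a) (c b)) A
  have h3 := blockCost_union (L := L) (mem_block.2 ⟨ha, rfl⟩ : a ∈ block c A (c a))
    (mem_block.2 ⟨hb, rfl⟩ : b ∈ block c A (c b)) hab
  unfold side at h3
  omega

theorem cost_erase (hc : partCost L c A = cost L A) {z : Fin 2 → ℤ} (hz : z ∈ A) {k : ℕ}
    (h : blockCost L ((block c A (c z)).erase z) + k ≤ blockCost L (block c A (c z))) :
    cost L (A.erase z) + k ≤ cost L A := by
  have h1 := partCost_erase L c hz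
  have h2 := cost_le L c (A.erase z)
  omega

theorem cost_insert (hc : partCost L c A = cost L A) {x : Fin 2 → ℤ} (hx : x ∉ A) {l k : ℕ}
    (h : blockCost L (insert x (block c A l)) ≤ blockCost L (block c A l) + k) :
    cost L (insert x A) ≤ cost L A + k := by
  have h1 := partCost_insert L c hx l
  have h2 := cost_le L (Function.update c x l) (insert x A)
  omega

/-- A fresh label makes the new site a block of its own. -/
theorem cost_insert_le {x : Fin 2 → ℤ} (hx : x ∉ A) :
    cost L (insert x A) ≤ cost L A + 6 * side L := by
  obtain ⟨c, hc⟩ := exists_cost_eq L A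
  obtain ⟨l, hl⟩ := Infinite.exists_notMem_finset (A.image c)
  have hE : block c A l = ∅ := by
    rw [eq_empty_iff_forall_notMem]
    intro z hz
    rw [mem_block] at hz
    exact hl (mem_image.2 ⟨z, hz⟩)
  refine cost_insert hc hx (l := l) ?_
  rw [hE]
  exact (blockCost_singleton_le L x).trans (Nat.le_add_left _ _)

/-- The new singleton costs at most `6 * side L`, and joining it to both neighbouring blocks saves
`3 * side L` twice. -/
theorem cost_insert_of_two_blocks (hc : partCost L c A = cost L A) {x a b : Fin 2 → ℤ}
    (hx : x ∉ A) (ha : a ∈ A) (hb : b ∈ A) (hxa : Nbr x a) (hxb : Nbr x b) (hne : c a ≠ c b) :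
    cost L (insert x A) ≤ cost L A := by
  have h1 := partCost_relabel L c A hne
  have h2 := partCost_insert L (relabel c (c a) (c b)) hx (c a)
  have h3 := cost_le L (Function.update (relabel c (c a) (c b)) x (c a)) (insert x A)
  rw [block_relabel] at h2
  have h4 := blockCost_union (L := L) (mem_singleton_self x)
    (mem_block.2 ⟨ha, rfl⟩ : a ∈ block c A (c a)) hxa
  have h5 := blockCost_union (L := L) (mem_union_left _ (mem_singleton_self x))
    (mem_block.2 ⟨hb, rfl⟩ : b ∈ block c A (c b)) hxb (S := {x} ∪ block c A (c a))
  have h6 := blockCost_singleton_le L x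
  rw [union_assoc, ← insert_eq] at h5
  omega

end Minimal

/-- Two quadrants sharing a direction cover a half-plane, so a site that is a corner of three types
is strictly extreme in a coordinate direction. -/
theorem two_type_filter : ∀ F : Finset (Bool × Bool), 3 ≤ F.card →
    (∃ v, (true, v) ∈ F ∧ (false, v) ∈ F) ∧ ∃ u, (u, true) ∈ F ∧ (u, false) ∈ F := by
  decide

/-- The number of types for which `z` is a corner of `S`. -/
def cornerTypes (S : Finset (Fin 2 → ℤ)) (z : Fin 2 → ℤ) : Finset (Bool × Bool) :=
  univ.filter fun t => z ∈ corners t S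

theorem inner_nbr {t : Bool × Bool} {z w : Fin 2 → ℤ} (h : Nbr z w) (hq : ¬ InQuad t z w) :
    (w 0 = z 0 - dir t.1 ∧ w 1 = z 1) ∨ (w 0 = z 0 ∧ w 1 = z 1 - dir t.2) := by
  rw [nbr_iff] at h
  obtain ⟨t1, t2⟩ := t
  cases t1 <;> cases t2 <;> simp only [InQuad, dir_true, dir_false] at * <;> omega

theorem nbrCount_le_two {t : Bool × Bool} {S : Finset (Fin 2 → ℤ)} {z : Fin 2 → ℤ}
    (h : ∀ w ∈ S, Nbr z w → ¬ InQuad t z w) : nbrCount S z ≤ 2 := by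
  refine (card_le_card (t := {![z 0 - dir t.1, z 1], ![z 0, z 1 - dir t.2]}) fun w hw => ?_).trans
    card_le_two
  rw [mem_filter] at hw
  rw [mem_insert, mem_singleton]
  rcases inner_nbr hw.2 (h w hw.1 hw.2) with ⟨h1, h2⟩ | ⟨h1, h2⟩
  · exact Or.inl (point_ext (by simpa using h1) (by simpa using h2))
  · exact Or.inr (point_ext (by simpa using h1) (by simpa using h2))

theorem corner_not_inQuad {t : Bool × Bool} {S : Finset (Fin 2 → ℤ)} {z : Fin 2 → ℤ}
    (h : z ∈ corners t S) : ∀ w ∈ S, Nbr z w → ¬ InQuad t z w := by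
  intro w hw hn hq
  have := (mem_corners.1 h).2 w hw hq
  subst this
  rw [nbr_iff] at hn; omega

theorem nbrCount_le_one {t s : Bool × Bool} (hts : t ≠ s) {S : Finset (Fin 2 → ℤ)}
    {z : Fin 2 → ℤ} (ht : z ∈ corners t S) (hs : z ∈ corners s S) : nbrCount S z ≤ 1 := by
  refine card_le_one.2 fun v hv w hw => ?_
  rw [mem_filter] at hv hw
  have h1 := inner_nbr hv.2 (corner_not_inQuad ht v hv.1 hv.2)
  have h2 := inner_nbr hv.2 (corner_not_inQuad hs v hv.1 hv.2)
  have h3 := inner_nbr hw.2 (corner_not_inQuad ht w hw.1 hw.2)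
  have h4 := inner_nbr hw.2 (corner_not_inQuad hs w hw.1 hw.2)
  obtain ⟨t1, t2⟩ := t
  obtain ⟨s1, s2⟩ := s
  refine point_ext ?_ ?_ <;> revert hts <;>
  cases t1 <;> cases t2 <;> cases s1 <;> cases s2 <;>
    simp only [dir_true, dir_false, ne_eq, not_true_eq_false, false_imp_iff] at * <;>
    intro _ <;> omega

theorem blockCost_erase_three {L : ℕ} {S : Finset (Fin 2 → ℤ)} (hS : S ⊆ box 2 L)
    {z : Fin 2 → ℤ} (h : 3 ≤ (cornerTypes S z).card) :
    blockCost L (S.erase z) + side L ≤ blockCost L S := by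
  obtain ⟨⟨v, h1, h2⟩, -⟩ := two_type_filter _ h
  simp only [cornerTypes, mem_filter, mem_univ, true_and, mem_corners] at h1 h2
  refine blockCost_erase_extreme hS h1.1 1 v fun w hw hne => ?_
  have a1 := fun hq => hne (h1.2 w hw hq)
  have a2 := fun hq => hne (h2.2 w hw hq)
  cases v <;> simp only [InQuad, dir_true, dir_false, imp_false] at * <;> omega

/-- A site outside the hull has a quadrant free of `S`, which excludes two of its neighbours; the
other two, one in each coordinate direction, must both belong to `S`. -/
theorem exists_growth {L : ℕ} {S : Finset (Fin 2 → ℤ)} {x : Fin 2 → ℤ} (hx : x ∈ box 2 L)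
    (hS : 2 ≤ nbrCount S x) (hh : x ∉ hull L S) :
    nbrCount S x = 2 ∧ ∃ t, x ∈ growth L t S := by
  rw [mem_hull] at hh
  have hh : ∃ t, ∀ w ∈ S, ¬ InQuad t x w := by
    by_contra hn; push Not at hn; exact hh ⟨hx, hn⟩
  obtain ⟨t, ht⟩ := hh
  have h2 := nbrCount_le_two (z := x) fun w hw _ => ht w hw
  refine ⟨le_antisymm h2 hS, t, mem_growth.2 ⟨hx, ht, ?_⟩⟩
  obtain ⟨v, hv, w, hw, hne⟩ := one_lt_card.1 (show 1 < nbrCount S x by omega)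
  rw [mem_filter] at hv hw
  have h3 := inner_nbr hv.2 (ht v hv.1)
  have h4 := inner_nbr hw.2 (ht w hw.1)
  rcases h3 with h3 | h3 <;> rcases h4 with h4 | h4
  · exact absurd (point_ext (by omega) (by omega)) hne
  · exact ⟨⟨v, hv.1, h3⟩, w, hw.1, h4⟩
  · exact ⟨⟨w, hw.1, h4⟩, v, hv.1, h3⟩
  · exact absurd (point_ext (by omega) (by omega)) hne

end IsingGlauber

/-! ### Drift of the exponential cost and lower bounds on the gap. -/

namespace IsingGlauber
open Finset

variable {Λ : Finset (Fin 2 → ℤ)}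

theorem minusSet_flip_of_one {x : Λ} {σ : Config Λ} (h : σ x = 1) :
    minusSet (flip x σ) = insert x.1 (minusSet σ) := by
  ext z
  rw [mem_insert, mem_minusSet, mem_minusSet]
  constructor
  · rintro ⟨hz, h1⟩
    by_cases hzx : (⟨z, hz⟩ : Λ) = x
    · exact Or.inl (congrArg Subtype.val hzx)
    · rw [flip_of_ne hzx] at h1; exact Or.inr ⟨hz, h1⟩
  · rintro (rfl | ⟨hz, h1⟩)
    · exact ⟨x.2, by simp [h]⟩
    · refine ⟨hz, ?_⟩
      rw [flip_of_ne ?_, h1]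
      rintro rfl
      rw [h] at h1; revert h1; decide

theorem minusSet_flip_of_neg {x : Λ} {σ : Config Λ} (h : σ x = -1) :
    minusSet (flip x σ) = (minusSet σ).erase x.1 := by
  ext z
  rw [mem_erase, mem_minusSet, mem_minusSet]
  constructor
  · rintro ⟨hz, h1⟩
    by_cases hzx : (⟨z, hz⟩ : Λ) = x
    · rw [hzx, flip_self, h] at h1; exact absurd h1 (by decide)
    · rw [flip_of_ne hzx] at h1
      exact ⟨fun h2 => hzx (Subtype.ext h2), hz, h1⟩
  · rintro ⟨hne, hz, h1⟩
    refine ⟨hz, ?_⟩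
    rw [flip_of_ne ?_, h1]
    rintro rfl
    exact hne rfl

theorem flipRate_le_of_one {β : ℝ} (hβ : 0 ≤ β) {x : Λ} {σ : Config Λ} (h : σ x = 1)
    (hm : nbrCount (minusSet σ) x.1 ≤ 1) : flipRate β x σ ≤ Real.exp (-(4 * β)) := by
  unfold flipRate barrier
  rw [h, spin_one, Real.exp_neg, one_div]
  have hm' : (nbrCount (minusSet σ) x.1 : ℝ) ≤ 1 := by exact_mod_cast hm
  refine inv_anti₀ (Real.exp_pos _) ?_
  have : Real.exp (4 * β) ≤ Real.exp (β * (2 * 1 * (4 - 2 * (nbrCount (minusSet σ) x.1 : ℝ)))) :=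
    Real.exp_le_exp.2 (by nlinarith)
  linarith

theorem flipRate_of_two {β : ℝ} {x : Λ} {σ : Config Λ}
    (hm : nbrCount (minusSet σ) x.1 = 2) : flipRate β x σ = 1 / 2 := by
  unfold flipRate barrier
  rw [hm]; norm_num

theorem barrier_of_neg {x : Λ} {σ : Config Λ} (h : σ x = -1) :
    barrier x σ = -(2 * (4 - 2 * (nbrCount (minusSet σ) x.1 : ℝ))) := by
  unfold barrier; rw [h, spin_neg, spin_one]; ring

theorem half_le_flipRate {β : ℝ} (hβ : 0 ≤ β) {x : Λ} {σ : Config Λ} (h : σ x = -1)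
    (hm : nbrCount (minusSet σ) x.1 ≤ 2) : 1 / 2 ≤ flipRate β x σ := by
  unfold flipRate
  rw [barrier_of_neg h]
  have hm' : (nbrCount (minusSet σ) x.1 : ℝ) ≤ 2 := by exact_mod_cast hm
  refine one_div_le_one_div_of_le (by positivity) ?_
  have : Real.exp (β * -(2 * (4 - 2 * (nbrCount (minusSet σ) x.1 : ℝ)))) ≤ 1 :=
    Real.exp_le_one_iff.2 (by nlinarith)
  linarith

theorem one_sub_le_flipRate {β : ℝ} (hβ : 0 ≤ β) {x : Λ} {σ : Config Λ} (h : σ x = -1)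
    (hm : nbrCount (minusSet σ) x.1 ≤ 1) : 1 - Real.exp (-(4 * β)) ≤ flipRate β x σ := by
  unfold flipRate
  rw [barrier_of_neg h]
  have hm' : (nbrCount (minusSet σ) x.1 : ℝ) ≤ 1 := by exact_mod_cast hm
  have : Real.exp (β * -(2 * (4 - 2 * (nbrCount (minusSet σ) x.1 : ℝ)))) ≤ Real.exp (-(4 * β)) :=
    Real.exp_le_exp.2 (by nlinarith)
  have h0 := Real.exp_pos (-(4 * β))
  rw [le_div_iff₀ (by positivity)]
  nlinarith [Real.exp_pos (β * -(2 * (4 - 2 * (nbrCount (minusSet σ) x.1 : ℝ))))]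

/-- Total number of (label, type) pairs for which `x` is a growth site. -/
noncomputable def growthCount (L : ℕ) (c : (Fin 2 → ℤ) → ℕ) (A : Finset (Fin 2 → ℤ))
    (x : Fin 2 → ℤ) : ℝ :=
  ∑ l ∈ A.image c, ∑ t : Bool × Bool, if x ∈ growth L t (block c A l) then 1 else 0

/-- Total number of (label, type) pairs for which `x` is a corner. -/
noncomputable def cornerCount (c : (Fin 2 → ℤ) → ℕ) (A : Finset (Fin 2 → ℤ))
    (x : Fin 2 → ℤ) : ℝ :=
  ∑ l ∈ A.image c, ∑ t : Bool × Bool, if x ∈ corners t (block c A l) then 1 else 0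

theorem growthCount_nonneg (L : ℕ) (c : (Fin 2 → ℤ) → ℕ) (A : Finset (Fin 2 → ℤ))
    (x : Fin 2 → ℤ) : 0 ≤ growthCount L c A x :=
  sum_nonneg fun _ _ => sum_nonneg fun _ _ => by split_ifs <;> norm_num

theorem cornerCount_of_notMem {c : (Fin 2 → ℤ) → ℕ} {A : Finset (Fin 2 → ℤ)}
    {x : Fin 2 → ℤ} (hx : x ∉ A) : cornerCount c A x = 0 :=
  sum_eq_zero fun l _ => sum_eq_zero fun _ _ => if_neg fun h =>
    hx (block_subset c A l (mem_corners.1 h).1)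

theorem cornerCount_of_mem {c : (Fin 2 → ℤ) → ℕ} {A : Finset (Fin 2 → ℤ)}
    {x : Fin 2 → ℤ} (hx : x ∈ A) :
    cornerCount c A x = ((cornerTypes (block c A (c x)) x).card : ℝ) := by
  unfold cornerCount cornerTypes
  rw [sum_eq_single (c x)]
  · rw [card_filter]; push_cast; rfl
  · intro l _ hl
    exact sum_eq_zero fun t _ => if_neg fun h => hl (mem_block.1 (mem_corners.1 h).1).2.symm
  · intro h; exact absurd (mem_image_of_mem c hx) h

theorem one_le_growthCount {L : ℕ} {c : (Fin 2 → ℤ) → ℕ} {A : Finset (Fin 2 → ℤ)}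
    {x : Fin 2 → ℤ} {l : ℕ} (hl : l ∈ A.image c) {t : Bool × Bool}
    (h : x ∈ growth L t (block c A l)) : 1 ≤ growthCount L c A x := by
  unfold growthCount
  have h0 : ∀ k (s : Bool × Bool),
      0 ≤ (if x ∈ growth L s (block c A k) then (1 : ℝ) else 0) := fun k s => by
    split_ifs <;> norm_num
  have h1 : (1 : ℝ) ≤ ∑ s : Bool × Bool, if x ∈ growth L s (block c A l) then (1 : ℝ) else 0 := by
    refine le_trans ?_ (single_le_sum (fun s _ => h0 l s) (mem_univ t))
    rw [if_pos h]
  exact h1.trans (single_le_sum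
    (f := fun k => ∑ s : Bool × Bool, if x ∈ growth L s (block c A k) then (1 : ℝ) else 0)
    (fun k _ => sum_nonneg fun s _ => h0 k s) hl)

theorem nbrCount_block {c : (Fin 2 → ℤ) → ℕ} {A : Finset (Fin 2 → ℤ)} {l : ℕ}
    {x : Fin 2 → ℤ} (h : ∀ w ∈ A, Nbr x w → c w = l) :
    nbrCount A x = nbrCount (block c A l) x := by
  unfold nbrCount
  congr 1
  ext w
  simp only [mem_filter, mem_block]
  exact ⟨fun hw => ⟨⟨hw.1, h w hw.1 hw.2⟩, hw.2⟩, fun hw => ⟨hw.1.1, hw.2⟩⟩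

theorem exp_mul_sub_one_le {a p q : ℝ} (ha : 0 ≤ a) (h : p ≤ q) :
    Real.exp (a * p) - 1 ≤ Real.exp (a * q) - 1 :=
  sub_le_sub_right (Real.exp_le_exp.2 (mul_le_mul_of_nonneg_left h ha)) 1

section Drift

variable {L : ℕ} {c : (Fin 2 → ℤ) → ℕ}

/-- With at most one minus neighbour the flip is rare. Otherwise the cost can grow only if all minus
neighbours belong to one block whose hull misses `x`, and `x` is then a growth site flipping at rate
`1/2`. -/
theorem drift_plus {β α : ℝ} (hβ : 0 ≤ β) (hα : 0 ≤ α) {σ : Config (box 2 L)}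
    (hc : partCost L c (minusSet σ) = cost L (minusSet σ)) {x : box 2 L} (hx : σ x = 1) :
    flipRate β x σ *
        (Real.exp (α * ((cost L (minusSet (flip x σ)) : ℝ) - cost L (minusSet σ))) - 1) ≤
      Real.exp (-(4 * β)) * (Real.exp (α * (6 * side L)) - 1) +
        1 / 2 * (Real.exp α - 1) * growthCount L c (minusSet σ) x.1 := by
  have hxA : x.1 ∉ minusSet σ := by
    rw [coe_mem_minusSet, hx]; decide
  rw [minusSet_flip_of_one hx]
  set A := minusSet σ with hA
  have hr := flipRate_pos β x σ
  have hG := growthCount_nonneg L c A x.1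
  have e1 : 0 ≤ Real.exp α - 1 := by linarith [Real.add_one_le_exp α]
  have e2 : 0 ≤ Real.exp (α * (6 * side L)) - 1 := by
    have : 0 ≤ α * (6 * (side L : ℝ)) := by positivity
    linarith [Real.add_one_le_exp (α * (6 * (side L : ℝ)))]
  have e3 := Real.exp_pos (-(4 * β))
  have t1 : 0 ≤ Real.exp (-(4 * β)) * (Real.exp (α * (6 * side L)) - 1) := mul_nonneg e3.le e2
  have t2 : 0 ≤ 1 / 2 * (Real.exp α - 1) * growthCount L c A x.1 := by positivity
  have nonpos : cost L (insert x.1 A) ≤ cost L A → flipRate β x σ *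
      (Real.exp (α * ((cost L (insert x.1 A) : ℝ) - cost L A)) - 1) ≤ 0 := by
    intro h
    have h' : (cost L (insert x.1 A) : ℝ) ≤ cost L A := by exact_mod_cast h
    have := exp_mul_sub_one_le hα (sub_nonpos.2 h')
    rw [mul_zero, Real.exp_zero, sub_self] at this
    exact mul_nonpos_of_nonneg_of_nonpos hr.le this
  by_cases hm : nbrCount A x.1 ≤ 1
  · have h1 : (cost L (insert x.1 A) : ℝ) ≤ cost L A + 6 * side L := by
      exact_mod_cast cost_insert_le (L := L) hxA
    have h2 := exp_mul_sub_one_le hα (sub_left_le_of_le_add h1)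
    have h3 := flipRate_le_of_one hβ hx hm
    have := (mul_le_mul_of_nonneg_left h2 hr.le).trans (mul_le_mul_of_nonneg_right h3 e2)
    linarith
  · push Not at hm
    obtain ⟨a, ha, b, hb, -⟩ := one_lt_card.1 hm
    rw [mem_filter] at ha
    by_cases htwo : ∃ w ∈ A, Nbr x.1 w ∧ c w ≠ c a
    · obtain ⟨w, hw, hxw, hne⟩ := htwo
      have := nonpos (cost_insert_of_two_blocks hc hxA hw ha.1 hxw ha.2 hne)
      linarith
    · push Not at htwo
      have hcount := nbrCount_block htwo
      by_cases hh : x.1 ∈ hull L (block c A (c a))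
      · have := nonpos (cost_insert hc hxA (k := 0) (insert_hull_subset hh))
        linarith
      · obtain ⟨h2, t, ht⟩ := exists_growth x.2 (by omega) hh
        have h1 : (cost L (insert x.1 A) : ℝ) ≤ cost L A + 1 := by
          exact_mod_cast cost_insert hc hxA (blockCost_growth ht)
        have h4 := exp_mul_sub_one_le hα (sub_left_le_of_le_add h1)
        rw [mul_one] at h4
        rw [flipRate_of_two (hcount.trans h2)]
        have h5 := one_le_growthCount (mem_image_of_mem c ha.1) ht
        nlinarith

theorem two_mul_one_sub_le_cube {y : ℝ} (h0 : 3 / 4 ≤ y) (h1 : y ≤ 1) :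
    2 * (1 - y) ≤ 1 - y ^ 3 := by
  have : 0 ≤ (1 - y) * (y + y ^ 2 - 1) := mul_nonneg (by linarith) (by nlinarith)
  linarith

/-- A site that is a corner of several types must pay for each of them. One type gives rate at least
`1/2` and two give almost one, each with a drop of at least one. For three or four, the rate cannot
double again, but the span shrinks and the drop is at least `side L ≥ 3`, which
`two_mul_one_sub_le_cube` shows to suffice. -/
theorem drift_minus {β α : ℝ} (hβ : 0 ≤ β) (hα : 0 ≤ α) (hL : 1 ≤ L)
    (hα' : α ≤ 1 / 4) {σ : Config (box 2 L)}
    (hc : partCost L c (minusSet σ) = cost L (minusSet σ)) {x : box 2 L} (hx : σ x = -1) :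
    flipRate β x σ *
        (Real.exp (α * ((cost L (minusSet (flip x σ)) : ℝ) - cost L (minusSet σ))) - 1) ≤
      -(1 / 2 * (1 - Real.exp (-(4 * β))) * (1 - Real.exp (-α)) * cornerCount c (minusSet σ) x.1) := by
  have hxA : x.1 ∈ minusSet σ := coe_mem_minusSet.2 hx
  rw [minusSet_flip_of_neg hx, cornerCount_of_mem hxA]
  set A := minusSet σ with hA
  set B := block c A (c x.1) with hB
  have hBbox : B ⊆ box 2 L := (block_subset _ _ _).trans (minusSet_subset σ)
  have hcount : nbrCount A x.1 = nbrCount B x.1 := nbrCount_block fun w hw hn =>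
    (color_eq_of_nbr hc hxA hw hn).symm
  set k := (cornerTypes B x.1).card with hk
  set r := flipRate β x σ with hr
  have hr0 : 0 < r := flipRate_pos β x σ
  have e1 : 0 ≤ 1 - Real.exp (-α) := by
    have := Real.exp_le_one_iff.2 (neg_nonpos.2 hα); linarith
  have e3 := Real.exp_pos (-(4 * β))
  have e4 : Real.exp (-(4 * β)) ≤ 1 := Real.exp_le_one_iff.2 (by linarith)
  have drop : ∀ j : ℕ, blockCost L (B.erase x.1) + j ≤ blockCost L B →
      r * (Real.exp (α * ((cost L (A.erase x.1) : ℝ) - cost L A)) - 1) ≤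
        r * (Real.exp (α * (-j)) - 1) := by
    intro j hj
    have h1 : (cost L (A.erase x.1) : ℝ) + j ≤ cost L A := by
      exact_mod_cast cost_erase hc hxA hj
    exact mul_le_mul_of_nonneg_left (exp_mul_sub_one_le hα (by linarith)) hr0.le
  have k4 : k ≤ 4 := by
    have := card_le_univ (cornerTypes B x.1)
    simpa using this
  obtain ⟨X, hX⟩ : ∃ X, X = r * (Real.exp (α * ((cost L (A.erase x.1) : ℝ) - cost L A)) - 1) :=
    ⟨_, rfl⟩
  rw [← hX]
  rw [← hX] at drop
  obtain ⟨y, hy⟩ : ∃ y, y = Real.exp (-α) := ⟨_, rfl⟩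
  obtain ⟨ε, hε⟩ : ∃ ε, ε = Real.exp (-(4 * β)) := ⟨_, rfl⟩
  rw [← hy] at e1
  rw [← hε] at e3 e4
  rw [← hy, ← hε]
  clear_value k r
  rcases Nat.eq_zero_or_pos k with h0 | h0
  · have := drop 0 (blockCost_mono (erase_subset _ _))
    rw [h0]
    simpa using this
  obtain ⟨t, ht⟩ : (cornerTypes B x.1).Nonempty := card_pos.1 (hk ▸ h0)
  have htc : x.1 ∈ corners t B := by simpa [cornerTypes] using ht
  have d1 := drop 1 (blockCost_erase_corner hBbox htc)
  rw [Nat.cast_one, mul_neg_one, ← hy] at d1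
  by_cases h1 : k = 1
  · have hm := half_le_flipRate (β := β) hβ hx
      ((hcount.trans_le (nbrCount_le_two (corner_not_inQuad htc))))
    rw [← hr] at hm
    rw [h1, Nat.cast_one]
    have p1 := mul_nonneg (sub_nonneg.2 hm) e1
    have p2 := mul_nonneg e3.le e1
    linarith
  · obtain ⟨t, ht, s, hs, hts⟩ := one_lt_card.1 (show 1 < (cornerTypes B x.1).card by omega)
    have htc : x.1 ∈ corners t B := by simpa [cornerTypes] using ht
    have hsc : x.1 ∈ corners s B := by simpa [cornerTypes] using hs
    have hm := one_sub_le_flipRate (β := β) hβ hx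
      ((hcount.trans_le (nbrCount_le_one hts htc hsc)))
    rw [← hr, ← hε] at hm
    by_cases h2 : k = 2
    · rw [h2]
      push_cast
      have p1 := mul_nonneg (sub_nonneg.2 hm) e1
      linarith
    · have d3 := drop (side L) (blockCost_erase_three hBbox (by omega))
      have hk4 : (k : ℝ) ≤ 4 := by exact_mod_cast k4
      have hy0 : 3 / 4 ≤ y := by rw [hy]; linarith [Real.add_one_le_exp (-α)]
      have hside : (3 : ℝ) ≤ side L := by
        have : 3 ≤ side L := by unfold side; omega
        exact_mod_cast this
      generalize (side L : ℝ) = M at d3 hside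
      have h3 : Real.exp (α * (-M)) ≤ y ^ 3 := by
        rw [hy, ← Real.exp_nat_mul]
        refine Real.exp_le_exp.2 ?_
        have := mul_le_mul_of_nonneg_left hside hα
        norm_num
        linarith
      have h4 := two_mul_one_sub_le_cube hy0 (by linarith)
      have h5 : 2 * (1 - y) ≤ 1 - Real.exp (α * (-M)) := by linarith
      have h6 : r * (2 * (1 - y)) ≤ r * (1 - Real.exp (α * (-M))) :=
        mul_le_mul_of_nonneg_left h5 hr0.le
      have h7 : (1 - ε) * (2 * (1 - y)) ≤ r * (2 * (1 - y)) :=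
        mul_le_mul_of_nonneg_right hm (by linarith)
      have h8 : (1 - ε) * (1 - y) * (4 - k) ≥ 0 :=
        mul_nonneg (mul_nonneg (by linarith) e1) (by linarith)
      linarith

end Drift

theorem sum_growthCount {L : ℕ} (c : (Fin 2 → ℤ) → ℕ) (A : Finset (Fin 2 → ℤ)) :
    ∑ x : box 2 L, growthCount L c A x.1 =
      ∑ l ∈ A.image c, ∑ t : Bool × Bool, ((growth L t (block c A l)).card : ℝ) := by
  unfold growthCount
  rw [sum_comm]
  refine sum_congr rfl fun l _ => ?_
  rw [sum_comm]
  refine sum_congr rfl fun t _ => ?_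
  rw [univ_eq_attach,
    sum_attach (box 2 L) (fun x => if x ∈ growth L t (block c A l) then (1 : ℝ) else 0),
    ← sum_filter, sum_const, nsmul_eq_mul, mul_one]
  congr 2
  ext x
  rw [mem_filter]
  exact ⟨fun h => h.2, fun h => ⟨(mem_growth.1 h).1, h⟩⟩

theorem sum_cornerCount {L : ℕ} (c : (Fin 2 → ℤ) → ℕ) {A : Finset (Fin 2 → ℤ)}
    (hA : A ⊆ box 2 L) :
    ∑ x : box 2 L, cornerCount c A x.1 =
      ∑ l ∈ A.image c, ∑ t : Bool × Bool, ((corners t (block c A l)).card : ℝ) := by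
  unfold cornerCount
  rw [sum_comm]
  refine sum_congr rfl fun l _ => ?_
  rw [sum_comm]
  refine sum_congr rfl fun t _ => ?_
  rw [univ_eq_attach,
    sum_attach (box 2 L) (fun x => if x ∈ corners t (block c A l) then (1 : ℝ) else 0),
    ← sum_filter, sum_const, nsmul_eq_mul, mul_one]
  congr 2
  ext x
  rw [mem_filter]
  exact ⟨fun h => h.2, fun h => ⟨hA (block_subset _ _ _ (mem_corners.1 h).1), h⟩⟩

theorem card_box (L : ℕ) : (box 2 L).card = side L ^ 2 := by
  unfold box
  rw [Pi.card_Icc, Fin.prod_univ_two, Int.card_Icc, side, sq]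
  congr 1 <;> omega

/-- The gap is at least of order `1 / L` when violations of the energy are rare enough. -/
theorem le_spectralGap_of_small {L : ℕ} (hL : 1 ≤ L) {β : ℝ} (hβ : 0 ≤ β)
    (hε : 200 * (side L : ℝ) ^ 3 * Real.exp (-(4 * β)) ≤ 1) :
    1 / (8 * (side L : ℝ)) ≤ spectralGap β (box 2 L) (plusBoundary (box 2 L)) := by
  set N : ℝ := (side L : ℝ) with hN
  have hN3 : 3 ≤ N := by
    have : 3 ≤ side L := by unfold side; omega
    rw [hN]; exact_mod_cast this
  set ε := Real.exp (-(4 * β)) with hεd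
  have hε0 : 0 < ε := Real.exp_pos _
  -- The exponent is small enough for the convexity loss `2 * α ^ 2 * N = α / 2` to stay below the
  -- gain of about `α` from the extra corner, and keeps `exp (6 * N * α)` bounded.
  set α : ℝ := 1 / (4 * N) with hα
  have hα0 : 0 < α := by positivity
  have hαN : α * N = 1 / 4 := by rw [hα]; field_simp
  have hα1 : α ≤ 1 / 12 := by nlinarith
  have hεN : 50 * (N * ε) ≤ α := by
    have e : 200 * N ^ 3 * ε = 4 * (50 * (N * ε) * N) * N := by ring
    have h2 : 50 * (N * ε) * N ≤ 1 / 4 := by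
      have h0 : 0 ≤ 50 * (N * ε) * N := by positivity
      nlinarith
    have h3 : 50 * (N * ε) * N ≤ α * N := by linarith
    exact le_of_mul_le_mul_right h3 (by linarith)
  refine le_spectralGap β _ ?_ (by positivity) (fun σ => Real.exp (α * cost L (minusSet σ)))
    (fun σ => Real.exp_pos _) ?_
  · exact ⟨0, mem_box.2 (by simp)⟩
  intro σ hσ
  obtain ⟨c, hc⟩ := exists_cost_eq L (minusSet σ)
  set A := minusSet σ with hA
  have hAbox : A ⊆ box 2 L := minusSet_subset σ
  obtain ⟨a, ha⟩ : ∃ a, a = Real.exp α - 1 := ⟨_, rfl⟩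
  obtain ⟨b, hb⟩ : ∃ b, b = 1 - Real.exp (-α) := ⟨_, rfl⟩
  clear_value α ε N
  have ha0 : 0 ≤ a := by linarith [Real.add_one_le_exp α]
  have ha1 : a ≤ α + α ^ 2 := by
    have := abs_le.1 (Real.abs_exp_sub_one_sub_id_le (x := α) (by rw [abs_of_pos hα0]; linarith))
    linarith [this.2]
  have hb1 : α - α ^ 2 ≤ b := by
    have := abs_le.1 (Real.abs_exp_sub_one_sub_id_le (x := -α)
      (by rw [abs_neg, abs_of_pos hα0]; linarith))
    nlinarith [this.2]
  have hb2 : b ≤ α := by linarith [Real.add_one_le_exp (-α)]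
  have hb0 : 0 ≤ b := by nlinarith
  have hexp : Real.exp (α * (6 * N)) - 1 ≤ 7 / 2 := by
    have h1 : α * (6 * N) = 3 / 2 := by linarith
    rw [h1]
    have h2 : Real.exp (3 / 2) ^ 2 ≤ (9 / 2) ^ 2 := by
      rw [← Real.exp_nat_mul]
      have h3 : ((2 : ℕ) : ℝ) * (3 / 2) = ((3 : ℕ) : ℝ) * 1 := by norm_num
      rw [h3, Real.exp_nat_mul]
      have h4 := Real.exp_one_lt_d9
      have h5 := Real.exp_pos 1
      calc Real.exp 1 ^ 3 ≤ 2.7182818286 ^ 3 := by gcongr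
        _ ≤ (9 / 2) ^ 2 := by norm_num
    have := le_of_sq_le_sq h2 (by norm_num)
    linarith
  have key : ∀ x : box 2 L, flipRate β x σ * (Real.exp (α * ((cost L (minusSet (flip x σ)) : ℝ) -
      cost L A)) - 1) ≤ ε * (7 / 2) + 1 / 2 * a * growthCount L c A x.1
        - 1 / 2 * (1 - ε) * b * cornerCount c A x.1 := by
    intro x
    rcases Int.units_eq_one_or (σ x) with hx | hx
    · have h1 := drift_plus hβ hα0.le hc hx
      rw [← hεd, ← ha, ← hA, ← hN] at h1
      rw [cornerCount_of_notMem (x := x.1) (by rw [hA, coe_mem_minusSet, hx]; decide)]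
      have h2 := mul_le_mul_of_nonneg_left hexp hε0.le
      linarith
    · have h1 := drift_minus hβ hα0.le hL (by linarith) hc hx
      rw [← hεd, ← hb, ← hA] at h1
      have h2 : 0 ≤ 1 / 2 * a * growthCount L c A x.1 :=
        mul_nonneg (mul_nonneg (by norm_num) ha0) (growthCount_nonneg L c A x.1)
      have h3 : 0 ≤ ε * (7 / 2) := by positivity
      linarith
  have total : ∑ x : box 2 L, flipRate β x σ * (Real.exp (α * ((cost L (minusSet (flip x σ)) : ℝ) -
      cost L A)) - 1) ≤ -(α / 2) := by
    refine (sum_le_sum fun x _ => key x).trans ?_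
    rw [sum_sub_distrib, sum_add_distrib, ← mul_sum, ← mul_sum, ← mul_sum, sum_growthCount,
      sum_cornerCount c hAbox, sum_const, card_univ, Fintype.card_coe, card_box,
      nsmul_eq_mul, mul_sum, mul_sum, add_sub_assoc, ← sum_sub_distrib]
    have hne : (A.image c).Nonempty := hσ.image c
    have h1 : ∀ l ∈ A.image c, 1 / 2 * a * ∑ t : Bool × Bool, ((growth L t (block c A l)).card : ℝ) -
        1 / 2 * (1 - ε) * b * ∑ t : Bool × Bool, ((corners t (block c A l)).card : ℝ) ≤
          -(4 / 5 * α) := by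
      intro l hl
      rw [mul_sum, mul_sum, ← sum_sub_distrib]
      have hB : (block c A l).Nonempty := by
        obtain ⟨z, hz, rfl⟩ := mem_image.1 hl
        exact ⟨z, mem_block.2 ⟨hz, rfl⟩⟩
      have hs : ∀ t ∈ (univ : Finset (Bool × Bool)),
          1 / 2 * a * ((growth L t (block c A l)).card : ℝ) -
            1 / 2 * (1 - ε) * b * ((corners t (block c A l)).card : ℝ) ≤ -(α / 5) := by
        intro t _
        have g1 : ((growth L t (block c A l)).card : ℝ) ≤ N := by
          rw [hN]
          exact_mod_cast card_growth_le ((block_subset _ _ _).trans hAbox)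
        have g2 : ((growth L t (block c A l)).card : ℝ) + 1 ≤ (corners t (block c A l)).card := by
          exact_mod_cast card_growth_lt (L := L) (t := t) hB
        have hG : (0 : ℝ) ≤ (growth L t (block c A l)).card := Nat.cast_nonneg _
        generalize ((growth L t (block c A l)).card : ℝ) = G at *
        generalize ((corners t (block c A l)).card : ℝ) = K at *
        have hε1 : ε ≤ 1 / 1000 := by nlinarith
        have hb3 : 0 ≤ (1 - ε) * b := mul_nonneg (by linarith) hb0
        have s1 : (1 - ε) * b * (G + 1) ≤ (1 - ε) * b * K :=
          mul_le_mul_of_nonneg_left g2 hb3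
        -- Growth and corner terms agree to first order in `α`; only this second-order difference is
        -- multiplied by the number `G ≤ N` of growth sites.
        have s2 : a - (1 - ε) * b ≤ 2 * α ^ 2 + ε * α := by nlinarith
        have s3 : (a - (1 - ε) * b) * G ≤ (2 * α ^ 2 + ε * α) * N :=
          (mul_le_mul_of_nonneg_right s2 hG).trans (mul_le_mul_of_nonneg_left g1 (by positivity))
        have s4 : (2 * α ^ 2 + ε * α) * N = α / 2 + α * (N * ε) := by
          have : (2 * α ^ 2 + ε * α) * N = 2 * α * (α * N) + α * (N * ε) := by ring
          rw [this, hαN]; ring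
        have s5 : α * (N * ε) ≤ α * (1 / 600) := mul_le_mul_of_nonneg_left (by linarith) hα0.le
        have s6 : α * (11 / 12) ≤ b := by nlinarith
        have s7 : α * (11 / 12) - α / 1000 ≤ (1 - ε) * b := by nlinarith
        linarith
      refine (sum_le_sum hs).trans ?_
      rw [sum_const]
      simp
      linarith
    have h2 := sum_le_sum h1
    rw [sum_const, nsmul_eq_mul] at h2
    have h3 : (1 : ℝ) ≤ (A.image c).card := by exact_mod_cast hne.card_pos
    have h4 : ((A.image c).card : ℝ) * (-(4 / 5 * α)) ≤ -(4 / 5 * α) := by nlinarith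
    -- The energy-raising flips use up `3/10` of the `4/5` available from a single block, leaving `α
    -- / 2`.
    have h5 : (((side L) ^ 2 : ℕ) : ℝ) * (7 / 2) * ε ≤ 3 / 10 * α := by
      rw [Nat.cast_pow]
      rw [← hN]
      have e : N ^ 2 * (7 / 2) * ε * N = 7 / 400 * (200 * N ^ 3 * ε) := by ring
      have : N ^ 2 * (7 / 2) * ε * N ≤ 3 / 10 * α * N := by rw [e]; nlinarith
      exact le_of_mul_le_mul_right this (by linarith)
    linarith
  have hW : ∀ x : box 2 L, flipRate β x σ * (Real.exp (α * cost L (minusSet (flip x σ))) -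
      Real.exp (α * cost L A)) = flipRate β x σ * (Real.exp (α * ((cost L (minusSet (flip x σ)) : ℝ) -
      cost L A)) - 1) * Real.exp (α * cost L A) := by
    intro x
    rw [mul_assoc, sub_mul, ← Real.exp_add, one_mul]
    ring_nf
  rw [sum_congr rfl fun x _ => hW x, ← sum_mul]
  refine mul_le_mul_of_nonneg_right (total.trans (le_of_eq ?_)) (Real.exp_pos _).le
  rw [hα]; field_simp; norm_num

/-- A crude bound on the gap, valid at every temperature. -/
theorem exists_le_spectralGap (hΛ : Λ.Nonempty) {B : ℝ} :
    ∃ lam : ℝ, 0 < lam ∧ ∀ β : ℝ, 0 ≤ β → β ≤ B →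
      lam ≤ spectralGap β Λ (plusBoundary Λ) := by
  set p : ℝ := 1 / (1 + Real.exp (B * 8)) with hp
  have hp0 : 0 < p := by positivity
  have hp1 : p ≤ 1 := by
    rw [hp, div_le_one (by positivity)]; linarith [Real.exp_pos (B * 8)]
  set n : ℕ := Λ.card with hn
  have hn0 : 0 < n := hΛ.card_pos
  have hn1 : (1 : ℝ) ≤ n := by exact_mod_cast hn0
  -- With this ratio, the total upward drift over `n` sites is at most half of the downward drift
  -- from a single minus spin.
  set r : ℝ := p / (2 * n) with hr
  have hr0 : 0 < r := by positivity
  have hrn : r * n = p / 2 := by rw [hr]; field_simp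
  have hr1 : r ≤ 1 / 2 := by nlinarith
  set w : ℕ → ℝ := fun m => ∑ i ∈ range (m + 1), r ^ i with hw
  have hw0 : ∀ m, 0 < w m := fun m => sum_pos (fun i _ => by positivity) ⟨0, by simp⟩
  have hw2 : ∀ m, w m ≤ 2 := by
    intro m
    have h := geom_sum_eq (show r ≠ 1 by linarith) (m + 1)
    simp only [hw]
    rw [h, div_le_iff_of_neg (by linarith)]
    have : 0 < r ^ (m + 1) := by positivity
    linarith
  refine ⟨p * r ^ n / 4, by positivity, fun β hβ hβB => ?_⟩
  have hrate : ∀ (x : Λ) (σ : Config Λ), p ≤ flipRate β x σ ∧ flipRate β x σ ≤ 1 := by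
    intro x σ
    have hb : barrier x σ ≤ 8 := by
      have h4 : (nbrCount (minusSet σ) x.1 : ℝ) ≤ 4 := by
        exact_mod_cast nbrCount_le_four (minusSet σ) x.1
      have h0 : (0 : ℝ) ≤ nbrCount (minusSet σ) x.1 := Nat.cast_nonneg _
      unfold barrier
      rcases Int.units_eq_one_or (σ x) with h | h <;> rw [h]
      · rw [spin_one]; linarith
      · rw [spin_neg, spin_one]; linarith
    unfold flipRate
    constructor
    · rw [hp]
      refine one_div_le_one_div_of_le (by positivity) ?_
      have : Real.exp (β * barrier x σ) ≤ Real.exp (B * 8) := Real.exp_le_exp.2 (by nlinarith)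
      linarith
    · rw [div_le_one (by positivity)]
      linarith [Real.exp_pos (β * barrier x σ)]
  refine le_spectralGap β _ hΛ (by positivity) (fun σ => w (minusSet σ).card) (fun σ => hw0 _) ?_
  intro σ hσ
  obtain ⟨m, hm⟩ : ∃ m, (minusSet σ).card = m + 1 :=
    ⟨_, (Nat.succ_pred_eq_of_pos hσ.card_pos).symm⟩
  have hmn : m + 1 ≤ n := hm ▸ card_le_card (minusSet_subset σ)
  have hx : ∀ x : Λ, flipRate β x σ * (w (minusSet (flip x σ)).card - w (minusSet σ).card) ≤
      r ^ (m + 2) - (if x.1 ∈ minusSet σ then p * r ^ (m + 1) else 0) := by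
    intro x
    obtain ⟨q1, q2⟩ := hrate x σ
    rcases Int.units_eq_one_or (σ x) with h | h
    · have hxA : x.1 ∉ minusSet σ := by rw [coe_mem_minusSet, h]; decide
      rw [minusSet_flip_of_one h, card_insert_of_notMem hxA, if_neg hxA, hm]
      have : w (m + 1 + 1) - w (m + 1) = r ^ (m + 2) := by
        simp only [hw]; rw [sum_range_succ]; ring
      rw [this]
      have : 0 < r ^ (m + 2) := by positivity
      nlinarith
    · have hxA : x.1 ∈ minusSet σ := coe_mem_minusSet.2 h
      rw [minusSet_flip_of_neg h, card_erase_of_mem hxA, if_pos hxA, hm, Nat.add_sub_cancel]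
      have : w m - w (m + 1) = -r ^ (m + 1) := by
        simp only [hw]; rw [sum_range_succ _ (m + 1)]; ring
      rw [this]
      have h1 : 0 < r ^ (m + 2) := by positivity
      have h2 : 0 < r ^ (m + 1) := by positivity
      nlinarith
  refine (sum_le_sum fun x _ => hx x).trans ?_
  rw [sum_sub_distrib, sum_const, card_univ, Fintype.card_coe, nsmul_eq_mul, hm]
  obtain ⟨z, hz⟩ := hσ
  have h1 : p * r ^ (m + 1) ≤ ∑ x : Λ, if x.1 ∈ minusSet σ then p * r ^ (m + 1) else 0 := by
    have := single_le_sum (f := fun x : Λ => if x.1 ∈ minusSet σ then p * r ^ (m + 1) else 0)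
      (fun x _ => by split_ifs <;> positivity) (mem_univ (⟨z, minusSet_subset σ hz⟩ : Λ))
    simpa [hz] using this
  have h2 : (n : ℝ) * r ^ (m + 2) = p / 2 * r ^ (m + 1) := by
    rw [← hrn]; ring
  have h3 : r ^ n ≤ r ^ (m + 1) := pow_le_pow_of_le_one hr0.le (by linarith) hmn
  have h4 := hw2 (m + 1)
  have h5 : p * r ^ n / 4 * w (m + 1) ≤ p * r ^ n / 4 * 2 :=
    mul_le_mul_of_nonneg_left h4 (by positivity)
  have h6 : p * r ^ n ≤ p * r ^ (m + 1) := mul_le_mul_of_nonneg_left h3 hp0.le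
  rw [← hn]
  linarith

end IsingGlauber

/-! ### Path amplitudes with a slowly turning angle, and path heights. -/

namespace IsingGlauber
open Finset

/-- The interpolating angle at the `i`-th step of a path with `p + 1` steps. -/
noncomputable def angle (p : ℕ) (i : ℕ) : ℝ := Real.pi * i / (2 * p)

/-- The amplitude of a single step. -/
noncomputable def stepWeight (p : ℕ) (i : Fin (p + 1)) (b : Bool) : ℝ :=
  if b then Real.cos (angle p i) else Real.sin (angle p i)

/-- The amplitude of a path. -/
noncomputable def pathWeight {p : ℕ} (ζ : Fin (p + 1) → Bool) : ℝ := ∏ i, stepWeight p i (ζ i)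

/-- Exchange of the steps `i` and `i + 1`. -/
def swapSteps {p : ℕ} (i : Fin p) (ζ : Fin (p + 1) → Bool) : Fin (p + 1) → Bool :=
  ζ ∘ Equiv.swap i.castSucc i.succ

theorem sum_stepWeight_sq (p : ℕ) (i : Fin (p + 1)) : ∑ b, stepWeight p i b ^ 2 = 1 := by
  simp [stepWeight]

theorem sum_pathWeight_sq (p : ℕ) : ∑ ζ : Fin (p + 1) → Bool, pathWeight ζ ^ 2 = 1 := by
  have h := Finset.prod_univ_sum (fun _ : Fin (p + 1) => (univ : Finset Bool))
    (fun i b => stepWeight p i b ^ 2)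
  rw [Fintype.piFinset_univ] at h
  simp only [pathWeight, ← prod_pow]
  rw [← h]
  exact prod_eq_one fun i _ => sum_stepWeight_sq p i

theorem swap_sq_le (p : ℕ) (i : Fin p) (ζ : Fin (p + 1) → Bool) :
    (pathWeight (swapSteps i ζ) - pathWeight ζ) ^ 2 ≤ (Real.pi / (2 * p)) ^ 2 *
      ∏ k, if k = i.castSucc ∨ k = i.succ then 1 else stepWeight p k (ζ k) ^ 2 := by
  have hne : i.castSucc ≠ i.succ := (Fin.castSucc_lt_succ).ne
  set s : Finset (Fin (p + 1)) := univ.filter fun k => ¬ (k = i.castSucc ∨ k = i.succ) with hs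
  have hsplit : ∀ f : Fin (p + 1) → ℝ, ∏ k, f k = f i.castSucc * f i.succ * ∏ k ∈ s, f k := by
    intro f
    rw [← prod_filter_mul_prod_filter_not univ (fun k => k = i.castSucc ∨ k = i.succ)]
    congr 1
    have : (univ.filter fun k => k = i.castSucc ∨ k = i.succ) = {i.castSucc, i.succ} := by
      ext k; simp
    rw [this, prod_pair hne]
  have hR : ∏ k ∈ s, stepWeight p k (swapSteps i ζ k) = ∏ k ∈ s, stepWeight p k (ζ k) := by
    refine prod_congr rfl fun k hk => ?_
    rw [hs, mem_filter, not_or] at hk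
    simp only [swapSteps, Function.comp]
    rw [Equiv.swap_apply_of_ne_of_ne hk.2.1 hk.2.2]
  have hR2 : (∏ k ∈ s, if k = i.castSucc ∨ k = i.succ then 1 else stepWeight p k (ζ k) ^ 2) =
      (∏ k ∈ s, stepWeight p k (ζ k)) ^ 2 := by
    rw [← prod_pow]
    refine prod_congr rfl fun k hk => ?_
    rw [hs, mem_filter] at hk
    rw [if_neg hk.2]
  unfold pathWeight
  rw [hsplit, hsplit (fun k => stepWeight p k (ζ k)), hsplit (fun k => if k = i.castSucc ∨ k = i.succ then 1 else stepWeight p k (ζ k) ^ 2), hR, hR2]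
  simp only [true_or, or_true, if_true, one_mul, swapSteps, Function.comp, Equiv.swap_apply_left,
    Equiv.swap_apply_right]
  rw [← sub_mul, mul_pow]
  refine mul_le_mul_of_nonneg_right ?_ (sq_nonneg _)
  have hang : angle p i.succ - angle p i.castSucc = Real.pi / (2 * p) := by
    simp only [angle, Fin.val_succ, Fin.val_castSucc]
    push_cast
    ring
  have hsin : Real.sin (Real.pi / (2 * p)) ^ 2 ≤ (Real.pi / (2 * p)) ^ 2 := by
    rw [sq_le_sq]
    exact Real.abs_sin_le_abs
  rw [← hang, Real.sin_sub] at hsin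
  rw [← hang]
  -- Exchanging equal steps changes nothing; for unequal steps the difference is, up to sign, the
  -- sine of the angle increment.
  cases h1 : ζ i.castSucc <;> cases h2 : ζ i.succ <;> simp only [stepWeight, if_true, if_false, Bool.false_eq_true] <;>
    nlinarith

theorem sum_swap_sq_le (p : ℕ) (i : Fin p) :
    ∑ ζ : Fin (p + 1) → Bool, (pathWeight (swapSteps i ζ) - pathWeight ζ) ^ 2 ≤
      4 * (Real.pi / (2 * p)) ^ 2 := by
  refine (sum_le_sum fun ζ _ => swap_sq_le p i ζ).trans ?_
  rw [← mul_sum, mul_comm (4 : ℝ)]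
  refine mul_le_mul_of_nonneg_left ?_ (sq_nonneg _)
  have h := Finset.prod_univ_sum (fun _ : Fin (p + 1) => (univ : Finset Bool))
    (fun k b => if k = i.castSucc ∨ k = i.succ then (1 : ℝ) else stepWeight p k b ^ 2)
  rw [Fintype.piFinset_univ] at h
  rw [← h]
  -- Each of the two exchanged positions contributes a factor two, every other position a normalised
  -- factor one.
  have hk : ∀ k : Fin (p + 1), (∑ b, if k = i.castSucc ∨ k = i.succ then (1 : ℝ) else stepWeight p k b ^ 2)
      = if k ∈ ({i.castSucc, i.succ} : Finset (Fin (p + 1))) then 2 else 1 := by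
    intro k
    by_cases hk : k = i.castSucc ∨ k = i.succ
    · simp [hk]
    · simp only [if_neg hk, sum_stepWeight_sq]; simp [hk]
  rw [prod_congr rfl fun k _ => hk k, prod_ite_mem, univ_inter, prod_const]
  have : ({i.castSucc, i.succ} : Finset (Fin (p + 1))).card ≤ 2 := card_le_two
  calc (2 : ℝ) ^ ({i.castSucc, i.succ} : Finset (Fin (p + 1))).card ≤ 2 ^ 2 :=
        pow_le_pow_right₀ (by norm_num) this
    _ = 4 := by norm_num

/-- The number of horizontal steps among the first `j`. -/
def height {p : ℕ} (ζ : Fin (p + 1) → Bool) (j : ℕ) : ℕ :=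
  ∑ i ∈ range j, if h : i < p + 1 then (if ζ ⟨i, h⟩ then 1 else 0) else 0

/-- Paths with `w` horizontal steps. -/
def sector (p w : ℕ) : Finset (Fin (p + 1) → Bool) := univ.filter fun ζ => height ζ (p + 1) = w

/-- In some sector the amplitudes have a small Dirichlet form. -/
theorem exists_sector {p : ℕ} (hp : 1 ≤ p) : ∃ w, 0 < ∑ ζ ∈ sector p w, pathWeight ζ ^ 2 ∧
    ∑ ζ ∈ sector p w, ∑ i : Fin p, (pathWeight (swapSteps i ζ) - pathWeight ζ) ^ 2 ≤
      10 / p * ∑ ζ ∈ sector p w, pathWeight ζ ^ 2 := by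
  -- If every sector of positive mass violated the bound, summing over sectors would contradict the
  -- total energy `π ^ 2 / p ≤ 10 / p`.
  by_contra hn
  push Not at hn
  set T : Finset ℕ := univ.image fun ζ : Fin (p + 1) → Bool => height ζ (p + 1) with hT
  have fib : ∀ f : (Fin (p + 1) → Bool) → ℝ, ∑ w ∈ T, ∑ ζ ∈ sector p w, f ζ = ∑ ζ, f ζ := by
    intro f
    exact sum_fiberwise_of_maps_to (fun ζ _ => mem_image_of_mem _ (mem_univ ζ)) f
  have hp0 : (0 : ℝ) < p := by exact_mod_cast hp
  have hle : ∀ w ∈ T, 10 / (p : ℝ) * ∑ ζ ∈ sector p w, pathWeight ζ ^ 2 ≤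
      ∑ ζ ∈ sector p w, ∑ i : Fin p, (pathWeight (swapSteps i ζ) - pathWeight ζ) ^ 2 := by
    intro w _
    have h0 : 0 ≤ ∑ ζ ∈ sector p w, pathWeight ζ ^ 2 := sum_nonneg fun _ _ => sq_nonneg _
    rcases h0.eq_or_lt with h | h
    · rw [← h, mul_zero]
      exact sum_nonneg fun _ _ => sum_nonneg fun _ _ => sq_nonneg _
    · exact (hn w h).le
  have hlt : ∃ w ∈ T, 10 / (p : ℝ) * ∑ ζ ∈ sector p w, pathWeight ζ ^ 2 <
      ∑ ζ ∈ sector p w, ∑ i : Fin p, (pathWeight (swapSteps i ζ) - pathWeight ζ) ^ 2 := by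
    have h1 : 0 < ∑ w ∈ T, ∑ ζ ∈ sector p w, pathWeight ζ ^ 2 := by
      rw [fib, sum_pathWeight_sq]; norm_num
    obtain ⟨w, hw, h⟩ := exists_lt_of_sum_lt (s := T) (f := fun _ => (0 : ℝ)) (by simpa using h1)
    exact ⟨w, hw, hn w h⟩
  have h := sum_lt_sum hle hlt
  rw [← mul_sum, fib, fib, sum_pathWeight_sq, mul_one, sum_comm] at h
  have h2 := sum_le_sum fun i (_ : i ∈ (univ : Finset (Fin p))) => sum_swap_sq_le p i
  rw [sum_const, card_univ, Fintype.card_fin, nsmul_eq_mul] at h2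
  have h3 : (p : ℝ) * (4 * (Real.pi / (2 * p)) ^ 2) = Real.pi ^ 2 / p := by field_simp; ring
  have h4 : Real.pi ^ 2 ≤ 10 := by
    have := Real.pi_lt_d2
    have := Real.pi_pos
    nlinarith
  have h5 : Real.pi ^ 2 / p ≤ 10 / p := by gcongr
  linarith

section Height

variable {p : ℕ} (ζ : Fin (p + 1) → Bool)

@[simp] theorem height_zero : height ζ 0 = 0 := by simp [height]

theorem height_succ (j : ℕ) : height ζ (j + 1) =
    height ζ j + if h : j < p + 1 then (if ζ ⟨j, h⟩ then 1 else 0) else 0 := by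
  unfold height; rw [sum_range_succ]

theorem height_le_succ (j : ℕ) : height ζ j ≤ height ζ (j + 1) := by
  rw [height_succ]; exact Nat.le_add_right _ _

theorem height_succ_le (j : ℕ) : height ζ (j + 1) ≤ height ζ j + 1 := by
  rw [height_succ]; split_ifs <;> omega

theorem height_mono : Monotone (height ζ) := monotone_nat_of_le_succ (height_le_succ ζ)

theorem height_add_le (j m : ℕ) : height ζ (j + m) ≤ height ζ j + m := by
  induction m with
  | zero => rfl
  | succ m ih => have := height_succ_le ζ (j + m); rw [← add_assoc]; omega

theorem height_le (j : ℕ) : height ζ j ≤ j := by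
  have := height_add_le ζ 0 j; simpa using this

theorem height_of_ge {j : ℕ} (hj : p + 1 ≤ j) : height ζ j = height ζ (p + 1) := by
  obtain ⟨m, rfl⟩ := Nat.exists_eq_add_of_le hj
  induction m with
  | zero => rfl
  | succ m ih => rw [← add_assoc, height_succ, ih (by omega), dif_neg (by omega)]; rfl

theorem height_le_total (j : ℕ) : height ζ j ≤ height ζ (p + 1) := by
  rcases le_total j (p + 1) with h | h
  · exact height_mono ζ h
  · rw [height_of_ge ζ h]

theorem total_le_height {j : ℕ} (hj : j ≤ p + 1) : height ζ (p + 1) + j ≤ height ζ j + (p + 1) := by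
  obtain ⟨m, hm⟩ := Nat.exists_eq_add_of_le hj
  have := height_add_le ζ j m
  rw [← hm] at this
  omega

theorem height_injective {ζ ζ' : Fin (p + 1) → Bool}
    (h : ∀ j, j ≤ p + 1 → height ζ j = height ζ' j) : ζ = ζ' := by
  funext i
  have h1 := h i (by omega)
  have h2 := h (i + 1) (by omega)
  rw [height_succ, height_succ, h1, dif_pos i.2, dif_pos i.2] at h2
  cases h3 : ζ i <;> cases h4 : ζ' i <;> simp_all

theorem height_swapSteps_of_ne (i : Fin p) {j : ℕ} (hj : j ≠ i + 1) :
    height (swapSteps i ζ) j = height ζ j := by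
  have hstep : ∀ m : ℕ, m ≠ i → m ≠ i + 1 → height (swapSteps i ζ) m = height ζ m →
      height (swapSteps i ζ) (m + 1) = height ζ (m + 1) := by
    intro m h1 h2 h
    rw [height_succ, height_succ, h]
    congr 1
    by_cases hm : m < p + 1
    · have hs : swapSteps i ζ ⟨m, hm⟩ = ζ ⟨m, hm⟩ := by
        simp only [swapSteps, Function.comp]
        rw [Equiv.swap_apply_of_ne_of_ne]
        · intro h3; exact h1 (by simpa using congrArg Fin.val h3)
        · intro h3; exact h2 (by simpa using congrArg Fin.val h3)
      rw [dif_pos hm, dif_pos hm, hs]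
    · rw [dif_neg hm, dif_neg hm]
  have low : ∀ m : ℕ, m ≤ i → height (swapSteps i ζ) m = height ζ m := by
    intro m
    induction m with
    | zero => simp
    | succ m ih => intro hm; exact hstep m (by omega) (by omega) (ih (by omega))
  have mid : height (swapSteps i ζ) (i + 1 + 1) = height ζ (i + 1 + 1) := by
    have e1 : (⟨i, by omega⟩ : Fin (p + 1)) = i.castSucc := rfl
    have e2 : (⟨i + 1, by omega⟩ : Fin (p + 1)) = i.succ := rfl
    have hi := i.2
    rw [height_succ, height_succ, height_succ ζ, height_succ ζ, low i le_rfl, dif_pos (by omega),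
      dif_pos (by omega), dif_pos (by omega), dif_pos (by omega), e1, e2]
    simp only [swapSteps, Function.comp, Equiv.swap_apply_left, Equiv.swap_apply_right]
    omega
  have high : ∀ m, height (swapSteps i ζ) (i + 1 + 1 + m) = height ζ (i + 1 + 1 + m) := by
    intro m
    induction m with
    | zero => exact mid
    | succ m ih => exact hstep (i + 1 + 1 + m) (by omega) (by omega) ih
  rcases lt_or_gt_of_ne hj with h | h
  · exact low j (by omega)
  · obtain ⟨m, rfl⟩ := Nat.exists_eq_add_of_le (show (i : ℕ) + 1 + 1 ≤ j by omega)
    exact high m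

theorem height_swapSteps_self (i : Fin p) :
    height (swapSteps i ζ) (i + 1) + height ζ (i + 1) = height ζ i + height ζ (i + 1 + 1) := by
  have e1 : (⟨i, by omega⟩ : Fin (p + 1)) = i.castSucc := rfl
  have e2 : (⟨i + 1, by omega⟩ : Fin (p + 1)) = i.succ := rfl
  have hi := i.2
  rw [height_succ, height_swapSteps_of_ne ζ i (by omega), height_succ ζ (i + 1),
    dif_pos (by omega), dif_pos (by omega), e1, e2]
  simp only [swapSteps, Function.comp, Equiv.swap_apply_left]
  omega

/-- Paths of non-zero amplitude start with a horizontal and end with a vertical step. -/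
theorem support_of_pathWeight_ne_zero (hp : 1 ≤ p) {ζ : Fin (p + 1) → Bool}
    (h : pathWeight ζ ≠ 0) : height ζ 1 = 1 ∧ height ζ p = height ζ (p + 1) := by
  have h' := fun i => (prod_ne_zero_iff.1 h) i (mem_univ i)
  constructor
  · rw [height_succ, height_zero, dif_pos (by omega)]
    have h0 := h' ⟨0, by omega⟩
    cases h1 : ζ ⟨0, by omega⟩
    · rw [stepWeight, h1] at h0
      simp [angle] at h0
    · simp
  · rw [height_succ, dif_pos (by omega)]
    have h0 := h' ⟨p, by omega⟩
    cases h1 : ζ ⟨p, by omega⟩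
    · simp
    · rw [stepWeight, h1, if_pos rfl, angle] at h0
      refine absurd ?_ h0
      have hp0 : (p : ℝ) ≠ 0 := by positivity
      have : Real.pi * (((⟨p, by omega⟩ : Fin (p + 1)) : ℕ) : ℝ) / (2 * p) = Real.pi / 2 := by
        field_simp
      rw [this, Real.cos_pi_div_two]

end Height

end IsingGlauber

/-! ### Droplets bounded by four staircase paths. -/

namespace IsingGlauber
open Finset

/-- Distance of a coordinate from the axis, the axis lying between `-1` and `0`. -/
def fold (u : ℤ) : ℕ := if 0 ≤ u then u.toNat else (-1 - u).toNat

/-- The coordinate on the given side of the axis with the given distance. -/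
def unfoldCoord (b : Bool) (a : ℕ) : ℤ := if b then (a : ℤ) else -1 - (a : ℤ)

/-- The quadrant of a site. -/
def quad (z : Fin 2 → ℤ) : Bool × Bool := (decide (0 ≤ z 0), decide (0 ≤ z 1))

theorem fold_unfoldCoord (b : Bool) (a : ℕ) : fold (unfoldCoord b a) = a := by
  cases b
  · have : ¬ (0 : ℤ) ≤ -1 - (a : ℤ) := by omega
    simp only [fold, unfoldCoord, Bool.false_eq_true, if_false, if_neg this]; omega
  · simp [fold, unfoldCoord]

theorem quad_unfoldCoord (q : Bool × Bool) (a b : ℕ) :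
    quad ![unfoldCoord q.1 a, unfoldCoord q.2 b] = q := by
  obtain ⟨q1, q2⟩ := q
  cases q1 <;> cases q2 <;> simp [quad, unfoldCoord] <;> omega

theorem fold_ext {z z' : Fin 2 → ℤ} (h : quad z = quad z') (h0 : fold (z 0) = fold (z' 0))
    (h1 : fold (z 1) = fold (z' 1)) : z = z' := by
  simp only [quad, Prod.mk.injEq, decide_eq_decide] at h
  unfold fold at h0 h1
  refine point_ext ?_ ?_
  · split_ifs at h0 <;> omega
  · split_ifs at h1 <;> omega

theorem fold_mem_box {L : ℕ} {z : Fin 2 → ℤ} (h0 : fold (z 0) < L) (h1 : fold (z 1) < L) :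
    z ∈ box 2 L := by
  unfold fold at h0 h1
  rw [mem_box]
  split_ifs at h0 h1 <;> omega

/-- Moving a coordinate one step away from the axis. -/
def outer (u : ℤ) : ℤ := if 0 ≤ u then u + 1 else u - 1

/-- Moving a coordinate one step towards the axis. -/
def inner (u : ℤ) : ℤ := if 0 ≤ u then u - 1 else u + 1

theorem fold_outer (u : ℤ) : fold (outer u) = fold u + 1 := by
  unfold fold outer; split_ifs <;> omega

theorem nonneg_outer (u : ℤ) : 0 ≤ outer u ↔ 0 ≤ u := by
  unfold outer; split_ifs <;> omega

theorem fold_inner_of_pos {u : ℤ} (h : 0 < fold u) :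
    fold (inner u) + 1 = fold u ∧ (0 ≤ inner u ↔ 0 ≤ u) := by
  unfold fold inner at *; split_ifs at * <;> omega

theorem fold_inner_of_zero {u : ℤ} (h : fold u = 0) : fold (inner u) = 0 := by
  unfold fold inner at *; split_ifs at * <;> omega

theorem nbrCount_eq_four (A : Finset (Fin 2 → ℤ)) (z : Fin 2 → ℤ) :
    nbrCount A z = (if ![outer (z 0), z 1] ∈ A then 1 else 0) +
      (if ![inner (z 0), z 1] ∈ A then 1 else 0) +
      (if ![z 0, outer (z 1)] ∈ A then 1 else 0) +
      (if ![z 0, inner (z 1)] ∈ A then 1 else 0) := by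
  have key : ∀ a b c d : ℤ, (![a, b] : Fin 2 → ℤ) = ![c, d] ↔ a = c ∧ b = d := by
    intro a b c d; simp
  have h1 : nbrCount A z = ∑ y ∈ nbrs z, if y ∈ A then 1 else 0 := by
    unfold nbrCount
    rw [← card_filter]
    congr 1
    ext y
    rw [mem_filter, mem_filter, mem_nbrs, and_comm]
  have h2 : nbrs z = {![outer (z 0), z 1], ![inner (z 0), z 1], ![z 0, outer (z 1)],
      ![z 0, inner (z 1)]} := by
    ext y
    simp only [nbrs, mem_insert, mem_singleton, outer, inner]
    split_ifs <;> tauto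
  rw [h1, h2, sum_insert, sum_insert, sum_insert, sum_singleton]
  · omega
  all_goals
    simp only [mem_insert, mem_singleton, key, outer, inner]
    split_ifs <;> omega

section Droplet

variable {p : ℕ}

/-- Membership in the droplet whose boundary in each quadrant is given by a path. -/
def InDroplet (k : ℕ) (η : Bool × Bool → Fin (p + 1) → Bool) (z : Fin 2 → ℤ) : Prop :=
  fold (z 0) + 1 ≤ height (η (quad z)) (fold (z 0) + k - fold (z 1))

instance (k : ℕ) (η : Bool × Bool → Fin (p + 1) → Bool) (z : Fin 2 → ℤ) :
    Decidable (InDroplet k η z) := inferInstanceAs (Decidable (_ ≤ _))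

/-- The paths have `w` horizontal and `k` vertical steps. -/
def InSector (w : ℕ) (η : Bool × Bool → Fin (p + 1) → Bool) : Prop :=
  ∀ q, height (η q) (p + 1) = w

/-- All paths start horizontally and end vertically. -/
def IsSupported (w : ℕ) (η : Bool × Bool → Fin (p + 1) → Bool) : Prop :=
  ∀ q, height (η q) 1 = 1 ∧ height (η q) p = w

variable {w k : ℕ} {η : Bool × Bool → Fin (p + 1) → Bool}

theorem quad_eq {z z' : Fin 2 → ℤ} (h0 : 0 ≤ z 0 ↔ 0 ≤ z' 0) (h1 : 0 ≤ z 1 ↔ 0 ≤ z' 1) :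
    quad z = quad z' := by
  simp [quad, h0, h1]

/-- In folded coordinates a path starts at `(0, k)`, and after `j` steps it is at horizontal
position `height j` on the diagonal `a - b + k = j`. The outer vertex of the cell of a site lies on
the diagonal through its inner vertex, so the site is in the droplet when the path passes at or
beyond that vertex. Membership thus involves one height only. -/
theorem fold_lt_of_inDroplet (hwk : w + k = p + 1) (hη : InSector w η) {z : Fin 2 → ℤ}
    (hz : InDroplet k η z) : fold (z 0) < w ∧ fold (z 1) < k := by
  unfold InDroplet at hz
  have h1 := height_le_total (η (quad z)) (fold (z 0) + k - fold (z 1))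
  have h2 := height_le (η (quad z)) (fold (z 0) + k - fold (z 1))
  have h3 := hη (quad z)
  omega

/-- A vertical last step makes the rows next to the axis reach the full half-width in every
quadrant, so the quadrants match across the axis. -/
theorem mem_axis (hwk : w + k = p + 1) (hη : InSector w η) (hs : IsSupported w η)
    {z : Fin 2 → ℤ} (h1 : fold (z 1) = 0) : InDroplet k η z ↔ fold (z 0) < w := by
  refine ⟨fun h => (fold_lt_of_inDroplet hwk hη h).1, fun h => ?_⟩
  unfold InDroplet
  rw [h1, Nat.sub_zero]
  rcases le_or_gt (fold (z 0) + k) p with h2 | h2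
  · obtain ⟨m, hm⟩ := Nat.exists_eq_add_of_le h2
    have h3 := height_add_le (η (quad z)) (fold (z 0) + k) m
    rw [← hm, (hs (quad z)).2] at h3
    omega
  · rw [height_of_ge _ h2, hη]; omega

theorem mem_axis' (hwk : w + k = p + 1) (hη : InSector w η) (hs : IsSupported w η)
    {z : Fin 2 → ℤ} (h0 : fold (z 0) = 0) : InDroplet k η z ↔ fold (z 1) < k := by
  refine ⟨fun h => (fold_lt_of_inDroplet hwk hη h).2, fun h => ?_⟩
  unfold InDroplet
  rw [h0, Nat.zero_add, Nat.zero_add]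
  have h2 := height_mono (η (quad z)) (show 1 ≤ k - fold (z 1) by omega)
  rw [(hs (quad z)).1] at h2
  omega

theorem inner_mem (hwk : w + k = p + 1) (hη : InSector w η) (hs : IsSupported w η)
    {z : Fin 2 → ℤ} (hz : InDroplet k η z) :
    InDroplet k η ![inner (z 0), z 1] ∧ InDroplet k η ![z 0, inner (z 1)] := by
  have hlt := fold_lt_of_inDroplet hwk hη hz
  constructor
  · rcases Nat.eq_zero_or_pos (fold (z 0)) with h | h
    · refine (mem_axis' hwk hη hs ?_).2 ?_
      · simpa using fold_inner_of_zero h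
      · simpa using hlt.2
    · have hi := fold_inner_of_pos h
      have hq : quad ![inner (z 0), z 1] = quad z := quad_eq (by simpa using hi.2) (by simp)
      unfold InDroplet at *
      rw [hq]
      simp only [Matrix.cons_val_zero, Matrix.cons_val_one]
      have h1 := height_succ_le (η (quad z)) (fold (inner (z 0)) + k - fold (z 1))
      have h2 : fold (inner (z 0)) + k - fold (z 1) + 1 = fold (z 0) + k - fold (z 1) := by omega
      rw [h2] at h1
      omega
  · rcases Nat.eq_zero_or_pos (fold (z 1)) with h | h
    · refine (mem_axis hwk hη hs ?_).2 ?_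
      · simpa using fold_inner_of_zero h
      · simpa using hlt.1
    · have hi := fold_inner_of_pos h
      have hq : quad ![z 0, inner (z 1)] = quad z := quad_eq (by simp) (by simpa using hi.2)
      unfold InDroplet at *
      rw [hq]
      simp only [Matrix.cons_val_zero, Matrix.cons_val_one]
      exact hz.trans (height_mono _ (by omega))

theorem outer_mem {z : Fin 2 → ℤ} :
    (InDroplet k η ![outer (z 0), z 1] ↔
      fold (z 0) + 2 ≤ height (η (quad z)) (fold (z 0) + 1 + k - fold (z 1))) ∧
    (InDroplet k η ![z 0, outer (z 1)] ↔
      fold (z 0) + 1 ≤ height (η (quad z)) (fold (z 0) + k - (fold (z 1) + 1))) := by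
  have hq : quad ![outer (z 0), z 1] = quad z := quad_eq (by simpa using nonneg_outer _) (by simp)
  have hq' : quad ![z 0, outer (z 1)] = quad z := quad_eq (by simp) (by simpa using nonneg_outer _)
  unfold InDroplet
  rw [hq, hq']
  simp only [Matrix.cons_val_zero, Matrix.cons_val_one, fold_outer]
  exact ⟨trivial, trivial⟩

theorem outer_notMem {z : Fin 2 → ℤ} (hz : ¬ InDroplet k η z) :
    ¬ InDroplet k η ![outer (z 0), z 1] ∧ ¬ InDroplet k η ![z 0, outer (z 1)] := by
  rw [outer_mem.1, outer_mem.2]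
  unfold InDroplet at hz
  constructor
  · intro h
    apply hz
    have h1 := height_succ_le (η (quad z)) (fold (z 0) + k - fold (z 1))
    rcases le_or_gt (fold (z 1)) (fold (z 0) + k) with h2 | h2
    · rw [show fold (z 0) + 1 + k - fold (z 1) = fold (z 0) + k - fold (z 1) + 1 by omega] at h
      omega
    · rw [show fold (z 0) + 1 + k - fold (z 1) = 0 by omega, height_zero] at h
      omega
  · intro h
    exact hz (h.trans (height_mono _ (by omega)))

/-- The heights around a removable site of the droplet. -/
theorem height_of_removable (hwk : w + k = p + 1) (hη : InSector w η) (hs : IsSupported w η)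
    {z : Fin 2 → ℤ} (hz : InDroplet k η z) (h0 : ¬ InDroplet k η ![outer (z 0), z 1])
    (h1 : ¬ InDroplet k η ![z 0, outer (z 1)]) :
    ∃ i : Fin p, fold (z 0) + k = fold (z 1) + (i + 1) ∧
      height (η (quad z)) i = fold (z 0) ∧ height (η (quad z)) (i + 1) = fold (z 0) + 1 ∧
      height (η (quad z)) (i + 1 + 1) = fold (z 0) + 1 := by
  rw [outer_mem.1] at h0
  rw [outer_mem.2] at h1
  have hlt := fold_lt_of_inDroplet hwk hη hz
  unfold InDroplet at hz
  obtain ⟨i, hi⟩ : ∃ i, fold (z 0) + k = fold (z 1) + (i + 1) :=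
    ⟨fold (z 0) + k - fold (z 1) - 1, by omega⟩
  rw [show fold (z 0) + 1 + k - fold (z 1) = i + 1 + 1 by omega] at h0
  rw [show fold (z 0) + k - (fold (z 1) + 1) = i by omega] at h1
  rw [show fold (z 0) + k - fold (z 1) = i + 1 by omega] at hz
  have e1 := height_succ_le (η (quad z)) i
  have e2 := height_le_succ (η (quad z)) (i + 1)
  -- The last step is vertical, so the horizontal step at index `i` cannot be the last one and a
  -- step `i + 1` follows.
  have hip : i < p := by
    by_contra hn
    have e3 := height_mono (η (quad z)) (show p ≤ i by omega)
    rw [(hs _).2] at e3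
    have e4 := height_le_total (η (quad z)) (i + 1)
    rw [hη] at e4
    omega
  refine ⟨⟨i, hip⟩, hi, ?_, ?_, ?_⟩ <;> simp only <;> omega

/-- The heights around a site at which the droplet can grow. -/
theorem height_of_addable (hwk : w + k = p + 1) (hη : InSector w η) (hs : IsSupported w η)
    {z : Fin 2 → ℤ} (hz : ¬ InDroplet k η z) (h0 : InDroplet k η ![inner (z 0), z 1])
    (h1 : InDroplet k η ![z 0, inner (z 1)]) :
    ∃ i : Fin p, fold (z 0) + k = fold (z 1) + (i + 1) ∧
      height (η (quad z)) i = fold (z 0) ∧ height (η (quad z)) (i + 1) = fold (z 0) ∧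
      height (η (quad z)) (i + 1 + 1) = fold (z 0) + 1 := by
  have l0 := (fold_lt_of_inDroplet hwk hη h0).2
  have l1 := (fold_lt_of_inDroplet hwk hη h1).1
  simp only [Matrix.cons_val_zero, Matrix.cons_val_one] at l0 l1
  -- Next to an axis the inner neighbour is across that axis and forces `z` into the droplet; away
  -- from both axes, everything takes place in one quadrant.
  rcases Nat.eq_zero_or_pos (fold (z 0)) with h | h
  · exact absurd ((mem_axis' hwk hη hs h).2 l0) hz
  rcases Nat.eq_zero_or_pos (fold (z 1)) with h' | h'
  · exact absurd ((mem_axis hwk hη hs h').2 l1) hz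
  have hi := fold_inner_of_pos h
  have hi' := fold_inner_of_pos h'
  have hq : quad ![inner (z 0), z 1] = quad z := quad_eq (by simpa using hi.2) (by simp)
  have hq' : quad ![z 0, inner (z 1)] = quad z := quad_eq (by simp) (by simpa using hi'.2)
  unfold InDroplet at *
  rw [hq] at h0
  rw [hq'] at h1
  simp only [Matrix.cons_val_zero, Matrix.cons_val_one] at h0 h1
  have g0 : fold (inner (z 0)) + k - fold (z 1) ≠ 0 := by
    intro hn; rw [hn, height_zero] at h0; omega
  obtain ⟨i, hi3⟩ : ∃ i, fold (z 0) + k = fold (z 1) + (i + 1) :=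
    ⟨fold (z 0) + k - fold (z 1) - 1, by omega⟩
  rw [show fold (inner (z 0)) + k - fold (z 1) = i by omega] at h0
  rw [show fold (z 0) + k - fold (inner (z 1)) = i + 1 + 1 by omega] at h1
  rw [show fold (z 0) + k - fold (z 1) = i + 1 by omega] at hz
  have e1 := height_succ_le (η (quad z)) (i + 1)
  have e2 := height_le_succ (η (quad z)) i
  have hip : i < p := by
    by_contra hn
    have e3 := height_succ (η (quad z)) (i + 1)
    rw [dif_neg (by omega)] at e3
    omega
  refine ⟨⟨i, hip⟩, hi3, ?_, ?_, ?_⟩ <;> simp only <;> omega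

/-- The effect of an exchange of steps on the droplet. -/
theorem inDroplet_swap {z : Fin 2 → ℤ} {i : Fin p} (hi : fold (z 0) + k = fold (z 1) + (i + 1))
    (h : (height (η (quad z)) (i + 1) = fold (z 0) + 1 ∧
        height (swapSteps i (η (quad z))) (i + 1) = fold (z 0)) ∨
      (height (η (quad z)) (i + 1) = fold (z 0) ∧
        height (swapSteps i (η (quad z))) (i + 1) = fold (z 0) + 1)) (y : Fin 2 → ℤ) :
    InDroplet k (Function.update η (quad z) (swapSteps i (η (quad z)))) y ↔
      if y = z then ¬ InDroplet k η z else InDroplet k η y := by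
  by_cases hyz : y = z
  · subst hyz
    rw [if_pos rfl]
    unfold InDroplet
    rw [Function.update_self, show fold (y 0) + k - fold (y 1) = i + 1 by omega]
    omega
  · rw [if_neg hyz]
    unfold InDroplet
    by_cases hq : quad y = quad z
    · rw [hq, Function.update_self]
      by_cases hj : fold (y 0) + k - fold (y 1) = i + 1
      · have hne : fold (y 0) ≠ fold (z 0) := fun h0 => hyz (fold_ext hq h0 (by omega))
        rw [hj]
        omega
      · rw [height_swapSteps_of_ne _ _ hj]
    · rw [Function.update_of_ne hq]

theorem droplet_injective (hwk : w + k = p + 1) {η η' : Bool × Bool → Fin (p + 1) → Bool}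
    (hη : InSector w η) (hη' : InSector w η') {L : ℕ} (hL : p + 1 ≤ L)
    (h : ∀ z ∈ box 2 L, InDroplet k η z ↔ InDroplet k η' z) : η = η' := by
  have aux : ∀ {η η' : Bool × Bool → Fin (p + 1) → Bool}, InSector w η → InSector w η' →
      (∀ z ∈ box 2 L, InDroplet k η z ↔ InDroplet k η' z) →
      ∀ q j, j ≤ p + 1 → height (η' q) j ≤ height (η q) j := by
    intro η η' hη hη' h q j hj
    by_contra hn
    push Not at hn
    have h1 := total_le_height (η q) hj
    rw [hη] at h1
    have h2 := height_le (η' q) j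
    have h3 := height_le_total (η' q) j
    rw [hη'] at h3
    obtain ⟨a, ha⟩ : ∃ a, height (η' q) j = a + 1 := ⟨height (η' q) j - 1, by omega⟩
    -- The cell `(a, b)` on diagonal `j` is the last one under the farther path, and so is not under
    -- the other one.
    obtain ⟨b, hb⟩ : ∃ b, a + k = b + j := ⟨a + k - j, by omega⟩
    set z : Fin 2 → ℤ := ![unfoldCoord q.1 a, unfoldCoord q.2 b] with hz
    have z0 : fold (z 0) = a := by simp [hz, fold_unfoldCoord]
    have z1 : fold (z 1) = b := by simp [hz, fold_unfoldCoord]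
    have hq : quad z = q := quad_unfoldCoord q a b
    have := h z (fold_mem_box (by omega) (by omega))
    unfold InDroplet at this
    rw [z0, z1, hq, show a + k - b = j by omega] at this
    omega
  funext q
  exact height_injective fun j hj =>
    le_antisymm (aux hη' hη (fun z hz => (h z hz).symm) q j hj) (aux hη hη' h q j hj)

end Droplet

/-- The axis sites of a supported droplet determine `w` and `k`, so droplets built from different
values of `p` never coincide. -/
theorem droplet_size_eq {p p' w w' k k' L : ℕ} {η : Bool × Bool → Fin (p + 1) → Bool}
    {η' : Bool × Bool → Fin (p' + 1) → Bool} (hwk : w + k = p + 1) (hwk' : w' + k' = p' + 1)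
    (hη : InSector w η) (hη' : InSector w' η') (hs : IsSupported w η) (hs' : IsSupported w' η')
    (hL : p + 1 ≤ L) (hL' : p' + 1 ≤ L)
    (h : ∀ z ∈ box 2 L, InDroplet k η z ↔ InDroplet k' η' z) : p = p' := by
  have hw : ∀ a, a < L → (a < w ↔ a < w') := by
    intro a ha
    have z0 : fold ((![(a : ℤ), 0] : Fin 2 → ℤ) 0) = a := by simp [fold]
    have z1 : fold ((![(a : ℤ), 0] : Fin 2 → ℤ) 1) = 0 := by simp [fold]
    have := h ![(a : ℤ), 0] (fold_mem_box (by omega) (by omega))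
    rwa [mem_axis hwk hη hs z1, mem_axis hwk' hη' hs' z1, z0] at this
  have hk : ∀ a, a < L → (a < k ↔ a < k') := by
    intro a ha
    have z0 : fold ((![0, (a : ℤ)] : Fin 2 → ℤ) 0) = 0 := by simp [fold]
    have z1 : fold ((![0, (a : ℤ)] : Fin 2 → ℤ) 1) = a := by simp [fold]
    have := h ![0, (a : ℤ)] (fold_mem_box (by omega) (by omega))
    rwa [mem_axis' hwk hη hs z0, mem_axis' hwk' hη' hs' z0, z1] at this
  have e1 : w = w' := by
    rcases lt_trichotomy w w' with h1 | h1 | h1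
    · have := hw w (by omega); omega
    · exact h1
    · have := hw w' (by omega); omega
  have e2 : k = k' := by
    rcases lt_trichotomy k k' with h1 | h1 | h1
    · have := hk k (by omega); omega
    · exact h1
    · have := hk k' (by omega); omega
  omega

end IsingGlauber

/-! ### Disjointly supported test functions, and droplets as configurations. -/

namespace IsingGlauber
open Finset

variable {Λ : Finset (Fin 2 → ℤ)}

/-- Every edge with nonzero gradient has an endpoint in the support, and the factor `1/2`
compensates for edges appearing in both orientations. Only configurations in the support then have
to be examined. -/
theorem dirichlet_le (β : ℝ) (f : Config Λ → ℝ) :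
    1 / 2 * ∑ x : Λ, ∑ σ, gw β σ * flipRate β x σ * (f (flip x σ) - f σ) ^ 2 ≤
      ∑ σ, if f σ ≠ 0 then ∑ x : Λ, gw β σ * flipRate β x σ * (f (flip x σ) - f σ) ^ 2 else 0 := by
  have h : ∀ x : Λ, ∑ σ, gw β σ * flipRate β x σ * (f (flip x σ) - f σ) ^ 2 ≤
      2 * ∑ σ, if f σ ≠ 0 then gw β σ * flipRate β x σ * (f (flip x σ) - f σ) ^ 2 else 0 := by
    intro x
    set t : Config Λ → ℝ := fun σ => gw β σ * flipRate β x σ * (f (flip x σ) - f σ) ^ 2 with ht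
    have hsym : ∀ σ, t (flip x σ) = t σ := by
      intro σ
      simp only [ht, flip_flip, detailed_balance β x σ]
      ring
    have h1 : ∑ σ, (if f (flip x σ) ≠ 0 then t σ else 0) = ∑ σ, if f σ ≠ 0 then t σ else 0 := by
      rw [← sum_flip x fun σ => if f σ ≠ 0 then t σ else 0]
      simp only [hsym]
    rw [two_mul]
    nth_rewrite 1 [← h1]
    rw [← sum_add_distrib]
    refine sum_le_sum fun σ _ => ?_
    have h0 : 0 ≤ t σ :=
      mul_nonneg (mul_nonneg (gw_pos β σ).le (flipRate_pos β x σ).le) (sq_nonneg _)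
    by_cases h2 : f σ = 0 <;> by_cases h3 : f (flip x σ) = 0
    · simp [h2, h3]
    · rw [if_pos h3]
      have : 0 ≤ if f σ ≠ 0 then t σ else 0 := by split_ifs <;> simp [h0]
      linarith
    · rw [if_pos h2]
      have : 0 ≤ if f (flip x σ) ≠ 0 then t σ else 0 := by split_ifs <;> simp [h0]
      linarith
    · rw [if_pos h2, if_pos h3]
      linarith
  have h2 := sum_le_sum fun x (_ : x ∈ (univ : Finset Λ)) => h x
  rw [← mul_sum] at h2
  have h3 : ∀ σ : Config Λ, (∑ x : Λ, if f σ ≠ 0 then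
      gw β σ * flipRate β x σ * (f (flip x σ) - f σ) ^ 2 else 0) =
      if f σ ≠ 0 then ∑ x : Λ, gw β σ * flipRate β x σ * (f (flip x σ) - f σ) ^ 2 else 0 := by
    intro σ; split_ifs <;> simp
  rw [← sum_congr rfl fun σ _ => h3 σ]
  rw [sum_comm (s := (univ : Finset (Config Λ)))]
  linarith

/-- Two disjointly supported functions with small Rayleigh quotient bound the gap above. -/
theorem spectralGap_le_of_two {β K : ℝ} {f g : Config Λ → ℝ} (hfg : ∀ σ, f σ * g σ = 0)
    (hf0 : 0 < ∑ σ, gw β σ * f σ ^ 2) (hg0 : 0 < ∑ σ, gw β σ * g σ ^ 2)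
    (hf : (∑ σ, if f σ ≠ 0 then ∑ x : Λ, gw β σ * flipRate β x σ * (f (flip x σ) - f σ) ^ 2 else 0) ≤
      K * ∑ σ, gw β σ * f σ ^ 2)
    (hg : (∑ σ, if g σ ≠ 0 then ∑ x : Λ, gw β σ * flipRate β x σ * (g (flip x σ) - g σ) ^ 2 else 0) ≤
      K * ∑ σ, gw β σ * g σ ^ 2) :
    spectralGap β Λ (plusBoundary Λ) ≤ 2 * K := by
  -- The combination is chosen with mean zero, so its variance is its full second moment.
  obtain ⟨a, b, hab, hmean⟩ : ∃ a b : ℝ, (a ≠ 0 ∨ b ≠ 0) ∧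
      a * (∑ σ, gw β σ * f σ) + b * ∑ σ, gw β σ * g σ = 0 := by
    by_cases h : ∑ σ, gw β σ * f σ = 0
    · exact ⟨1, 0, Or.inl one_ne_zero, by rw [h]; ring⟩
    · exact ⟨-∑ σ, gw β σ * g σ, ∑ σ, gw β σ * f σ, Or.inr h, by ring⟩
  set F : Config Λ → ℝ := fun σ => a * f σ + b * g σ with hF
  have hFmean : ∑ σ, gw β σ * F σ = 0 := by
    rw [← hmean, mul_sum, mul_sum, ← sum_add_distrib]
    exact sum_congr rfl fun σ _ => by simp only [hF]; ring
  have hF2 : ∑ σ, gw β σ * F σ ^ 2 = a ^ 2 * ∑ σ, gw β σ * f σ ^ 2 + b ^ 2 * ∑ σ, gw β σ * g σ ^ 2 := by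
    rw [mul_sum, mul_sum, ← sum_add_distrib]
    refine sum_congr rfl fun σ _ => ?_
    have e : gw β σ * F σ ^ 2 = a ^ 2 * (gw β σ * f σ ^ 2) + b ^ 2 * (gw β σ * g σ ^ 2) +
      2 * a * b * gw β σ * (f σ * g σ) := by simp only [hF]; ring
    rw [e, hfg]; ring
  have hpos : 0 < ∑ σ, gw β σ * F σ ^ 2 := by
    rw [hF2]
    rcases hab with h | h
    · have := mul_pos (by positivity : 0 < a ^ 2) hf0
      have := mul_nonneg (sq_nonneg b) hg0.le
      linarith
    · have := mul_pos (by positivity : 0 < b ^ 2) hg0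
      have := mul_nonneg (sq_nonneg a) hf0.le
      linarith
  have hexp : expect β Λ (plusBoundary Λ) F = 0 := hFmean
  refine spectralGap_le β F _ ?_ ?_
  · rintro ⟨s, hs⟩
    rw [sum_congr rfl fun σ _ => by rw [hs σ], ← sum_mul, sum_gw, one_mul] at hFmean
    rw [sum_congr rfl fun σ _ => by rw [hs σ, hFmean]] at hpos
    simp at hpos
  · rw [variance_eq β F 0, hexp]
    simp only [sub_zero]
    rw [hF2]
    have h1 := (dirichlet_le β f).trans hf
    have h2 := (dirichlet_le β g).trans hg
    -- Disjoint supports remove the cross term from the norm but not from the Dirichlet form; `(u +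
    -- v) ^ 2 ≤ 2 u ^ 2 + 2 v ^ 2` accounts for the factor `2` in the conclusion.
    have h3 : ∑ x : Λ, ∑ σ, gw β σ * flipRate β x σ * (F (flip x σ) - F σ) ^ 2 ≤
        2 * a ^ 2 * (∑ x : Λ, ∑ σ, gw β σ * flipRate β x σ * (f (flip x σ) - f σ) ^ 2) +
        2 * b ^ 2 * (∑ x : Λ, ∑ σ, gw β σ * flipRate β x σ * (g (flip x σ) - g σ) ^ 2) := by
      simp only [mul_sum, ← sum_add_distrib]
      refine sum_le_sum fun x _ => sum_le_sum fun σ _ => ?_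
      have hc : 0 ≤ gw β σ * flipRate β x σ := mul_nonneg (gw_pos β σ).le (flipRate_pos β x σ).le
      have h4 : (F (flip x σ) - F σ) ^ 2 ≤ 2 * (a * (f (flip x σ) - f σ)) ^ 2 +
          2 * (b * (g (flip x σ) - g σ)) ^ 2 := by
        have e : F (flip x σ) - F σ = a * (f (flip x σ) - f σ) + b * (g (flip x σ) - g σ) := by
          simp only [hF]; ring
        rw [e]
        linarith [sq_nonneg (a * (f (flip x σ) - f σ) - b * (g (flip x σ) - g σ))]
      refine (mul_le_mul_of_nonneg_left h4 hc).trans (le_of_eq ?_)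
      ring
    have h5 := mul_le_mul_of_nonneg_left h1 (by positivity : 0 ≤ 2 * a ^ 2)
    have h6 := mul_le_mul_of_nonneg_left h2 (by positivity : 0 ≤ 2 * b ^ 2)
    linarith

/-- A bound on the gap valid for all parameters. -/
theorem spectralGap_le_two (β : ℝ) (hΛ : Λ.Nonempty) :
    spectralGap β Λ (plusBoundary Λ) ≤ 2 := by
  obtain ⟨z, hz⟩ := hΛ
  set o : Λ := ⟨z, hz⟩ with ho
  have aux : ∀ s : ℤˣ, ∀ f : Config Λ → ℝ, (f = fun σ => if σ o = s then 1 else 0) →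
      0 < ∑ σ, gw β σ * f σ ^ 2 ∧
      (∑ σ, if f σ ≠ 0 then ∑ x : Λ, gw β σ * flipRate β x σ * (f (flip x σ) - f σ) ^ 2 else 0) ≤
        1 * ∑ σ, gw β σ * f σ ^ 2 := by
    intro s f hf
    constructor
    · refine sum_pos' (s := univ) (f := fun σ => gw β σ * f σ ^ 2)
        (fun σ _ => mul_nonneg (gw_pos β σ).le (sq_nonneg _)) ⟨fun _ => s, mem_univ _, ?_⟩
      have := gw_pos β (fun _ : Λ => s)
      simpa [hf] using this
    · rw [one_mul]
      refine sum_le_sum fun σ _ => ?_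
      have hg := gw_pos β σ
      by_cases h : σ o = s
      · have h1 : f σ = 1 := by simp [hf, h]
        rw [if_pos (by rw [h1]; exact one_ne_zero), h1, sum_eq_single o]
        · have h2 : f (flip o σ) = 0 := by
            have hne : -s ≠ s := by rcases Int.units_eq_one_or s with rfl | rfl <;> decide
            simp [hf, h, hne]
          rw [h2]
          have h3 : flipRate β o σ ≤ 1 := by
            unfold flipRate
            rw [div_le_one (by positivity)]
            linarith [Real.exp_pos (β * barrier o σ)]
          nlinarith
        · intro x _ hx
          have h2 : f (flip x σ) = 1 := by
            simp [hf, flip_of_ne hx.symm, h]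
          rw [h2]; ring
        · intro h2; exact absurd (mem_univ o) h2
      · have h1 : f σ = 0 := by simp [hf, h]
        simp [h1]
  have h1 := aux 1 _ rfl
  have h2 := aux (-1) _ rfl
  have := spectralGap_le_of_two (fun σ => ?_) h1.1 h2.1 h1.2 h2.2
  · linarith
  · rcases Int.units_eq_one_or (σ o) with h | h <;> rw [h] <;> simp

section TestFunction

variable {p w k L : ℕ}

/-- The droplet as a spin configuration. -/
def dropletConfig (L k : ℕ) (η : Bool × Bool → Fin (p + 1) → Bool) : Config (box 2 L) :=
  fun x => if InDroplet k η x.1 then -1 else 1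

theorem dropletConfig_eq_neg_iff {η : Bool × Bool → Fin (p + 1) → Bool} {x : box 2 L} :
    dropletConfig L k η x = -1 ↔ InDroplet k η x.1 := by
  unfold dropletConfig
  split_ifs with h
  · simp [h]
  · simp only [h, iff_false]; decide

theorem mem_minusSet_dropletConfig {η : Bool × Bool → Fin (p + 1) → Bool} (hwk : w + k = p + 1)
    (hη : InSector w η) (hL : p + 1 ≤ L) {z : Fin 2 → ℤ} :
    z ∈ minusSet (dropletConfig L k η) ↔ InDroplet k η z := by
  rw [mem_minusSet]
  constructor
  · rintro ⟨hz, h⟩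
    exact dropletConfig_eq_neg_iff.1 h
  · intro h
    have := fold_lt_of_inDroplet hwk hη h
    exact ⟨fold_mem_box (by omega) (by omega), dropletConfig_eq_neg_iff.2 h⟩

/-- Exchange of two steps in one of the four paths. -/
def swapIn (q : Bool × Bool) (i : Fin p) (η : Bool × Bool → Fin (p + 1) → Bool) :
    Bool × Bool → Fin (p + 1) → Bool := Function.update η q (swapSteps i (η q))

/-- Both inner neighbours of a droplet site are in the droplet, and both outer neighbours of an
outside site are outside. Hence no flip of a supported droplet lowers the energy, and the neutral
flips occur exactly at path corners. -/
theorem nbrCount_droplet {η : Bool × Bool → Fin (p + 1) → Bool} (hwk : w + k = p + 1)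
    (hη : InSector w η) (hs : IsSupported w η) (hL : p + 1 ≤ L) (x : box 2 L) :
    (InDroplet k η x.1 → 2 ≤ nbrCount (minusSet (dropletConfig L k η)) x.1) ∧
    (¬ InDroplet k η x.1 → nbrCount (minusSet (dropletConfig L k η)) x.1 ≤ 2) ∧
    (nbrCount (minusSet (dropletConfig L k η)) x.1 = 2 →
      ∃ q i, flip x (dropletConfig L k η) = dropletConfig L k (swapIn q i η)) := by
  have hm := fun {z : Fin 2 → ℤ} => mem_minusSet_dropletConfig (z := z) hwk hη hL
  rw [nbrCount_eq_four]
  simp only [hm]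
  have conclude : ∀ i : Fin p, fold (x.1 0) + k = fold (x.1 1) + (i + 1) →
      ((height (η (quad x.1)) (i + 1) = fold (x.1 0) + 1 ∧
        height (swapSteps i (η (quad x.1))) (i + 1) = fold (x.1 0)) ∨
      (height (η (quad x.1)) (i + 1) = fold (x.1 0) ∧
        height (swapSteps i (η (quad x.1))) (i + 1) = fold (x.1 0) + 1)) →
      ∃ q i, flip x (dropletConfig L k η) = dropletConfig L k (swapIn q i η) := by
    intro i hi h
    refine ⟨quad x.1, i, ?_⟩
    funext y
    have hD := inDroplet_swap hi h y.1
    by_cases hyx : y = x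
    · subst hyx
      rw [if_pos rfl] at hD
      rw [flip_self]
      unfold dropletConfig swapIn
      by_cases h1 : InDroplet k η y.1 <;> simp [h1, hD]
    · rw [if_neg fun h => hyx (Subtype.ext h)] at hD
      rw [flip_of_ne hyx]
      unfold dropletConfig swapIn
      by_cases h1 : InDroplet k η y.1 <;> simp [h1, hD]
  by_cases hx : InDroplet k η x.1
  · have hin := inner_mem hwk hη hs hx
    rw [if_pos hin.1, if_pos hin.2]
    refine ⟨fun _ => by omega, fun h => absurd hx h, fun h => ?_⟩
    have h0 : ¬ InDroplet k η ![outer (x.1 0), x.1 1] := by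
      intro h1; rw [if_pos h1] at h; omega
    have h1 : ¬ InDroplet k η ![x.1 0, outer (x.1 1)] := by
      intro h1; rw [if_pos h1] at h; omega
    obtain ⟨i, hi, e0, e1, e2⟩ := height_of_removable hwk hη hs hx h0 h1
    have := height_swapSteps_self (η (quad x.1)) i
    exact conclude i hi (Or.inl ⟨e1, by omega⟩)
  · have hout := outer_notMem hx
    rw [if_neg hout.1, if_neg hout.2]
    refine ⟨fun h => absurd h hx, fun _ => by split_ifs <;> omega, fun h => ?_⟩
    have h0 : InDroplet k η ![inner (x.1 0), x.1 1] := by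
      by_contra h1; rw [if_neg h1] at h; split_ifs at h <;> omega
    have h1 : InDroplet k η ![x.1 0, inner (x.1 1)] := by
      by_contra h1; rw [if_neg h1] at h; split_ifs at h <;> omega
    obtain ⟨i, hi, e0, e1, e2⟩ := height_of_addable hwk hη hs hx h0 h1
    have := height_swapSteps_self (η (quad x.1)) i
    exact conclude i hi (Or.inr ⟨e1, by omega⟩)

/-- The quadruples of paths with `w` horizontal steps each. -/
def quadSector (p w : ℕ) : Finset (Bool × Bool → Fin (p + 1) → Bool) :=
  Fintype.piFinset fun _ => sector p w

theorem mem_quadSector {η : Bool × Bool → Fin (p + 1) → Bool} :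
    η ∈ quadSector p w ↔ InSector w η := by
  simp [quadSector, Fintype.mem_piFinset, sector, InSector]

/-- The amplitude of a quadruple of paths. -/
noncomputable def amplitude (η : Bool × Bool → Fin (p + 1) → Bool) : ℝ := ∏ q, pathWeight (η q)

theorem isSupported_of_amplitude (hp : 1 ≤ p) {η : Bool × Bool → Fin (p + 1) → Bool}
    (hη : InSector w η) (h : amplitude η ≠ 0) : IsSupported w η := by
  intro q
  have h1 := support_of_pathWeight_ne_zero hp (prod_ne_zero_iff.1 h q (mem_univ q))
  exact ⟨h1.1, h1.2.trans (hη q)⟩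

theorem swapIn_mem {q : Bool × Bool} {i : Fin p} {η : Bool × Bool → Fin (p + 1) → Bool}
    (hη : InSector w η) : InSector w (swapIn q i η) := by
  intro r
  unfold swapIn
  by_cases h : r = q
  · subst h
    rw [Function.update_self, height_swapSteps_of_ne _ _ (by omega)]
    exact hη r
  · rw [Function.update_of_ne h]; exact hη r

theorem sum_amplitude_sq (p w : ℕ) :
    ∑ η ∈ quadSector p w, amplitude η ^ 2 = (∑ ζ ∈ sector p w, pathWeight ζ ^ 2) ^ 4 := by
  have h := Finset.prod_univ_sum (fun _ : Bool × Bool => sector p w)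
    (fun _ ζ => pathWeight ζ ^ 2)
  rw [prod_const, card_univ] at h
  simp only [amplitude, ← prod_pow]
  exact h.symm

theorem sum_swapIn_sq (p w : ℕ) (q : Bool × Bool) (i : Fin p) :
    ∑ η ∈ quadSector p w, (amplitude (swapIn q i η) - amplitude η) ^ 2 =
      (∑ ζ ∈ sector p w, (pathWeight (swapSteps i ζ) - pathWeight ζ) ^ 2) *
        (∑ ζ ∈ sector p w, pathWeight ζ ^ 2) ^ 3 := by
  have h := Finset.prod_univ_sum (fun _ : Bool × Bool => sector p w)
    (fun r ζ => if r = q then (pathWeight (swapSteps i ζ) - pathWeight ζ) ^ 2 else pathWeight ζ ^ 2)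
  have hL : ∀ η : Bool × Bool → Fin (p + 1) → Bool,
      (amplitude (swapIn q i η) - amplitude η) ^ 2 = ∏ r, if r = q then
        (pathWeight (swapSteps i (η r)) - pathWeight (η r)) ^ 2 else pathWeight (η r) ^ 2 := by
    intro η
    unfold amplitude
    rw [← mul_prod_erase univ (fun r => pathWeight (η r)) (mem_univ q),
      ← mul_prod_erase univ (fun r => pathWeight (swapIn q i η r)) (mem_univ q),
      ← mul_prod_erase univ (fun r => if r = q then
        (pathWeight (swapSteps i (η r)) - pathWeight (η r)) ^ 2 else pathWeight (η r) ^ 2)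
        (mem_univ q)]
    have e1 : ∏ r ∈ univ.erase q, pathWeight (swapIn q i η r) =
        ∏ r ∈ univ.erase q, pathWeight (η r) := by
      refine prod_congr rfl fun r hr => ?_
      rw [swapIn, Function.update_of_ne (ne_of_mem_erase hr)]
    have e2 : (∏ r ∈ univ.erase q, if r = q then
        (pathWeight (swapSteps i (η r)) - pathWeight (η r)) ^ 2 else pathWeight (η r) ^ 2) =
        (∏ r ∈ univ.erase q, pathWeight (η r)) ^ 2 := by
      rw [← prod_pow]
      exact prod_congr rfl fun r hr => if_neg (ne_of_mem_erase hr)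
    rw [e1, e2, if_pos rfl, swapIn, Function.update_self, ← sub_mul, mul_pow]
  rw [sum_congr rfl fun η _ => hL η]
  unfold quadSector
  rw [← h, ← mul_prod_erase univ _ (mem_univ q)]
  simp only [if_true]
  congr 1
  rw [prod_congr rfl fun r hr => by rw [sum_congr rfl fun ζ _ => if_neg (ne_of_mem_erase hr)],
    prod_const, card_erase_of_mem (mem_univ q), card_univ]
  rfl

/-- The test function, up to the square root of the Gibbs weight. -/
noncomputable def profile (L k p w : ℕ) (σ : Config (box 2 L)) : ℝ :=
  ∑ η ∈ quadSector p w, if dropletConfig L k η = σ then amplitude η else 0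

theorem dropletConfig_injOn (hwk : w + k = p + 1) (hL : p + 1 ≤ L) :
    Set.InjOn (dropletConfig (p := p) L k) (quadSector p w) := by
  intro η hη η' hη' h
  refine droplet_injective hwk (mem_quadSector.1 hη) (mem_quadSector.1 hη') hL fun z hz => ?_
  rw [← dropletConfig_eq_neg_iff (L := L) (x := ⟨z, hz⟩), h, dropletConfig_eq_neg_iff]

theorem profile_dropletConfig (hwk : w + k = p + 1) (hL : p + 1 ≤ L)
    {η : Bool × Bool → Fin (p + 1) → Bool} (hη : InSector w η) :
    profile L k p w (dropletConfig L k η) = amplitude η := by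
  unfold profile
  rw [sum_eq_single η]
  · rw [if_pos rfl]
  · intro η' hη' hne
    exact if_neg fun h => hne (dropletConfig_injOn hwk hL hη' (mem_quadSector.2 hη) h)
  · intro h; exact absurd (mem_quadSector.2 hη) h

theorem exists_of_profile_ne_zero {σ : Config (box 2 L)}
    (h : profile L k p w σ ≠ 0) :
    ∃ η : Bool × Bool → Fin (p + 1) → Bool,
      InSector w η ∧ amplitude η ≠ 0 ∧ dropletConfig L k η = σ := by
  obtain ⟨η, hη, hne⟩ := exists_ne_zero_of_sum_ne_zero h
  by_cases h1 : dropletConfig L k η = σ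
  · rw [if_pos h1] at hne
    exact ⟨η, mem_quadSector.1 hη, hne, h1⟩
  · exact absurd (if_neg h1) hne

theorem sum_over_profile (hwk : w + k = p + 1) (hL : p + 1 ≤ L)
    (G : Config (box 2 L) → ℝ) (hG : ∀ σ, profile L k p w σ = 0 → G σ = 0) :
    ∑ σ, G σ = ∑ η ∈ quadSector p w, G (dropletConfig L k η) := by
  rw [← sum_image (f := G) (dropletConfig_injOn hwk hL)]
  refine (sum_subset (subset_univ _) fun σ _ hσ => hG σ ?_).symm
  by_contra hne
  obtain ⟨η, hη, -, rfl⟩ := exists_of_profile_ne_zero hne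
  exact hσ (mem_image_of_mem _ (mem_quadSector.2 hη))

end TestFunction

end IsingGlauber

/-! ### Rayleigh quotients of the droplet functions and the upper bound. -/

namespace IsingGlauber
open Finset

variable {p w k L : ℕ}

theorem not_nbr_self (x : Fin 2 → ℤ) : ¬ Nbr x x := by
  rw [nbr_iff]; omega

theorem nbrCount_flip {Λ : Finset (Fin 2 → ℤ)} (x : Λ) (σ : Config Λ) :
    nbrCount (minusSet (flip x σ)) x.1 = nbrCount (minusSet σ) x.1 := by
  unfold nbrCount
  rcases Int.units_eq_one_or (σ x) with h | h
  · rw [minusSet_flip_of_one h, filter_insert, if_neg (not_nbr_self _)]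
  · rw [minusSet_flip_of_neg h, filter_erase, erase_eq_of_notMem]
    rw [mem_filter]
    exact fun h => not_nbr_self _ h.2

theorem flipRate_le_of_neg {Λ : Finset (Fin 2 → ℤ)} {β : ℝ} (hβ : 0 ≤ β) {x : Λ}
    {σ : Config Λ} (h : σ x = -1) (hm : 3 ≤ nbrCount (minusSet σ) x.1) :
    flipRate β x σ ≤ Real.exp (-(4 * β)) := by
  unfold flipRate
  rw [barrier_of_neg h, Real.exp_neg, one_div]
  have hm' : (3 : ℝ) ≤ nbrCount (minusSet σ) x.1 := by exact_mod_cast hm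
  refine inv_anti₀ (Real.exp_pos _) ?_
  have : Real.exp (4 * β) ≤ Real.exp (β * -(2 * (4 - 2 * (nbrCount (minusSet σ) x.1 : ℝ)))) :=
    Real.exp_le_exp.2 (by nlinarith)
  linarith

theorem barrier_of_two {Λ : Finset (Fin 2 → ℤ)} {x : Λ} {σ : Config Λ}
    (hm : nbrCount (minusSet σ) x.1 = 2) : barrier x σ = 0 := by
  unfold barrier
  rw [hm]; norm_num

/-- The test function built from the profile. -/
noncomputable def testFun (β : ℝ) (L k p w : ℕ) (σ : Config (box 2 L)) : ℝ :=
  profile L k p w σ / Real.sqrt (gw β σ)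

/-- Dividing by the square root of the Gibbs weight turns the weighted norm into that of the
amplitudes; neutral flips preserve the weight, so their gradients transform in the same way. -/
theorem gw_mul_testFun_sq (β : ℝ) (σ : Config (box 2 L)) :
    gw β σ * testFun β L k p w σ ^ 2 = profile L k p w σ ^ 2 := by
  have := gw_pos β σ
  rw [testFun, div_pow, Real.sq_sqrt this.le]
  field_simp

theorem testFun_eq_zero_iff (β : ℝ) (σ : Config (box 2 L)) :
    testFun β L k p w σ = 0 ↔ profile L k p w σ = 0 := by
  have := (Real.sqrt_pos.2 (gw_pos β σ)).ne'
  simp [testFun, this]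

theorem sum_gw_testFun_sq (hwk : w + k = p + 1) (hL : p + 1 ≤ L) (β : ℝ) :
    ∑ σ, gw β σ * testFun β L k p w σ ^ 2 = (∑ ζ ∈ sector p w, pathWeight ζ ^ 2) ^ 4 := by
  rw [← sum_amplitude_sq, sum_congr rfl fun σ _ => gw_mul_testFun_sq β σ,
    sum_over_profile hwk hL _ fun σ h => by rw [h]; ring]
  exact sum_congr rfl fun η hη => by rw [profile_dropletConfig hwk hL (mem_quadSector.1 hη)]

/-- Distinct neutral sites give distinct flipped configurations and therefore use distinct exchanges
`(q, i)`. -/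
theorem sum_flip_neutral_le (hp : 1 ≤ p) (hwk : w + k = p + 1) (hL : p + 1 ≤ L)
    {η : Bool × Bool → Fin (p + 1) → Bool} (hη : InSector w η) (hs : IsSupported w η) :
    ∑ x : box 2 L with nbrCount (minusSet (dropletConfig L k η)) x.1 = 2,
        (profile L k p w (flip x (dropletConfig L k η)) - amplitude η) ^ 2 ≤
      ∑ q : Bool × Bool, ∑ i : Fin p, (amplitude (swapIn q i η) - amplitude η) ^ 2 := by
  have hex : ∀ x : box 2 L, nbrCount (minusSet (dropletConfig L k η)) x.1 = 2 →
      ∃ t : (Bool × Bool) × Fin p,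
        flip x (dropletConfig L k η) = dropletConfig L k (swapIn t.1 t.2 η) := by
    intro x hx
    obtain ⟨q, i, h⟩ := (nbrCount_droplet hwk hη hs hL x).2.2 hx
    exact ⟨(q, i), h⟩
  have : Nonempty (Fin p) := ⟨⟨0, hp⟩⟩
  choose! t ht using hex
  rw [← sum_product']
  have hinj : Set.InjOn t ((univ.filter fun x : box 2 L =>
      nbrCount (minusSet (dropletConfig L k η)) x.1 = 2 : Finset (box 2 L)) : Set (box 2 L)) := by
    intro x hx y hy hxy
    rw [mem_coe, mem_filter] at hx hy
    have h : flip x (dropletConfig L k η) = flip y (dropletConfig L k η) := by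
      rw [ht x hx.2, ht y hy.2, hxy]
    by_contra hne
    have h1 := congrFun h x
    rw [flip_self, flip_of_ne hne] at h1
    exact ne_flip x (dropletConfig L k η) (by
      funext z
      by_cases hz : z = x
      · rw [hz, flip_self, h1]
      · rw [flip_of_ne hz])
  have h1 : ∀ x ∈ (univ.filter fun x : box 2 L =>
      nbrCount (minusSet (dropletConfig L k η)) x.1 = 2),
      (profile L k p w (flip x (dropletConfig L k η)) - amplitude η) ^ 2 =
        (amplitude (swapIn (t x).1 (t x).2 η) - amplitude η) ^ 2 := by
    intro x hx
    rw [mem_filter] at hx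
    rw [ht x hx.2, profile_dropletConfig hwk hL (swapIn_mem hη)]
  rw [sum_congr rfl h1, ← sum_image
    (f := fun s : (Bool × Bool) × Fin p => (amplitude (swapIn s.1 s.2 η) - amplitude η) ^ 2) hinj]
  exact sum_le_sum_of_subset_of_nonneg (fun s _ => by simp) fun _ _ _ => sq_nonneg _

theorem local_dirichlet_le (hp : 1 ≤ p) (hwk : w + k = p + 1) (hL : p + 1 ≤ L) {β : ℝ}
    (hβ : 0 ≤ β) {η : Bool × Bool → Fin (p + 1) → Bool} (hη : InSector w η)
    (ha : amplitude η ≠ 0) :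
    ∑ x : box 2 L, gw β (dropletConfig L k η) * flipRate β x (dropletConfig L k η) *
        (testFun β L k p w (flip x (dropletConfig L k η)) -
          testFun β L k p w (dropletConfig L k η)) ^ 2 ≤
      1 / 2 * ∑ q : Bool × Bool, ∑ i : Fin p, (amplitude (swapIn q i η) - amplitude η) ^ 2 +
        Real.exp (-(4 * β)) * (side L : ℝ) ^ 2 * amplitude η ^ 2 := by
  have hs := isSupported_of_amplitude hp hη ha
  have hneutral := sum_flip_neutral_le hp hwk hL hη hs
  set σ := dropletConfig L k η with hσ
  have hprof : profile L k p w σ = amplitude η := profile_dropletConfig hwk hL hη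
  have key : ∀ x : box 2 L, gw β σ * flipRate β x σ *
      (testFun β L k p w (flip x σ) - testFun β L k p w σ) ^ 2 ≤
      (if nbrCount (minusSet σ) x.1 = 2 then
        1 / 2 * (profile L k p w (flip x σ) - amplitude η) ^ 2 else 0) +
        Real.exp (-(4 * β)) * amplitude η ^ 2 := by
    intro x
    have hx := nbrCount_droplet hwk hη hs hL x
    rw [← hσ] at hx
    have hg := gw_pos β σ
    have he : 0 ≤ Real.exp (-(4 * β)) * amplitude η ^ 2 := by positivity
    by_cases h2 : nbrCount (minusSet σ) x.1 = 2
    · have hgf : gw β (flip x σ) = gw β σ := by rw [gw_flip, barrier_of_two h2]; simp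
      rw [if_pos h2, flipRate_of_two h2, testFun, testFun, hgf, hprof, ← sub_div, div_pow,
        Real.sq_sqrt hg.le]
      have : gw β σ * (1 / 2) * ((profile L k p w (flip x σ) - amplitude η) ^ 2 / gw β σ) =
          1 / 2 * (profile L k p w (flip x σ) - amplitude η) ^ 2 := by field_simp
      rw [this]; linarith
    · have hrate : flipRate β x σ ≤ Real.exp (-(4 * β)) := by
        by_cases h3 : InDroplet k η x.1
        · have := hx.1 h3
          exact flipRate_le_of_neg hβ (dropletConfig_eq_neg_iff.2 h3) (by omega)
        · have := hx.2.1 h3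
          refine flipRate_le_of_one hβ ?_ (by omega)
          simp [hσ, dropletConfig, h3]
      -- The neighbour count at `x` is unaffected by its own flip. If both configurations were
      -- supported droplets, it would be at least two from one and at most two from the other,
      -- making the flip neutral.
      have h0 : testFun β L k p w (flip x σ) = 0 := by
        rw [testFun_eq_zero_iff]
        by_contra hne
        obtain ⟨η', hη', ha', hd⟩ := exists_of_profile_ne_zero hne
        have hx' := nbrCount_droplet hwk hη' (isSupported_of_amplitude hp hη' ha') hL x
        rw [hd, nbrCount_flip] at hx'
        have hiff : InDroplet k η' x.1 ↔ ¬ InDroplet k η x.1 := by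
          rw [← dropletConfig_eq_neg_iff (L := L), hd, flip_self,
            ← dropletConfig_eq_neg_iff (L := L) (η := η), ← hσ]
          rcases Int.units_eq_one_or (σ x) with h | h <;> rw [h] <;> decide
        by_cases h3 : InDroplet k η x.1
        · have := hx.1 h3
          have := hx'.2.1 (fun h => hiff.1 h h3)
          omega
        · have := hx.2.1 h3
          have := hx'.1 (hiff.2 h3)
          omega
      rw [if_neg h2, h0, zero_add, zero_sub, neg_sq]
      have e : gw β σ * flipRate β x σ * testFun β L k p w σ ^ 2 =
          flipRate β x σ * (gw β σ * testFun β L k p w σ ^ 2) := by ring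
      rw [e, gw_mul_testFun_sq, hprof]
      exact mul_le_mul_of_nonneg_right hrate (sq_nonneg _)
  refine (sum_le_sum fun x _ => key x).trans ?_
  rw [sum_add_distrib, sum_const, card_univ, Fintype.card_coe, card_box, ← sum_filter, ← mul_sum,
    nsmul_eq_mul, Nat.cast_pow]
  linarith

/-- Four independent paths, each with quotient at most `δ` and exchanges at rate `1/2`, give `2 *
δ`; the other term bounds the escape from the support. -/
theorem testFun_rayleigh (hp : 1 ≤ p) (hwk : w + k = p + 1) (hL : p + 1 ≤ L) {β δ : ℝ}
    (hβ : 0 ≤ β)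
    (hδ : ∑ ζ ∈ sector p w, ∑ i : Fin p, (pathWeight (swapSteps i ζ) - pathWeight ζ) ^ 2 ≤
      δ * ∑ ζ ∈ sector p w, pathWeight ζ ^ 2) :
    (∑ σ, if testFun β L k p w σ ≠ 0 then ∑ x : box 2 L, gw β σ * flipRate β x σ *
        (testFun β L k p w (flip x σ) - testFun β L k p w σ) ^ 2 else 0) ≤
      (2 * δ + Real.exp (-(4 * β)) * (side L : ℝ) ^ 2) *
        ∑ σ, gw β σ * testFun β L k p w σ ^ 2 := by
  rw [sum_over_profile hwk hL _ fun σ h => if_neg (not_not.2 ((testFun_eq_zero_iff β σ).2 h)),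
    sum_gw_testFun_sq hwk hL]
  have h1 : ∀ η ∈ quadSector p w,
      (if testFun β L k p w (dropletConfig L k η) ≠ 0 then
        ∑ x : box 2 L, gw β (dropletConfig L k η) * flipRate β x (dropletConfig L k η) *
        (testFun β L k p w (flip x (dropletConfig L k η)) -
          testFun β L k p w (dropletConfig L k η)) ^ 2 else 0) ≤
      1 / 2 * ∑ q : Bool × Bool, ∑ i : Fin p, (amplitude (swapIn q i η) - amplitude η) ^ 2 +
        Real.exp (-(4 * β)) * (side L : ℝ) ^ 2 * amplitude η ^ 2 := by
    intro η hη
    rw [mem_quadSector] at hη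
    have hnn : 0 ≤ 1 / 2 * ∑ q : Bool × Bool, ∑ i : Fin p,
        (amplitude (swapIn q i η) - amplitude η) ^ 2 +
        Real.exp (-(4 * β)) * (side L : ℝ) ^ 2 * amplitude η ^ 2 := by positivity
    split_ifs with h
    · refine local_dirichlet_le hp hwk hL hβ hη ?_
      rw [ne_eq, testFun_eq_zero_iff, profile_dropletConfig hwk hL hη] at h
      exact h
    · exact hnn
  refine (sum_le_sum h1).trans ?_
  rw [sum_add_distrib, ← mul_sum, ← mul_sum, sum_amplitude_sq, sum_comm]
  have h2 : ∀ q ∈ (univ : Finset (Bool × Bool)), ∑ η ∈ quadSector p w, ∑ i : Fin p,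
      (amplitude (swapIn q i η) - amplitude η) ^ 2 ≤
        δ * (∑ ζ ∈ sector p w, pathWeight ζ ^ 2) ^ 4 := by
    intro q _
    rw [sum_comm, sum_congr rfl fun i _ => sum_swapIn_sq p w q i, ← sum_mul, sum_comm]
    have hZ : 0 ≤ (∑ ζ ∈ sector p w, pathWeight ζ ^ 2) ^ 3 :=
      pow_nonneg (sum_nonneg fun _ _ => sq_nonneg _) 3
    refine (mul_le_mul_of_nonneg_right hδ hZ).trans (le_of_eq ?_)
    ring
  have h3 := sum_le_sum h2
  rw [sum_const, card_univ, nsmul_eq_mul] at h3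
  have h4 : ((Fintype.card (Bool × Bool) : ℕ) : ℝ) = 4 := by norm_num
  rw [h4] at h3
  linarith

/-- The two droplet families have `p = L - 2` and `p = L - 1`, for which `10 / p ≤ 30 / L`; the
constant is `2 * (2 * 30 + 1)`. -/
theorem spectralGap_le_of_large (hL : 3 ≤ L) {β : ℝ} (hβ : 0 ≤ β)
    (hε : 200 * (side L : ℝ) ^ 3 * Real.exp (-(4 * β)) ≤ 1) :
    spectralGap β (box 2 L) (plusBoundary (box 2 L)) ≤ 122 / L := by
  obtain ⟨m, rfl⟩ : ∃ m, L = m + 3 := ⟨L - 3, by omega⟩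
  obtain ⟨w, hw0, hw⟩ := exists_sector (p := m + 1) (by omega)
  obtain ⟨w', hw0', hw'⟩ := exists_sector (p := m + 2) (by omega)
  have hsector : ∀ {p w : ℕ}, 0 < ∑ ζ ∈ sector p w, pathWeight ζ ^ 2 → w ≤ p + 1 := by
    intro p w h
    obtain ⟨ζ, hζ, -⟩ := exists_ne_zero_of_sum_ne_zero h.ne'
    simp only [sector, mem_filter, mem_univ, true_and] at hζ
    have := height_le ζ (p + 1)
    omega
  obtain ⟨k, hk⟩ := Nat.exists_eq_add_of_le (hsector hw0)
  obtain ⟨k', hk'⟩ := Nat.exists_eq_add_of_le (hsector hw0')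
  have hεN : Real.exp (-(4 * β)) * (side (m + 3) : ℝ) ^ 2 ≤ 1 / ((m + 3 : ℕ) : ℝ) := by
    have hN : ((m + 3 : ℕ) : ℝ) ≤ side (m + 3) := by
      have : m + 3 ≤ side (m + 3) := by unfold side; omega
      exact_mod_cast this
    have hpos : (0 : ℝ) < ((m + 3 : ℕ) : ℝ) := by positivity
    rw [le_div_iff₀ hpos]
    generalize (side (m + 3) : ℝ) = N at *
    have e := Real.exp_pos (-(4 * β))
    have h1 : Real.exp (-(4 * β)) * N ^ 2 * ((m + 3 : ℕ) : ℝ) ≤ Real.exp (-(4 * β)) * N ^ 2 * N :=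
      mul_le_mul_of_nonneg_left hN (by positivity)
    have h2 : 0 ≤ Real.exp (-(4 * β)) * N ^ 2 * N := by
      have : 0 ≤ N := hpos.le.trans hN
      positivity
    linarith
  have hm0 : (0 : ℝ) ≤ m := Nat.cast_nonneg m
  have hd : (10 : ℝ) / ((m + 1 : ℕ) : ℝ) ≤ 30 / ((m + 3 : ℕ) : ℝ) := by
    push_cast
    rw [div_le_div_iff₀ (by positivity) (by positivity)]
    linarith
  have hd' : (10 : ℝ) / ((m + 2 : ℕ) : ℝ) ≤ 30 / ((m + 3 : ℕ) : ℝ) := by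
    push_cast
    rw [div_le_div_iff₀ (by positivity) (by positivity)]
    linarith
  have hw := hw.trans (mul_le_mul_of_nonneg_right hd hw0.le)
  have hw' := hw'.trans (mul_le_mul_of_nonneg_right hd' hw0'.le)
  have r1 := testFun_rayleigh (by omega) hk.symm (by omega : m + 1 + 1 ≤ m + 3) hβ hw
  have r2 := testFun_rayleigh (by omega) hk'.symm (by omega : m + 2 + 1 ≤ m + 3) hβ hw'
  have m1 := sum_gw_testFun_sq hk.symm (by omega : m + 1 + 1 ≤ m + 3) β
  have m2 := sum_gw_testFun_sq hk'.symm (by omega : m + 2 + 1 ≤ m + 3) β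
  have p1 := (pow_pos hw0 4).trans_eq m1.symm
  have p2 := (pow_pos hw0' 4).trans_eq m2.symm
  clear m1 m2
  refine (spectralGap_le_of_two (f := testFun β (m + 3) k (m + 1) w)
    (g := testFun β (m + 3) k' (m + 2) w') ?_ p1 p2 r1 r2).trans ?_
  · intro σ
    by_contra hne
    have hne' := mul_ne_zero_iff.1 hne
    rw [ne_eq, ne_eq, testFun_eq_zero_iff, testFun_eq_zero_iff] at hne'
    obtain ⟨η, hη, ha, h1⟩ := exists_of_profile_ne_zero hne'.1
    obtain ⟨η', hη', ha', h1'⟩ := exists_of_profile_ne_zero hne'.2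
    have := droplet_size_eq hk.symm hk'.symm hη hη' (isSupported_of_amplitude (by omega) hη ha)
      (isSupported_of_amplitude (by omega) hη' ha') (L := m + 3) (by omega) (by omega)
      fun z hz => by
        rw [← dropletConfig_eq_neg_iff (L := m + 3) (x := ⟨z, hz⟩), h1, ← h1',
          dropletConfig_eq_neg_iff]
    omega
  · have e : (122 : ℝ) / ((m + 3 : ℕ) : ℝ) =
        2 * (2 * (30 / ((m + 3 : ℕ) : ℝ)) + 1 / ((m + 3 : ℕ) : ℝ)) := by ring
    rw [e]
    linarith

theorem small_violation {β : ℝ} (hL : 2 ≤ L) (hβ : 10 * Real.log L ≤ β) :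
    200 * (side L : ℝ) ^ 3 * Real.exp (-(4 * β)) ≤ 1 := by
  have hL2 : (2 : ℝ) ≤ L := by exact_mod_cast hL
  have hL0 : (0 : ℝ) < L := by linarith
  rw [Real.exp_neg, mul_inv_le_iff₀ (Real.exp_pos _), one_mul]
  have h1 : (L : ℝ) ^ 40 ≤ Real.exp (4 * β) := by
    calc (L : ℝ) ^ 40 = Real.exp (Real.log L) ^ 40 := by rw [Real.exp_log hL0]
      _ = Real.exp (40 * Real.log L) := by rw [← Real.exp_nat_mul]; norm_num
      _ ≤ Real.exp (4 * β) := Real.exp_le_exp.2 (by linarith)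
  refine le_trans ?_ h1
  have h2 : (side L : ℝ) ≤ 3 * L := by
    unfold side; push_cast; linarith
  calc 200 * (side L : ℝ) ^ 3 ≤ 200 * (3 * (L : ℝ)) ^ 3 := by gcongr
    _ = 5400 * (L : ℝ) ^ 3 := by ring
    _ ≤ 2 ^ 37 * (L : ℝ) ^ 3 := by
      have : (0 : ℝ) < (L : ℝ) ^ 3 := by positivity
      nlinarith
    _ ≤ (L : ℝ) ^ 37 * (L : ℝ) ^ 3 := by gcongr
    _ = (L : ℝ) ^ 40 := by ring

end IsingGlauber

open IsingGlauber in
theorem one_div_le_spectralGap_of_side {L : ℕ} (hL : 1 ≤ L) {β : ℝ} (hβ : 0 ≤ β)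
    (hε : 200 * (side L : ℝ) ^ 3 * Real.exp (-(4 * β)) ≤ 1) :
    1 / 24 / (L : ℝ) ≤ spectralGap β (box 2 L) (plusBoundary (box 2 L)) := by
  refine le_trans ?_ (le_spectralGap_of_small hL hβ hε)
  have hL1 : (1 : ℝ) ≤ L := by exact_mod_cast hL
  rw [div_div]
  refine one_div_le_one_div_of_le (by positivity) ?_
  unfold side
  push_cast
  linarith

theorem theorem3p5 :
    ∃ C c : ℝ, 0 < C ∧ 0 < c ∧
      ∀ L : ℕ, 1 ≤ L → ∀ β : ℝ, C * Real.log (L : ℝ) ≤ β →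
        c / (L : ℝ) ≤ IsingGlauber.spectralGap β (IsingGlauber.box 2 L)
            (IsingGlauber.plusBoundary (IsingGlauber.box 2 L)) ∧
          IsingGlauber.spectralGap β (IsingGlauber.box 2 L)
            (IsingGlauber.plusBoundary (IsingGlauber.box 2 L)) ≤ 1 / (c * (L : ℝ)) := by
  have hne : ∀ L, (IsingGlauber.box 2 L).Nonempty := fun L =>
    ⟨0, IsingGlauber.mem_box.2 (by simp)⟩
  -- Since `log 1 = 0`, the case `L = 1` includes all `β ≥ 0`; the crude constant serves up to `β =
  -- 3`, beyond which `exp (4 * β) ≥ 200 * 3 ^ 3`.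
  obtain ⟨lam, hlam, hcrude⟩ := IsingGlauber.exists_le_spectralGap (hne 1) (B := 3)
  refine ⟨10, min (1 / 122) lam, by norm_num, by positivity, fun L hL β hβ => ?_⟩
  have hc0 : 0 < min (1 / 122) lam := by positivity
  have hc1 : min (1 / 122) lam ≤ 1 / 122 := min_le_left _ _
  have hc2 : min (1 / 122) lam ≤ lam := min_le_right _ _
  have hL1 : (1 : ℝ) ≤ L := by exact_mod_cast hL
  have hβ0 : 0 ≤ β := le_trans (mul_nonneg (by norm_num) (Real.log_nonneg hL1)) hβ
  have lower : 1 / 24 / (L : ℝ) ≤ IsingGlauber.spectralGap β (IsingGlauber.box 2 L)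
      (IsingGlauber.plusBoundary (IsingGlauber.box 2 L)) →
      min (1 / 122) lam / (L : ℝ) ≤ IsingGlauber.spectralGap β (IsingGlauber.box 2 L)
      (IsingGlauber.plusBoundary (IsingGlauber.box 2 L)) := fun h => by
    refine le_trans ?_ h
    gcongr
    linarith
  constructor
  · rcases hL.eq_or_lt with h | h
    · subst h
      rcases le_total β 3 with h3 | h3
      · have := hcrude β hβ0 h3
        rw [Nat.cast_one, div_one]
        linarith
      · refine lower (one_div_le_spectralGap_of_side le_rfl hβ0 ?_)
        rw [Real.exp_neg, mul_inv_le_iff₀ (Real.exp_pos _), one_mul]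
        have h1 : Real.exp 1 ^ 12 ≤ Real.exp (4 * β) := by
          rw [← Real.exp_nat_mul]
          exact Real.exp_le_exp.2 (by push_cast; linarith)
        refine le_trans ?_ h1
        have h2 : (2.7 : ℝ) ^ 12 ≤ Real.exp 1 ^ 12 := by
          have := Real.exp_one_gt_d9
          gcongr
          linarith
        refine le_trans ?_ h2
        norm_num [IsingGlauber.side]
    · exact lower (one_div_le_spectralGap_of_side hL hβ0 (IsingGlauber.small_violation h hβ))
  · rcases le_or_gt L 2 with h | h
    · refine (IsingGlauber.spectralGap_le_two β (hne L)).trans ?_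
      have hL2 : (L : ℝ) ≤ 2 := by exact_mod_cast h
      rw [le_div_iff₀ (by positivity)]
      nlinarith
    · refine (IsingGlauber.spectralGap_le_of_large h hβ0
        (IsingGlauber.small_violation (by omega) hβ)).trans ?_
      rw [div_le_div_iff₀ (by positivity) (by positivity)]
      nlinarith
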